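/- Let $k$ be an algebraically closed field with $\operatorname{char} k\neq 2$, let $n\ge 0$, and let $\sigma$ be an outer involution of $\mathrm{GL}_n=\mathrm{GL}_n(k)$, i.e. $\sigma^2=1$ and $\sigma(g)=A\,{}^t g^{-1}A^{-1}$ for some $A\in \mathrm{GL}_n$. Then one may take ${}^tA=\varepsilon A$ with $\varepsilon=\pm1$, and $\varepsilon$ is called the sign of $\sigma$ (both signs being allowed if $n=0$). Let $\mathrm{GL}_n\rtimes\langle\sigma\rangle$ be the semidirect product with $\mathbb{Z}/2\mathbb{Z}$ acting through $\sigma$. A subgroup of $\mathrm{GL}_n\rtimes\langle\sigma\rangle$ is called irreducible if it is not contained in the normaliser of a proper parabolic subgroup of $\mathrm{GL}_n$ (the stabiliser of a flag in $k^n$). (1) Let $H_0\subset \mathrm{GL}_n$ be a subgroup and let $x_0\sigma\in \mathrm{GL}_n\sigma$ be a semisimple element that normalises $H_0$ and satisfies $(x_0\sigma)^2\in H_0$. Suppose that the subgroup $H$ generated by $H_0$ and $x_0\sigma$ is irreducible. Then $k^n=\bigoplus_j V_j$, where the $V_j$ are irreducible and pairwise non-isomorphic $H_0$-modules, and there is an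 isomorphism $\prod_j\mu_2\cong C_{\mathrm{GL}_n}(H)$ under which $(\varepsilon_j)_j$ acts on each $V_j$ as the scalar $\varepsilon_j$. (2) Let $\tilde\Pi$ be a normal subgroup of index $2$ of a group $\Pi$, and let $\rho:\Pi\to \mathrm{GL}_n\rtimes\langle\sigma\rangle$ be a homomorphism with $\rho^{-1}(\mathrm{GL}_n)=\tilde\Pi$ which is irreducible, i.e. the Zariski closure of its image is an irreducible subgroup. Then the underlying representation $\tilde\rho=\rho|_{\tilde\Pi}$ on $k^n$ is a direct sum of irreducible, pairwise non-isomorphic representations $V_j$. Each $V_j$ is $\Gamma$-invariant for $\Gamma=\Pi/\tilde\Pi$: for every $\gamma\in\Pi\setminus\tilde\Pi$ the representation $\alpha\mapsto\tilde\rho(\gamma^{-1}\alpha\gamma)|_{V_j}$ is isomorphic to the dual of $\tilde\rho|_{V_j}$. Moreover, conjugation by $\rho(\gamma)$ maps each factor $\mathrm{GL}(V_j)$ of $\prod_i\mathrm{GL}(V_i)\subset\mathrm{GL}_n$ into itself. (3) Let $k=\mathbb{C}$ and let $\varepsilon$ be the sign of $\sigma$. Let $\tilde X$ be a connected complex manifold,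 $p:\tilde X\to X$ an unramified double covering whose non-trivial covering transformation $\tau$ is biholomorphic, and $\tilde x\in\tilde X$. Let $\rho:\pi_1(X,p(\tilde x))\to \mathrm{GL}_n(\mathbb{C})\rtimes\langle\sigma\rangle$ be a homomorphism as in (2) with $\tilde\Pi=\pi_1(\tilde X,\tilde x)$, and suppose that it is irreducible. Let $(\mathcal{E},\nabla)$ be a holomorphic vector bundle with a flat connection on $\tilde X$ whose monodromy representation at $\tilde x$ is, in some basis of $\mathcal{E}_{\tilde x}$, the underlying representation $\tilde\rho$. Call a flat isomorphism $\Phi:\mathcal{F}\to\tau^*\mathcal{F}^\vee$, regarded as a pairing $\mathcal{F}_y\times\mathcal{F}_{\tau(y)}\to\mathbb{C}$, a $\Gamma$-structure on a flat bundle $\mathcal{F}$ if $\Phi(v,w)=\varepsilon\,\Phi(w,v)$ for all $v\in\mathcal{F}_y$, $w\in\mathcal{F}_{\tau(y)}$. Then $(\mathcal{E},\nabla)=\bigoplus_j\mathcal{E}_j$ with irreducible, pairwise non-isomorphic flat subbundles $\mathcal{E}_j$. There exists a $\Gamma$-structure on $\mathcal{E}$; and for every $\Gamma$-structure $\Phi$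 on $\mathcal{E}$ the factors $\mathcal{E}_i$ and $\tau^*\mathcal{E}_j$ are orthogonal for $i\ne j$, and $\Phi$ restricts to a $\Gamma$-structure on each $\mathcal{E}_j$. In particular each $\mathcal{E}_j$ is $\Gamma$-invariant. -/

import Mathlib

open scoped Manifold ContDiff Topology Matrix
open Bundle

noncomputable section

namespace TwistedGL

/-! ### The group `GL_n ⋊ ⟨σ⟩` -/

/-- `GL_n(k)`. -/
abbrev GLn (n : ℕ) (k : Type*) [Field k] : Type _ := Matrix.GeneralLinearGroup (Fin n) k

/-- An exterior (outer) involution of `GL_n`: an automorphism of order two which is the composition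
of transpose-inverse with an inner automorphism. -/
structure OuterInvolution (n : ℕ) (k : Type*) [Field k] where
  aut : MulAut (GLn n k)
  sq_eq_one : aut * aut = 1
  outer : ∃ A : GLn n k, ∀ g : GLn n k,
    (aut g : Matrix (Fin n) (Fin n) k) = A.val * (g⁻¹).valᵀ * (A⁻¹).val

variable {n : ℕ} {k : Type*} [Field k]

/-- The sign of an outer involution `g ↦ A ᵗg⁻¹ A⁻¹`: it is `ε` if `ᵗA = ε A`, so that `ε = 1` is the
orthogonal type and `ε = -1` is the symplectic type. -/
def OuterInvolution.HasSign (σ : OuterInvolution n k) (ε : k) : Prop :=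
  (ε = 1 ∨ ε = -1) ∧ ∃ A : GLn n k,
    (∀ g : GLn n k, (σ.aut g : Matrix (Fin n) (Fin n) k) = A.val * (g⁻¹).valᵀ * (A⁻¹).val) ∧
      A.valᵀ = ε • A.val

/-- The action of `ℤ/2` on `GL_n` through an outer involution. -/
def OuterInvolution.action (σ : OuterInvolution n k) :
    Multiplicative (ZMod 2) →* MulAut (GLn n k) where
  toFun c := if c = 1 then 1 else σ.aut
  map_one' := by simp
  map_mul' := by
    intro a b
    have h : ∀ a b : Multiplicative (ZMod 2), a ≠ 1 → b ≠ 1 → a * b = 1 := by decide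
    by_cases ha : a = 1
    · simp [ha]
    · by_cases hb : b = 1
      · simp [hb]
      · rw [if_pos (h a b ha hb), if_neg ha, if_neg hb, σ.sq_eq_one]

/-- The semidirect product `GL_n ⋊ ⟨σ⟩`. -/
abbrev OuterInvolution.Ext (σ : OuterInvolution n k) : Type _ :=
  GLn n k ⋊[σ.action] Multiplicative (ZMod 2)

/-- The faithful rational representation of `GL_n ⋊ ⟨σ⟩` of dimension `2n` given by
`g ↦ diag(g, σ(g))` on `GL_n` and by the interchange of the two blocks on `σ`. -/
def OuterInvolution.blockRep (σ : OuterInvolution n k) :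
    σ.Ext →* Matrix (Fin n ⊕ Fin n) (Fin n ⊕ Fin n) k where
  toFun x :=
    if x.right = 1 then Matrix.fromBlocks x.left.val 0 0 (σ.aut x.left).val
    else Matrix.fromBlocks 0 x.left.val (σ.aut x.left).val 0
  map_one' := by simp [Matrix.fromBlocks_one]
  map_mul' := by
    intro x y
    have h : ∀ a b : Multiplicative (ZMod 2), a ≠ 1 → b ≠ 1 → a * b = 1 := by decide
    have hσ : ∀ g, σ.aut (σ.aut g) = g := fun g => by
      have := congrArg (fun f : MulAut (GLn n k) => f g) σ.sq_eq_one
      simpa using this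
    by_cases hx : x.right = 1
    · by_cases hy : y.right = 1
      · simp [hx, hy, Matrix.fromBlocks_multiply]
      · simp [hx, hy, Matrix.fromBlocks_multiply]
    · by_cases hy : y.right = 1
      · simp [hx, hy, Matrix.fromBlocks_multiply, OuterInvolution.action, hσ]
      · simp [hx, hy, h _ _ hx hy, Matrix.fromBlocks_multiply, OuterInvolution.action, hσ]

/-- Semisimple elements of the linear algebraic group `GL_n ⋊ ⟨σ⟩`. -/
def OuterInvolution.IsSemisimpleElement (σ : OuterInvolution n k) (x : σ.Ext) : Prop :=
  Module.End.IsSemisimple (Matrix.toLin' (σ.blockRep x))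

/-! ### Zariski closure, parabolic subgroups, irreducible subgroups -/

/-- Zariski closed subsets of `GL_n(k)`. -/
def IsZariskiClosed (S : Set (GLn n k)) : Prop :=
  ∃ I : Set (MvPolynomial (Fin n × Fin n) k),
    S = {g | ∀ f ∈ I, MvPolynomial.eval (fun ij => g.val ij.1 ij.2) f = 0}

/-- Zariski closed subsets of `GL_n ⋊ ⟨σ⟩`, a disjoint union of two copies of `GL_n`. -/
def OuterInvolution.IsZariskiClosed (σ : OuterInvolution n k) (S : Set σ.Ext) : Prop :=
  ∀ c : Multiplicative (ZMod 2), TwistedGL.IsZariskiClosed {g : GLn n k | (⟨g, c⟩ : σ.Ext) ∈ S}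

/-- The Zariski closure of a subgroup: the smallest closed subgroup containing it. -/
def OuterInvolution.zariskiClosure (σ : OuterInvolution n k) (H : Subgroup σ.Ext) :
    Subgroup σ.Ext :=
  sInf {K | H ≤ K ∧ σ.IsZariskiClosed (K : Set σ.Ext)}

/-- The stabiliser in `GL_n(k)` of a family of subspaces of `k^n`. -/
def flagStabilizer (F : Set (Submodule k (Fin n → k))) : Subgroup (GLn n k) where
  carrier := {g | ∀ W ∈ F, ∀ v, g.val *ᵥ v ∈ W ↔ v ∈ W}
  one_mem' := by simp
  mul_mem' := by
    intro a b ha hb W hW v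
    have : (a * b).val *ᵥ v = a.val *ᵥ (b.val *ᵥ v) := by simp [Matrix.mulVec_mulVec]
    rw [this, ha W hW, hb W hW]
  inv_mem' := by
    intro a ha W hW v
    rw [← ha W hW, Matrix.mulVec_mulVec, ← Units.val_mul, mul_inv_cancel, Units.val_one,
      Matrix.one_mulVec]

/-- The parabolic subgroups of `GL_n`: the stabilisers of flags of subspaces of `k^n`. -/
def IsParabolic (P : Subgroup (GLn n k)) : Prop :=
  ∃ F : Set (Submodule k (Fin n → k)), IsChain (· ≤ ·) F ∧ P = flagStabilizer F

/-- A subgroup of `GL_n ⋊ ⟨σ⟩` is irreducible if it is not contained in the normaliser of a proper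
parabolic subgroup of the identity component `GL_n`. -/
def OuterInvolution.IsIrreducible (σ : OuterInvolution n k) (H : Subgroup σ.Ext) : Prop :=
  ∀ P : Subgroup (GLn n k), IsParabolic P → P ≠ ⊤ →
    ¬ H ≤ Subgroup.normalizer
      ((P.map (SemidirectProduct.inl : GLn n k →* σ.Ext) : Subgroup σ.Ext) : Set σ.Ext)

/-! ### Representations -/

/-- The natural representation of `GL_n(k)` on `k^n`. -/
def naturalRep (n : ℕ) (k : Type*) [Field k] : Representation k (GLn n k) (Fin n → k) where
  toFun g := Matrix.mulVecLin g.val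
  map_one' := by ext; simp
  map_mul' a b := by
    ext v
    simp

/-- `V` is the direct sum of the subrepresentations `W j`, which are irreducible and pairwise non
isomorphic. -/
def IsMultiplicityFreeDecomposition {G V : Type*} [Group G] [AddCommGroup V] [Module k V]
    {r : Representation k G V} {m : ℕ} (W : Fin m → Subrepresentation r) : Prop :=
  DirectSum.IsInternal (fun j => (W j).toSubmodule) ∧
    (∀ j, (W j).toRepresentation.IsIrreducible) ∧
    ∀ i j, i ≠ j → IsEmpty ((W i).toRepresentation.Equiv (W j).toRepresentation)

/-- The elements of `GL_n` preserving `W j` and acting trivially on `W i` for `i ≠ j`, i.e. the factor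
`GL(W j)` of `∏ GL(W i)` if `k^n` is the direct sum of the `W i`. -/
def blockFactor {m : ℕ} (W : Fin m → Submodule k (Fin n → k)) (j : Fin m) : Set (GLn n k) :=
  {g | (∀ v, g.val *ᵥ v ∈ W j ↔ v ∈ W j) ∧ ∀ i, i ≠ j → ∀ v ∈ W i, g.val *ᵥ v = v}

/-- For a normal subgroup `N` of index two in `D`: a representation `r` of `N` is `Γ`-invariant,
`Γ = D/N` acting on the general linear group through transpose-inverse, if for each
`γ ∈ D ∖ N` the twist `a ↦ r(γ⁻¹ a γ)` is isomorphic to the dual of `r`. -/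
def IsGammaInvariant {D V : Type*} [Group D] (N : Subgroup D) [N.Normal] [AddCommGroup V]
    [Module k V] (r : Representation k N V) : Prop :=
  ∀ γ : D, γ ∉ N →
    Nonempty (r.dual.Equiv (r.comp (MulAut.conjNormal (H := N) γ⁻¹).toMonoidHom))

/-- `ρ : D → GL_n ⋊ ⟨σ⟩` is a `GL_n ⋊ ⟨σ⟩`-representation relative to `N` if it is compatible with
`D → D/N ≅ ℤ/2`. -/
def OuterInvolution.IsExtRep (σ : OuterInvolution n k) {D : Type*} [Group D] (N : Subgroup D)
    (ρ : D →* σ.Ext) : Prop :=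
  ∀ a : D, (ρ a).right = 1 ↔ a ∈ N

/-- The underlying `GL_n`-representation of a `GL_n ⋊ ⟨σ⟩`-representation, as a homomorphism. -/
def OuterInvolution.IsExtRep.underlying {σ : OuterInvolution n k} {D : Type*} [Group D]
    {N : Subgroup D} {ρ : D →* σ.Ext} (hρ : σ.IsExtRep N ρ) : N →* GLn n k where
  toFun a := (ρ a).left
  map_one' := by simp
  map_mul' a b := by
    have ha : (ρ a).right = 1 := (hρ a).2 a.2
    simp [ha]

/-- The underlying representation on `k^n`. -/
def OuterInvolution.IsExtRep.underlyingRep {σ : OuterInvolution n k} {D : Type*} [Group D]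
    {N : Subgroup D} {ρ : D →* σ.Ext} (hρ : σ.IsExtRep N ρ) :
    Representation k N (Fin n → k) :=
  (naturalRep n k).comp hρ.underlying

/-- A representation is irreducible if the Zariski closure of its image is. -/
def OuterInvolution.IsIrreducibleRep (σ : OuterInvolution n k) {D : Type*} [Group D]
    (ρ : D →* σ.Ext) : Prop :=
  σ.IsIrreducible (σ.zariskiClosure ρ.range)

/-! ### Flat connections -/

section Flat

variable {E : Type*} [NormedAddCommGroup E] [NormedSpace ℂ E]
  {Y : Type*} [TopologicalSpace Y] [ChartedSpace E Y]
  {F : Type*} [NormedAddCommGroup F] [NormedSpace ℂ F]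
  {V : Y → Type*} [TopologicalSpace (TotalSpace F V)]
  [∀ y, AddCommGroup (V y)] [∀ y, Module ℂ (V y)] [∀ y, TopologicalSpace (V y)]
  [∀ y, IsTopologicalAddGroup (V y)] [∀ y, ContinuousSMul ℂ (V y)]
  [FiberBundle F V]

/-- `s` is a holomorphic horizontal section over `U`. -/
def IsHorizontalOn (cov : CovariantDerivative 𝓘(ℂ, E) F V) (s : ∀ y, V y) (U : Set Y) : Prop :=
  ContMDiffOn 𝓘(ℂ, E) (𝓘(ℂ, E).prod 𝓘(ℂ, F)) ω (fun y => TotalSpace.mk' F y (s y)) U ∧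
    ∀ y ∈ U, cov s y = 0

/-- `W` is a flat subbundle: a subbundle on which the connection restricts to a flat connection, in
the sense that it has, locally, frames of holomorphic horizontal sections. -/
def IsFlatSubbundle (cov : CovariantDerivative 𝓘(ℂ, E) F V) (W : ∀ y, Submodule ℂ (V y)) : Prop :=
  ∀ y : Y, ∃ U : Set Y, IsOpen U ∧ y ∈ U ∧ ∃ (d : ℕ) (e : Fin d → ∀ z, V z),
    (∀ i, IsHorizontalOn cov (e i) U) ∧
      ∀ z ∈ U, LinearIndependent ℂ (fun i => e i z) ∧
        Submodule.span ℂ (Set.range fun i => e i z) = W z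

/-- The connection is flat (integrable): locally there are frames of holomorphic horizontal sections,
i.e. locally the bundle with its connection is isomorphic to the trivial bundle with `d`. -/
def IsFlat (cov : CovariantDerivative 𝓘(ℂ, E) F V) : Prop :=
  IsFlatSubbundle cov (fun _ => ⊤)

/-- A flat subbundle is irreducible if it is nonzero and has no flat subbundles other than zero and
itself. -/
def IsIrreducibleFlat (cov : CovariantDerivative 𝓘(ℂ, E) F V) (W : ∀ y, Submodule ℂ (V y)) : Prop :=
  W ≠ (fun _ => ⊥) ∧ ∀ W' : ∀ y, Submodule ℂ (V y), IsFlatSubbundle cov W' → (∀ y, W' y ≤ W y) →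
    W' = (fun _ => ⊥) ∨ W' = W

/-- The flat subbundles `W` and `W'` are isomorphic as flat bundles: there are fibrewise linear
bijections `W y → W' y` carrying horizontal sections to horizontal sections. -/
def FlatIsomorphic (cov : CovariantDerivative 𝓘(ℂ, E) F V) (W W' : ∀ y, Submodule ℂ (V y)) : Prop :=
  ∃ φ : ∀ y, V y →ₗ[ℂ] V y,
    (∀ y, Set.BijOn (φ y) (W y) (W' y)) ∧
      ∀ (U : Set Y) (s : ∀ y, V y), IsOpen U → (∀ y ∈ U, s y ∈ W y) → IsHorizontalOn cov s U →
        IsHorizontalOn cov (fun y => φ y (s y)) U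

/-- An isomorphism of flat bundles `Φ : W → τ^* W^∨`, written as a pairing
`Φ y (τ y) : W y × W (τ y) → ℂ` which is perfect and horizontal (it is locally constant on pairs of
horizontal sections). The cocycle condition on `Φ` for the involution `σ` of sign `ε` is
`Φ(v, w) = ε Φ(w, v)`. Only the values `Φ y z` with `z = τ y` matter. -/
structure IsInvariantPairing (cov : CovariantDerivative 𝓘(ℂ, E) F V) (τ : Y → Y) (ε : ℂ)
    (W : ∀ y, Submodule ℂ (V y)) (Φ : ∀ y z, V y →ₗ[ℂ] V z →ₗ[ℂ] ℂ) : Prop where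
  horizontal : ∀ (U U' : Set Y) (s t : ∀ y, V y), IsOpen U → IsOpen U' → (∀ y ∈ U, τ y ∈ U') →
    IsHorizontalOn cov s U → IsHorizontalOn cov t U' →
    (∀ y ∈ U, s y ∈ W y) → (∀ y ∈ U', t y ∈ W y) →
    ∀ y ∈ U, ∀ᶠ z in 𝓝 y, Φ z (τ z) (s z) (t (τ z)) = Φ y (τ y) (s y) (t (τ y))
  left_nondegenerate : ∀ y, ∀ v ∈ W y, (∀ w ∈ W (τ y), Φ y (τ y) v w = 0) → v = 0
  right_nondegenerate : ∀ y, ∀ w ∈ W (τ y), (∀ v ∈ W y, Φ y (τ y) v w = 0) → w = 0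
  cocycle : ∀ y z, z = τ y → ∀ v ∈ W y, ∀ w ∈ W z, Φ y z v w = ε * Φ z y w v

/-- `s` is a horizontal lift of the path `γ`: near each parameter it is the restriction to `γ` of a
local horizontal section. -/
def IsHorizontalLift (cov : CovariantDerivative 𝓘(ℂ, E) F V) {x y : Y} (γ : Path x y)
    (s : unitInterval → TotalSpace F V) : Prop :=
  ∀ t, ∃ (U : Set Y) (u : ∀ y, V y), IsOpen U ∧ γ t ∈ U ∧ IsHorizontalOn cov u U ∧
    ∀ᶠ t' in 𝓝 t, s t' = TotalSpace.mk' F (γ t') (u (γ t'))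

/-- In the basis `b` of the fibre at `x`, parallel transport around a loop `γ` at `x` is given by the
matrix `r [γ]`. -/
def HasMonodromy (cov : CovariantDerivative 𝓘(ℂ, E) F V) {n : ℕ} {x : Y}
    (b : Module.Basis (Fin n) ℂ (V x)) (r : FundamentalGroup Y x → GLn n ℂ) : Prop :=
  ∀ (γ : Path x x) (c : Fin n → ℂ), ∃ s : unitInterval → TotalSpace F V,
    IsHorizontalLift cov γ s ∧
      s 0 = TotalSpace.mk' F x (b.equivFun.symm c) ∧
      s 1 = TotalSpace.mk' F x (b.equivFun.symm
        ((r (FundamentalGroup.fromPath (Path.Homotopic.Quotient.mk γ))).val *ᵥ c))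

/-- `p : Y → X` is an unramified double covering, with non-trivial covering transformation `τ`. -/
structure IsDoubleCover {X : Type*} [TopologicalSpace X] (p : C(Y, X)) (τ : Y → Y) : Prop where
  covering : IsCoveringMap p
  surjective : Function.Surjective p
  free : ∀ y, τ y ≠ y
  fibre : ∀ y z, p y = p z ↔ z = y ∨ z = τ y

end Flat

end TwistedGL

end

/-! All three assertions rest on one bilinear form. If `σ(g) = A ᵗg⁻¹ A⁻¹` and `x = x₀σ` lies
outside `GL_n`, put `B(v, w) = ᵗv (x₀A)⁻¹ w`. Then `B(gv, (x g x⁻¹)w) = B(v, w)` for `g` in `GL_n`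
(`form_conj`), and `B(w, v) = c B(v, x²w)`, where `c` is the scalar with `ᵗA⁻¹ = c A⁻¹`
(`form_flip`). For a group that `x` normalises and that contains `x²`, this makes `B` a
nondegenerate form, invariant up to a twist of its first argument, whose left and right orthogonals
of a subrepresentation coincide.

Irreducibility says that `B` is anisotropic on subrepresentations: if `U ≠ 0` were totally
isotropic, the stabiliser of the flag `U ≤ U^⊥` would be a proper parabolic subgroup, normalised by
the group because conjugation by `x` exchanges the conditions at `U` and `U^⊥`
(`extForm_isAnisotropic`). Such normalisers are Zariski closed, so passing to the closure of the
group changes nothing.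

Anisotropy gives `V = U ⊕ U^⊥` for every subrepresentation, hence an orthogonal sum of irreducibles.
Two orthogonal isomorphic summands would carry proportional forms, and over an algebraically closed
field a suitable graph in their sum would be isotropic (`isEmpty_equiv`); so the summands are
pairwise non-isomorphic. By Schur's lemma, twisted invariant forms vanish between distinct summands
and are multiples of `B` on each one. An element centralising the group is therefore a scalar on
each summand, and preserving `B` makes the scalar `±1`. Likewise `B` identifies the twist of each
summand with its dual, and conjugation by `x` is an inverse adjoint for `B`, so it respects the
blocks.

For flat bundles, the horizontal sections form a covering space of the base
(`IsFlat.isCoveringMap`), whose monodromy is parallel transport. Fibres at the base point then turn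
flat subbundles into subrepresentations and `Γ`-structures into twisted invariant forms, with `x`
the image under `ρ` of the projection of a path `δ` from `y₀` to `τ y₀`. -/

namespace TwistedGL

/-! ### Twisted invariant forms and orthogonal decomposition -/

section TwistedForm

variable {k G V : Type*} [Field k] [Group G] [AddCommGroup V] [Module k V]

/-- A nondegenerate bilinear form on a representation which is invariant up to a twist of the group
acting on its first argument, and which is symmetric up to a scalar and a group element. -/
structure TwistedForm (r : Representation k G V) where
  form : V →ₗ[k] V →ₗ[k] k
  twist : G → G
  invariant : ∀ g v w, form (r (twist g) v) (r g w) = form v w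
  element : G
  scalar : k
  flip : ∀ v w, form w v = scalar * form v (r element w)
  nondegenerate : ∀ v, (∀ w, form w v = 0) → v = 0

theorem isIrreducible_toRepresentation {r : Representation k G V} (U : Subrepresentation r)
    (hU : U ≠ ⊥) (h : ∀ X : Subrepresentation r, X ≤ U → X = ⊥ ∨ X = U) :
    U.toRepresentation.IsIrreducible := by
  have key : ∀ Y : Subrepresentation U.toRepresentation, Y = ⊥ ∨ Y = ⊤ := by
    intro Y
    let X : Subrepresentation r :=
      ⟨Y.toSubmodule.map U.toSubmodule.subtype, by
        rintro g _ ⟨v, hv, rfl⟩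
        exact ⟨U.toRepresentation g v, Y.apply_mem_toSubmodule g hv, rfl⟩⟩
    have hX : X ≤ U := by
      rintro _ ⟨v, -, rfl⟩
      exact v.2
    rcases h X hX with h | h
    · left
      apply Subrepresentation.toSubmodule_injective
      have h' : Y.toSubmodule.map U.toSubmodule.subtype = ⊥ :=
        congrArg Subrepresentation.toSubmodule h
      apply Submodule.map_injective_of_injective (f := U.toSubmodule.subtype) Subtype.val_injective
      rw [h']
      exact (Submodule.map_bot _).symm
    · right
      apply Subrepresentation.toSubmodule_injective
      have h' : Y.toSubmodule.map U.toSubmodule.subtype = U.toSubmodule :=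
        congrArg Subrepresentation.toSubmodule h
      apply Submodule.map_injective_of_injective (f := U.toSubmodule.subtype) Subtype.val_injective
      rw [h']
      exact (Submodule.map_subtype_top _).symm
  refine @IsSimpleOrder.mk _ _ _ ⟨⟨⊥, ⊤, fun hbt => hU ?_⟩⟩ key
  apply Subrepresentation.toSubmodule_injective
  have h' : (⊥ : Submodule k U.toSubmodule) = ⊤ := congrArg Subrepresentation.toSubmodule hbt
  have h'' := congrArg (Submodule.map U.toSubmodule.subtype) h'
  rw [Submodule.map_bot, Submodule.map_subtype_top] at h''
  exact h''.symm

theorem eq_bot_or_eq_of_le {r : Representation k G V} {U : Subrepresentation r}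
    (h : U.toRepresentation.IsIrreducible) {X : Subrepresentation r} (hX : X ≤ U) :
    X = ⊥ ∨ X = U := by
  let Y : Subrepresentation U.toRepresentation :=
    ⟨X.toSubmodule.comap U.toSubmodule.subtype, fun g v hv => X.apply_mem_toSubmodule g hv⟩
  have hY : Y.toSubmodule.map U.toSubmodule.subtype = X.toSubmodule := by
    rw [Submodule.map_comap_subtype]
    exact inf_eq_right.2 hX
  rcases h.eq_bot_or_eq_top Y with h | h
  · left
    apply Subrepresentation.toSubmodule_injective
    rw [← hY, h]
    exact Submodule.map_bot _
  · right
    apply Subrepresentation.toSubmodule_injective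
    rw [← hY, h]
    exact Submodule.map_subtype_top _

theorem ne_bot_of_isIrreducible {r : Representation k G V} {U : Subrepresentation r}
    (h : U.toRepresentation.IsIrreducible) : U ≠ ⊥ := by
  rintro rfl
  have : (⊥ : Subrepresentation (⊥ : Subrepresentation r).toRepresentation) ≠ ⊤ := bot_ne_top
  apply this
  apply Subrepresentation.toSubmodule_injective
  change (⊥ : Submodule k (⊥ : Submodule k V)) = ⊤
  exact Subsingleton.elim _ _

namespace TwistedForm

variable {r : Representation k G V} (B : TwistedForm r)

/-- The orthogonal of a subrepresentation. -/
def orthogonal (U : Subrepresentation r) : Subrepresentation r where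
  toSubmodule :=
    { carrier := {w | ∀ u ∈ U, B.form u w = 0}
      zero_mem' := by simp
      add_mem' := by
        intro a b ha hb u hu
        rw [map_add, ha u hu, hb u hu, add_zero]
      smul_mem' := by
        intro c a ha u hu
        rw [map_smul, ha u hu, smul_zero] }
  apply_mem_toSubmodule := by
    intro g w hw u hu
    have h := B.invariant g (r (B.twist g)⁻¹ u) w
    rw [Representation.self_inv_apply] at h
    rw [h]
    exact hw _ (U.apply_mem_toSubmodule _ hu)

/-- By `flip`, exchanging the arguments costs a scalar and a group element, and the latter preserves
the orthogonal. So orthogonality of subrepresentations is a symmetric relation although the form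
need not be symmetric. -/
theorem form_eq_zero_of_mem_orthogonal {U : Subrepresentation r} {u w : V}
    (hw : w ∈ B.orthogonal U) (hu : u ∈ U) : B.form w u = 0 := by
  rw [B.flip, (B.orthogonal U).apply_mem_toSubmodule B.element hw u hu, mul_zero]

/-- Double orthogonality: one inclusion is the symmetry of orthogonality, equality follows by
counting dimensions. -/
theorem mem_of_form_orthogonal_eq_zero [FiniteDimensional k V] {U : Subrepresentation r} {v : V}
    (h : ∀ w ∈ B.orthogonal U, B.form w v = 0) : v ∈ U := by
  have hnd : LinearMap.BilinForm.Nondegenerate B.form := by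
    refine ⟨fun v hv => B.nondegenerate v fun w => ?_, B.nondegenerate⟩
    rw [B.flip, hv, mul_zero]
  have hle : U ≤ B.orthogonal (B.orthogonal U) := fun u hu w hw =>
    B.form_eq_zero_of_mem_orthogonal hw hu
  have hd : ∀ X : Subrepresentation r, Module.finrank k (B.orthogonal X).toSubmodule =
      Module.finrank k V - Module.finrank k X.toSubmodule :=
    fun X => LinearMap.BilinForm.finrank_orthogonal hnd X.toSubmodule
  have hU : U.toSubmodule = (B.orthogonal (B.orthogonal U)).toSubmodule := by
    refine Submodule.eq_of_le_of_finrank_eq hle ?_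
    have := Submodule.finrank_le U.toSubmodule
    rw [hd, hd]
    omega
  change v ∈ U.toSubmodule
  rw [hU]
  exact h

/-- There are no nonzero totally isotropic subrepresentations. -/
def IsAnisotropic : Prop :=
  ∀ U : Subrepresentation r, (∀ u ∈ U, ∀ v ∈ U, B.form u v = 0) → U = ⊥

variable {B}

theorem IsAnisotropic.inf_orthogonal (hB : B.IsAnisotropic) (U : Subrepresentation r) :
    U ⊓ B.orthogonal U = ⊥ :=
  hB _ fun _ hu _ hv => hv.2 _ hu.1

theorem IsAnisotropic.eq_zero (hB : B.IsAnisotropic) {U : Subrepresentation r} {u : V}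
    (hu : u ∈ U) (h : ∀ v ∈ U, B.form v u = 0) : u = 0 := by
  have : u ∈ U ⊓ B.orthogonal U := ⟨hu, h⟩
  rw [hB.inf_orthogonal U] at this
  exact this

/-- The isomorphism of an anisotropic subrepresentation with its dual space. -/
noncomputable def IsAnisotropic.dualEquiv [FiniteDimensional k V] (hB : B.IsAnisotropic)
    (U : Subrepresentation r) : U.toSubmodule ≃ₗ[k] Module.Dual k U.toSubmodule :=
  LinearMap.linearEquivOfInjective
    (B.form.domRestrict₁₂ U.toSubmodule U.toSubmodule).flip
    (by
      rw [← LinearMap.ker_eq_bot, LinearMap.ker_eq_bot']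
      intro u hu
      apply Subtype.ext
      exact hB.eq_zero u.2 fun v hv => LinearMap.congr_fun hu ⟨v, hv⟩)
    Subspace.dual_finrank_eq.symm

theorem IsAnisotropic.dualEquiv_apply [FiniteDimensional k V] (hB : B.IsAnisotropic)
    (U : Subrepresentation r) (u v : U.toSubmodule) :
    hB.dualEquiv U u v = B.form v u := rfl

theorem IsAnisotropic.form_dualEquiv_symm [FiniteDimensional k V] (hB : B.IsAnisotropic)
    (U : Subrepresentation r) (f : Module.Dual k U.toSubmodule) (v : U.toSubmodule) :
    B.form v ((hB.dualEquiv U).symm f) = f v := by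
  rw [← hB.dualEquiv_apply, LinearEquiv.apply_symm_apply]

theorem IsAnisotropic.exists_sub_mem_orthogonal [FiniteDimensional k V] (hB : B.IsAnisotropic)
    (U : Subrepresentation r) (v : V) : ∃ u ∈ U, v - u ∈ B.orthogonal U := by
  refine ⟨(hB.dualEquiv U).symm ((B.form.flip v).domRestrict U.toSubmodule), Subtype.prop _, ?_⟩
  intro u hu
  have := hB.form_dualEquiv_symm U ((B.form.flip v).domRestrict U.toSubmodule) ⟨u, hu⟩
  rw [map_sub, this]
  exact sub_self _

/-- Twisted invariant pairings of an anisotropic subrepresentation `U` with a subrepresentation `X`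
are represented by intertwining maps from `X` to `U`. -/
theorem IsAnisotropic.exists_intertwiningMap [FiniteDimensional k V] (hB : B.IsAnisotropic)
    (U X : Subrepresentation r) (C : U.toSubmodule →ₗ[k] X.toSubmodule →ₗ[k] k)
    (hC : ∀ g v w, C (U.toRepresentation (B.twist g) v) (X.toRepresentation g w) = C v w) :
    ∃ T : Representation.IntertwiningMap X.toRepresentation U.toRepresentation,
      ∀ (v : U.toSubmodule) (w : X.toSubmodule), B.form v (T w) = C v w := by
  have h : ∀ (v : U.toSubmodule) (w : X.toSubmodule),
      B.form v ((hB.dualEquiv U).symm (C.flip w)) = C v w :=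
    fun v w => hB.form_dualEquiv_symm U (C.flip w) v
  refine ⟨⟨(hB.dualEquiv U).symm.toLinearMap ∘ₗ C.flip, ?_⟩, fun v w => h v w⟩
  intro g
  ext w : 1
  apply (hB.dualEquiv U).injective
  ext v
  -- `twist` is a mere function, so the action of `twist g` on the first argument is undone by the
  -- inverse of `twist g` itself.
  have h1 := hC g (U.toRepresentation (B.twist g)⁻¹ v) w
  rw [Representation.self_inv_apply] at h1
  have h2 := B.invariant g (r (B.twist g)⁻¹ v) ((hB.dualEquiv U).symm (C.flip w))
  rw [Representation.self_inv_apply] at h2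
  exact (h v (X.toRepresentation g w)).trans
    (h1.trans ((h (U.toRepresentation (B.twist g)⁻¹ v) w).symm.trans h2.symm))

/-- Any twisted invariant form pairs non-isomorphic irreducible orthogonal summands trivially. -/
theorem IsAnisotropic.form_eq_zero [FiniteDimensional k V] (hB : B.IsAnisotropic)
    {U X : Subrepresentation r} (hU : U.toRepresentation.IsIrreducible)
    (hX : X.toRepresentation.IsIrreducible)
    (hUX : IsEmpty (U.toRepresentation.Equiv X.toRepresentation))
    (C : V →ₗ[k] V →ₗ[k] k) (hC : ∀ g v w, C (r (B.twist g) v) (r g w) = C v w)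
    {v w : V} (hv : v ∈ U) (hw : w ∈ X) : C v w = 0 := by
  obtain ⟨T, hT⟩ := hB.exists_intertwiningMap U X (C.domRestrict₁₂ U.toSubmodule X.toSubmodule)
    fun g v w => hC g v w
  have hT0 : T = 0 := (Representation.IsIrreducible.bijective_or_eq_zero T).resolve_left
    fun h => hUX.false (Representation.IntertwiningMap.ofBijective T h).symm
  have := hT ⟨v, hv⟩ ⟨w, hw⟩
  rw [hT0] at this
  exact this.symm.trans (map_zero _)

/-- A twisted invariant form on an irreducible subrepresentation is unique up to a scalar. -/
theorem IsAnisotropic.exists_scalar [FiniteDimensional k V] [IsAlgClosed k] (hB : B.IsAnisotropic)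
    {U : Subrepresentation r} (hU : U.toRepresentation.IsIrreducible)
    (C : U.toSubmodule →ₗ[k] U.toSubmodule →ₗ[k] k)
    (hC : ∀ g v w, C (U.toRepresentation (B.twist g) v) (U.toRepresentation g w) = C v w) :
    ∃ c : k, ∀ v w : U.toSubmodule, C v w = c * B.form v w := by
  obtain ⟨T, hT⟩ := hB.exists_intertwiningMap U U C hC
  obtain ⟨c, rfl⟩ :=
    (Representation.IsIrreducible.algebraMap_intertwiningMap_bijective_of_isAlgClosed
      (ρ := U.toRepresentation)).2 T
  refine ⟨c, fun v w => ?_⟩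
  rw [← hT]
  exact map_smul (B.form v) c (w : V)

/-- An isomorphism `f : U → X` pulls the form on `X` back to `c` times the form on `U`, by Schur's
lemma. With `a² = -c`, the subrepresentation of all `a u + f u` is totally isotropic, since the
cross terms vanish by orthogonality. By anisotropy it is zero, which forces `f = 0`. -/
theorem IsAnisotropic.isEmpty_equiv [FiniteDimensional k V] [IsAlgClosed k] (hB : B.IsAnisotropic)
    {U X : Subrepresentation r} (hU : U.toRepresentation.IsIrreducible)
    (hUX : ∀ u ∈ U, ∀ x ∈ X, B.form u x = 0) :
    IsEmpty (U.toRepresentation.Equiv X.toRepresentation) := by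
  refine ⟨fun φ => ?_⟩
  have hφ : ∀ g u, φ (U.toRepresentation g u) = X.toRepresentation g (φ u) :=
    fun g u => φ.toIntertwiningMap.isIntertwining _ _ g u
  let f : U.toSubmodule →ₗ[k] V := X.toSubmodule.subtype ∘ₗ φ.toIntertwiningMap.toLinearMap
  have hf : ∀ g u, f (U.toRepresentation g u) = r g (f u) := fun g u =>
    congrArg Subtype.val (hφ g u)
  have hfX : ∀ u, f u ∈ X := fun u => (φ u).2
  obtain ⟨c, hc⟩ := hB.exists_scalar hU (B.form.compl₁₂ f f) (by
    intro g v w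
    rw [LinearMap.compl₁₂_apply, LinearMap.compl₁₂_apply, hf, hf]
    exact B.invariant _ _ _)
  obtain ⟨a, ha⟩ := IsAlgClosed.exists_pow_nat_eq (-c) (n := 2) two_pos
  have hXU : ∀ u ∈ U, ∀ x ∈ X, B.form x u = 0 := fun u hu x hx =>
    B.form_eq_zero_of_mem_orthogonal (U := U) (fun u hu => hUX u hu x hx) hu
  let h : U.toSubmodule →ₗ[k] V := a • U.toSubmodule.subtype + f
  have hh : ∀ u, h u = a • (u : V) + f u := fun u => rfl
  let Z : Subrepresentation r := ⟨LinearMap.range h, by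
    rintro g _ ⟨u, rfl⟩
    refine ⟨U.toRepresentation g u, ?_⟩
    rw [hh, hh, hf, map_add, map_smul]
    rfl⟩
  have hZ : Z = ⊥ := by
    apply hB
    rintro _ ⟨u, rfl⟩ _ ⟨v, rfl⟩
    have := hc u v
    rw [LinearMap.compl₁₂_apply] at this
    rw [hh, hh]
    simp only [map_add, map_smul, LinearMap.add_apply, LinearMap.smul_apply, smul_eq_mul]
    rw [hUX u u.2 _ (hfX v), hXU v v.2 _ (hfX u), this]
    linear_combination (B.form u v) * ha
  apply ne_bot_of_isIrreducible hU
  rw [eq_bot_iff]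
  intro u hu
  have h0 : h ⟨u, hu⟩ ∈ Z := ⟨_, rfl⟩
  rw [hZ] at h0
  have h1 : a • u + f ⟨u, hu⟩ = 0 := h0
  -- Pairing `a u + f u = 0` with `X` kills the first term, so `f u` is an element of `X` orthogonal
  -- to `X`.
  have hfu : f ⟨u, hu⟩ = 0 := by
    apply hB.eq_zero (hfX _)
    intro x hx
    have := congrArg (B.form x) h1
    rwa [map_add, map_smul, hXU u hu x hx, smul_zero, zero_add, map_zero] at this
  have hφ0 : φ ⟨u, hu⟩ = 0 := Subtype.ext hfu
  have hinj : (⟨u, hu⟩ : U.toSubmodule) = 0 := by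
    apply φ.toLinearEquiv.injective
    rw [map_zero]
    exact hφ0
  exact congrArg Subtype.val hinj

/-- Orthogonal decomposition of a subrepresentation into irreducible subrepresentations. -/
theorem IsAnisotropic.exists_decomposition_of_subrepresentation [FiniteDimensional k V]
    (hB : B.IsAnisotropic) (d : ℕ) :
    ∀ X : Subrepresentation r, Module.finrank k X.toSubmodule = d →
      ∃ (m : ℕ) (W : Fin m → Subrepresentation r),
        (∀ j, (W j).toRepresentation.IsIrreducible) ∧
        (∀ i j, i ≠ j → ∀ v ∈ W i, ∀ w ∈ W j, B.form v w = 0) ∧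
        ⨆ j, (W j).toSubmodule = X.toSubmodule := by
  induction d using Nat.strong_induction_on with
  | _ d ih =>
    intro X hX
    by_cases hX0 : X = ⊥
    · subst hX0
      exact ⟨0, Fin.elim0, fun j => j.elim0, fun j => j.elim0, by rw [iSup_of_empty]; rfl⟩
    obtain ⟨U, ⟨hUX, hU0⟩, hUmin⟩ := WellFounded.has_min
      (InvImage.wf (fun U : Subrepresentation r => Module.finrank k U.toSubmodule) wellFounded_lt)
      {U | U ≤ X ∧ U ≠ ⊥} ⟨X, le_rfl, hX0⟩
    have hUirr : U.toRepresentation.IsIrreducible := by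
      refine isIrreducible_toRepresentation U hU0 fun Y hY => ?_
      by_cases hY0 : Y = ⊥
      · exact Or.inl hY0
      right
      apply Subrepresentation.toSubmodule_injective
      exact Submodule.eq_of_le_of_finrank_le hY (not_lt.1 (hUmin Y ⟨hY.trans hUX, hY0⟩))
    -- The complement of the minimal piece `U` inside `X`; it is strictly smaller because `U` meets
    -- its orthogonal trivially.
    let Y : Subrepresentation r := X ⊓ B.orthogonal U
    have hYX : Y.toSubmodule < X.toSubmodule := by
      refine lt_of_le_of_ne (fun v hv => hv.1) fun h => hU0 ?_
      rw [eq_bot_iff]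
      intro u hu
      have : u ∈ Y.toSubmodule := h ▸ hUX hu
      exact hB.eq_zero hu this.2
    have hlt := Submodule.finrank_lt_finrank_of_lt hYX
    obtain ⟨m, W, hW1, hW2, hW3⟩ := ih _ (hX ▸ hlt) Y rfl
    have hWY : ∀ j, ∀ w ∈ W j, w ∈ B.orthogonal U := fun j w hw => by
      have : w ∈ Y.toSubmodule := hW3 ▸ Submodule.mem_iSup_of_mem j hw
      exact this.2
    refine ⟨m + 1, Fin.cons U W, ?_, ?_, ?_⟩
    · intro j
      refine Fin.cases hUirr (fun j => ?_) j
      exact hW1 j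
    · intro i j
      refine Fin.cases ?_ (fun i => ?_) i <;> refine Fin.cases ?_ (fun j => ?_) j
      · exact fun h => (h rfl).elim
      · exact fun _ v hv w hw => hWY j w hw v hv
      · exact fun _ v hv w hw => B.form_eq_zero_of_mem_orthogonal (hWY i v hv) hw
      · exact fun h => hW2 i j fun hij => h (congrArg Fin.succ hij)
    · apply le_antisymm
      · refine iSup_le fun j => ?_
        refine Fin.cases hUX (fun j => ?_) j
        exact (le_iSup (fun j => (W j).toSubmodule) j).trans (hW3.le.trans hYX.le)
      · intro x hx
        obtain ⟨u, hu, hxu⟩ := hB.exists_sub_mem_orthogonal U x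
        have h1 : u ∈ ⨆ j, ((Fin.cons U W : Fin (m + 1) → Subrepresentation r) j).toSubmodule :=
          Submodule.mem_iSup_of_mem 0 hu
        have h2 : x - u ∈ Y.toSubmodule := ⟨X.toSubmodule.sub_mem hx (hUX hu), hxu⟩
        rw [← hW3] at h2
        have h3 : x - u ∈ ⨆ j, ((Fin.cons U W : Fin (m + 1) → Subrepresentation r) j).toSubmodule :=
          (iSup_le fun j => le_iSup
            (fun j => ((Fin.cons U W : Fin (m + 1) → Subrepresentation r) j).toSubmodule) j.succ :
            ⨆ j, (W j).toSubmodule ≤ _) h2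
        have := Submodule.add_mem _ h1 h3
        rwa [add_sub_cancel] at this

theorem IsAnisotropic.exists_decomposition [FiniteDimensional k V] [IsAlgClosed k]
    (hB : B.IsAnisotropic) :
    ∃ (m : ℕ) (W : Fin m → Subrepresentation r), IsMultiplicityFreeDecomposition W ∧
      ∀ i j, i ≠ j → ∀ v ∈ W i, ∀ w ∈ W j, B.form v w = 0 := by
  classical
  obtain ⟨m, W, hW1, hW2, hW3⟩ := hB.exists_decomposition_of_subrepresentation _ ⊤ rfl
  refine ⟨m, W, ⟨?_, hW1, ?_⟩, hW2⟩
  · rw [DirectSum.isInternal_submodule_iff_iSupIndep_and_iSup_eq_top]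
    refine ⟨fun i => ?_, hW3⟩
    rw [Submodule.disjoint_def]
    intro v hv hv'
    apply hB.eq_zero hv
    have : ⨆ j, ⨆ (_ : j ≠ i), (W j).toSubmodule ≤ (B.orthogonal (W i)).toSubmodule :=
      iSup₂_le fun j hj w hw u hu => hW2 i j hj.symm u hu w hw
    exact fun u hu => this hv' u hu
  · exact fun i j hij => hB.isEmpty_equiv (hW1 i) fun u hu x hx => hW2 i j hij u hu x hx

end TwistedForm

end TwistedForm

/-! ### Polynomial conditions on `GL_n` -/

section ZariskiClosed

variable {n : ℕ} {k : Type*} [Field k]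

theorem isZariskiClosed_iInter {ι : Sort*} {S : ι → Set (GLn n k)}
    (h : ∀ i, IsZariskiClosed (S i)) : IsZariskiClosed (⋂ i, S i) := by
  choose I hI using h
  refine ⟨⋃ i, I i, ?_⟩
  ext g
  simp only [Set.mem_iInter, Set.mem_ofPred_eq, Set.mem_iUnion, forall_exists_index]
  constructor
  · intro h f i hf
    have := h i
    rw [hI i] at this
    exact this f hf
  · intro h i
    rw [hI i]
    exact fun f hf => h f i hf

/-- Matrix valued functions on `GL_n` whose entries are polynomials in the matrix entries. -/
def IsPolynomialMatrix (Q : GLn n k → Matrix (Fin n) (Fin n) k) : Prop :=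
  ∃ R : Matrix (Fin n) (Fin n) (MvPolynomial (Fin n × Fin n) k),
    ∀ g, Q g = R.map (MvPolynomial.eval fun ij => g.val ij.1 ij.2)

theorem IsPolynomialMatrix.const (a : Matrix (Fin n) (Fin n) k) :
    IsPolynomialMatrix fun _ => a :=
  ⟨a.map MvPolynomial.C, fun g => by ext; simp⟩

theorem IsPolynomialMatrix.val : IsPolynomialMatrix fun g : GLn n k => g.val :=
  ⟨Matrix.of fun i j => MvPolynomial.X (i, j), fun g => by ext; simp⟩

theorem IsPolynomialMatrix.mul {Q Q' : GLn n k → Matrix (Fin n) (Fin n) k}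
    (h : IsPolynomialMatrix Q) (h' : IsPolynomialMatrix Q') :
    IsPolynomialMatrix fun g => Q g * Q' g := by
  obtain ⟨R, hR⟩ := h
  obtain ⟨R', hR'⟩ := h'
  exact ⟨R * R', fun g => by
    change Q g * Q' g = _
    rw [hR, hR', Matrix.map_mul]⟩

theorem IsPolynomialMatrix.transpose {Q : GLn n k → Matrix (Fin n) (Fin n) k}
    (h : IsPolynomialMatrix Q) : IsPolynomialMatrix fun g => (Q g)ᵀ := by
  obtain ⟨R, hR⟩ := h
  exact ⟨Rᵀ, fun g => by
    change (Q g)ᵀ = _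
    rw [hR, Matrix.transpose_map]⟩

theorem IsPolynomialMatrix.adjugate {Q : GLn n k → Matrix (Fin n) (Fin n) k}
    (h : IsPolynomialMatrix Q) : IsPolynomialMatrix fun g => (Q g).adjugate := by
  obtain ⟨R, hR⟩ := h
  refine ⟨R.adjugate, fun g => ?_⟩
  change (Q g).adjugate = _
  rw [hR]
  exact (RingHom.map_adjugate
    (MvPolynomial.eval fun ij : Fin n × Fin n => g.val ij.1 ij.2) R).symm

/-- The equations are `f (Q g v) = 0` for `v` in `W` and `f` in the annihilator of `W`; over a field
these linear forms cut out `W`. -/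
theorem IsPolynomialMatrix.isZariskiClosed {Q : GLn n k → Matrix (Fin n) (Fin n) k}
    (h : IsPolynomialMatrix Q) (W : Submodule k (Fin n → k)) :
    IsZariskiClosed {g | ∀ v ∈ W, Q g *ᵥ v ∈ W} := by
  obtain ⟨R, hR⟩ := h
  refine ⟨{q | ∃ v ∈ W, ∃ f ∈ W.dualAnnihilator,
    q = ∑ i, ∑ j, MvPolynomial.C (f (Pi.single i 1)) * (R i j * MvPolynomial.C (v j))}, ?_⟩
  have key : ∀ (g : GLn n k) (f : Module.Dual k (Fin n → k)) (v : Fin n → k),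
      MvPolynomial.eval (fun ij : Fin n × Fin n => g.val ij.1 ij.2)
        (∑ i, ∑ j, MvPolynomial.C (f (Pi.single i 1)) * (R i j * MvPolynomial.C (v j))) =
        f (Q g *ᵥ v) := by
    intro g f v
    have : f (Q g *ᵥ v) = ∑ i, (Q g *ᵥ v) i * f (Pi.single i 1) := by
      conv_lhs => rw [pi_eq_sum_univ' (Q g *ᵥ v)]
      rw [map_sum]
      exact Finset.sum_congr rfl fun i _ => by rw [map_smul, smul_eq_mul]
    rw [this, map_sum]
    refine Finset.sum_congr rfl fun i _ => ?_
    rw [map_sum, Matrix.mulVec, dotProduct, Finset.sum_mul]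
    refine Finset.sum_congr rfl fun j _ => ?_
    rw [hR]
    simp only [map_mul, MvPolynomial.eval_C, Matrix.map_apply]
    ring
  ext g
  constructor
  · rintro hg _ ⟨v, hv, f, hf, rfl⟩
    rw [key]
    exact (Submodule.mem_dualAnnihilator f).1 hf _ (hg v hv)
  · intro hg v hv
    rw [← Subspace.forall_mem_dualAnnihilator_apply_eq_zero_iff]
    intro f hf
    rw [← key]
    exact hg _ ⟨v, hv, f, hf, rfl⟩

theorem mulVec_inv_mulVec (g : GLn n k) (v : Fin n → k) : g.val *ᵥ ((g⁻¹).val *ᵥ v) = v := by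
  rw [Matrix.mulVec_mulVec, ← Units.val_mul, mul_inv_cancel, Units.val_one, Matrix.one_mulVec]

theorem inv_mulVec_mulVec (g : GLn n k) (v : Fin n → k) : (g⁻¹).val *ᵥ (g.val *ᵥ v) = v := by
  rw [Matrix.mulVec_mulVec, ← Units.val_mul, inv_mul_cancel, Units.val_one, Matrix.one_mulVec]

theorem exists_mulVec_eq (e : (Fin n → k) ≃ₗ[k] Fin n → k) :
    ∃ g : GLn n k, ∀ v, g.val *ᵥ v = e v := by
  refine ⟨⟨LinearMap.toMatrix' e.toLinearMap, LinearMap.toMatrix' e.symm.toLinearMap, ?_, ?_⟩,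
    fun v => ?_⟩
  · rw [← LinearMap.toMatrix'_comp]
    simp
  · rw [← LinearMap.toMatrix'_comp]
    simp
  · exact LinearMap.toMatrix'_mulVec _ _

theorem mulVec_mem_iff (g : GLn n k) {W : Submodule k (Fin n → k)}
    (h : ∀ v ∈ W, g.val *ᵥ v ∈ W) (v : Fin n → k) : g.val *ᵥ v ∈ W ↔ v ∈ W := by
  refine ⟨fun hv => ?_, h v⟩
  have hinj : Function.Injective (Matrix.mulVecLin g.val) :=
    Function.LeftInverse.injective (g := fun v => (g⁻¹).val *ᵥ v) (inv_mulVec_mulVec g)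
  have hW : W.map (Matrix.mulVecLin g.val) = W := by
    apply Submodule.eq_of_le_of_finrank_eq
    · rintro _ ⟨w, hw, rfl⟩
      exact h w hw
    · exact (Submodule.equivMapOfInjective _ hinj W).finrank_eq.symm
  rw [← hW] at hv
  obtain ⟨w, hw, hwv⟩ := hv
  rwa [← hinj hwv]

theorem mem_flagStabilizer {F : Set (Submodule k (Fin n → k))} {g : GLn n k} :
    g ∈ flagStabilizer F ↔ ∀ W ∈ F, ∀ v ∈ W, g.val *ᵥ v ∈ W :=
  ⟨fun h W hW v hv => (h W hW v).2 hv, fun h W hW v => mulVec_mem_iff g (h W hW) v⟩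

/-- The entries of an inverse matrix are not polynomials, but become so after multiplication by the
determinant. A nonzero scalar does not affect whether subspaces are preserved. -/
theorem isZariskiClosed_mem_flagStabilizer (F : Set (Submodule k (Fin n → k)))
    {q : GLn n k → GLn n k} {Q : GLn n k → Matrix (Fin n) (Fin n) k} (hQ : IsPolynomialMatrix Q)
    (hq : ∀ g, (g.val.det) • (q g).val = Q g) : IsZariskiClosed {g | q g ∈ flagStabilizer F} := by
  have : {g | q g ∈ flagStabilizer F} = ⋂ W : F, {g | ∀ v ∈ W.1, Q g *ᵥ v ∈ W.1} := by
    ext g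
    have hdet : g.val.det ≠ 0 := (Matrix.GeneralLinearGroup.det g).ne_zero
    simp only [Set.mem_ofPred_eq, mem_flagStabilizer, Set.mem_iInter, Subtype.forall]
    refine forall₂_congr fun W _ => forall₂_congr fun v _ => ?_
    rw [← hq, Matrix.smul_mulVec, Submodule.smul_mem_iff _ hdet]
  rw [this]
  exact isZariskiClosed_iInter fun W => hQ.isZariskiClosed W.1

end ZariskiClosed

/-! ### The form attached to an element outside `GL_n`, and its anisotropy -/

section Ext

variable {n : ℕ} {k : Type*} [Field k] (σ : OuterInvolution n k)

theorem det_smul_inv_val (g : GLn n k) : g.val.det • (g⁻¹).val = g.val.adjugate := by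
  have hdet : g.val.det ≠ 0 := (Matrix.GeneralLinearGroup.det g).ne_zero
  rw [Matrix.coe_units_inv, Matrix.inv_def, Ring.inverse_eq_inv', smul_smul, mul_inv_cancel₀ hdet,
    one_smul]

variable {σ}

theorem OuterInvolution.action_of_ne_one {c : Multiplicative (ZMod 2)} (hc : c ≠ 1) :
    σ.action c = σ.aut := if_neg hc

theorem conj_inl_of_right_ne_one {x : σ.Ext} (hx : x.right ≠ 1) (g : GLn n k) :
    x * SemidirectProduct.inl g * x⁻¹ =
      SemidirectProduct.inl (x.left * σ.aut g * x.left⁻¹) := by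
  apply SemidirectProduct.ext
  · simp [OuterInvolution.action_of_ne_one hx, mul_assoc]
  · simp

theorem mul_mul_of_right_ne_one {x : σ.Ext} (hx : x.right ≠ 1) :
    x * x = SemidirectProduct.inl (x.left * σ.aut x.left) := by
  have h : ∀ a : Multiplicative (ZMod 2), a * a = 1 := by decide
  apply SemidirectProduct.ext
  · simp [OuterInvolution.action_of_ne_one hx]
  · simp [h]

theorem inv_conj_inl (x : σ.Ext) (g : GLn n k) :
    x⁻¹ * SemidirectProduct.inl g * x =
      SemidirectProduct.inl (σ.action x.right⁻¹ (x.left⁻¹ * g * x.left)) := by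
  apply SemidirectProduct.ext <;> simp [mul_assoc]

theorem conj_inl (x : σ.Ext) (g : GLn n k) :
    x * SemidirectProduct.inl g * x⁻¹ =
      SemidirectProduct.inl (x.left * σ.action x.right g * x.left⁻¹) := by
  apply SemidirectProduct.ext <;> simp [mul_assoc]

theorem mem_normalizer_map_inl {P : Subgroup (GLn n k)} {x : σ.Ext} :
    x ∈ Subgroup.normalizer ((P.map (SemidirectProduct.inl : GLn n k →* σ.Ext) :
      Subgroup σ.Ext) : Set σ.Ext) ↔
    (∀ g ∈ P, x.left * σ.action x.right g * x.left⁻¹ ∈ P) ∧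
      ∀ g ∈ P, σ.action x.right⁻¹ (x.left⁻¹ * g * x.left) ∈ P := by
  have hinl : ∀ g, (SemidirectProduct.inl g : σ.Ext) ∈ P.map SemidirectProduct.inl ↔ g ∈ P :=
    fun g => Subgroup.mem_map_iff_mem SemidirectProduct.inl_injective
  rw [Subgroup.mem_normalizer_iff]
  constructor
  · refine fun h => ⟨fun g hg => ?_, fun g hg => ?_⟩
    · rw [← hinl, ← conj_inl, ← h, hinl]
      exact hg
    · rw [← hinl, ← inv_conj_inl, ← Subgroup.mem_normalizer_iff''.1 (Subgroup.mem_normalizer_iff.2 h),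
        hinl]
      exact hg
  · rintro ⟨h1, h2⟩ y
    constructor
    · rintro ⟨g, hg, rfl⟩
      rw [conj_inl]
      exact (hinl _).2 (h1 g hg)
    · rintro ⟨g, hg, hgy⟩
      have : y = x⁻¹ * SemidirectProduct.inl g * x := by rw [hgy]; group
      rw [this, inv_conj_inl]
      exact (hinl _).2 (h2 g hg)

/-- On each of the two components the normaliser is an intersection, over the elements `p` of the
stabiliser, of conditions on conjugates of `p`; each is polynomial up to the determinant. -/
theorem isZariskiClosed_normalizer (F : Set (Submodule k (Fin n → k))) :
    σ.IsZariskiClosed ((Subgroup.normalizer (((flagStabilizer F).map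
      (SemidirectProduct.inl : GLn n k →* σ.Ext) : Subgroup σ.Ext) : Set σ.Ext) :
        Subgroup σ.Ext) : Set σ.Ext) := by
  obtain ⟨A, hA⟩ := σ.outer
  intro c
  have hset : {g : GLn n k | (⟨g, c⟩ : σ.Ext) ∈ ((Subgroup.normalizer (((flagStabilizer F).map
      (SemidirectProduct.inl : GLn n k →* σ.Ext) : Subgroup σ.Ext) : Set σ.Ext) :
        Subgroup σ.Ext) : Set σ.Ext)} =
      -- The Boolean index selects conjugation by the element or by its inverse.
      ⋂ b : Bool, ⋂ p : flagStabilizer F,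
        {g | (if b then g * σ.action c p.1 * g⁻¹ else σ.action c⁻¹ (g⁻¹ * p.1 * g)) ∈
          flagStabilizer F} := by
    ext g
    simp only [Set.mem_ofPred_eq, SetLike.mem_coe, mem_normalizer_map_inl, Set.mem_iInter,
      Bool.forall_bool, Subtype.forall]
    exact and_comm
  rw [hset]
  refine isZariskiClosed_iInter fun b => isZariskiClosed_iInter fun p => ?_
  have hP := IsPolynomialMatrix.val (n := n) (k := k)
  cases b
  · by_cases hc : c⁻¹ = 1
    · refine isZariskiClosed_mem_flagStabilizer F
        ((hP.adjugate.mul (.const p.1.val)).mul hP) fun g => ?_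
      simp only [hc, map_one, MulAut.one_apply, Units.val_mul, Bool.false_eq_true, if_false]
      rw [← Matrix.smul_mul, ← Matrix.smul_mul, det_smul_inv_val]
    -- Off the identity component, `σ(g⁻¹ p g) = A ᵗg ᵗp⁻¹ ᵗg⁻¹ A⁻¹`, whose only non-polynomial
    -- factor is `ᵗg⁻¹`.
    · refine isZariskiClosed_mem_flagStabilizer F
        (((((IsPolynomialMatrix.const A.val).mul hP.transpose).mul
          (.const ((p.1⁻¹).valᵀ))).mul hP.adjugate.transpose).mul (.const (A⁻¹).val)) fun g => ?_
      simp only [OuterInvolution.action_of_ne_one hc, Bool.false_eq_true, if_false, hA]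
      rw [← det_smul_inv_val]
      simp [mul_assoc, Matrix.transpose_mul]
  · refine isZariskiClosed_mem_flagStabilizer F
      ((hP.mul (.const (σ.action c p.1).val)).mul hP.adjugate) fun g => ?_
    simp only [if_true, Units.val_mul]
    rw [← Matrix.mul_smul, det_smul_inv_val]

theorem zariskiClosure_le_normalizer {F : Set (Submodule k (Fin n → k))} {H : Subgroup σ.Ext}
    (h : H ≤ Subgroup.normalizer (((flagStabilizer F).map
      (SemidirectProduct.inl : GLn n k →* σ.Ext) : Subgroup σ.Ext) : Set σ.Ext)) :
    σ.zariskiClosure H ≤ Subgroup.normalizer (((flagStabilizer F).map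
      (SemidirectProduct.inl : GLn n k →* σ.Ext) : Subgroup σ.Ext) : Set σ.Ext) :=
  sInf_le ⟨h, isZariskiClosed_normalizer F⟩

theorem le_zariskiClosure (H : Subgroup σ.Ext) : H ≤ σ.zariskiClosure H :=
  le_sInf fun _ h => h.1

/-- A transvection `v ↦ v + f(v) w` with `v ∈ U`, `w ∉ U`, `f v ≠ 0` and `f w = 0` moves `v` out of
`U`. -/
theorem flagStabilizer_ne_top {F : Set (Submodule k (Fin n → k))} {U : Submodule k (Fin n → k)}
    (hUF : U ∈ F) (hU : U ≠ ⊥) (hU' : U ≠ ⊤) : flagStabilizer F ≠ ⊤ := by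
  intro h
  obtain ⟨v, hv, hv0⟩ := (Submodule.ne_bot_iff U).1 hU
  obtain ⟨w, hw⟩ := SetLike.exists_not_mem_of_ne_top U hU'
  obtain ⟨f, hfv, hfw⟩ : ∃ f : Module.Dual k (Fin n → k), f v ≠ 0 ∧ f w = 0 := by
    have : v ∉ Submodule.span k {w} := by
      intro h
      obtain ⟨c, rfl⟩ := Submodule.mem_span_singleton.1 h
      have hc : c ≠ 0 := by rintro rfl; exact hv0 (zero_smul _ _)
      exact hw ((Submodule.smul_mem_iff _ hc).1 hv)
    obtain ⟨f, hf, hf'⟩ := Submodule.exists_le_ker_of_notMem this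
    exact ⟨f, hf, hf' (Submodule.mem_span_singleton_self w)⟩
  let e := LinearEquiv.transvection hfw
  obtain ⟨g, hg⟩ := exists_mulVec_eq e
  have := mem_flagStabilizer.1 (h ▸ Subgroup.mem_top g : g ∈ flagStabilizer F) U hUF v hv
  rw [hg, LinearEquiv.transvection.apply] at this
  exact hw ((Submodule.smul_mem_iff _ hfv).1 ((Submodule.add_mem_iff_right U hv).1 this))

/-- Conjugation by `A ᵗA⁻¹` is `σ²`, hence trivial, so `A ᵗA⁻¹` is central and therefore a scalar
`c`. -/
theorem OuterInvolution.exists_transpose_eq (σ : OuterInvolution n k) :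
    ∃ A : GLn n k, (∀ g : GLn n k,
      (σ.aut g : Matrix (Fin n) (Fin n) k) = A.val * (g⁻¹).valᵀ * (A⁻¹).val) ∧
      ∃ c : k, (A⁻¹).valᵀ = c • (A⁻¹).val := by
  obtain ⟨A, hA⟩ := σ.outer
  refine ⟨A, hA, ?_⟩
  let t : GLn n k := ⟨(A⁻¹).valᵀ, A.valᵀ, by
    rw [← Matrix.transpose_mul, Units.mul_inv, Matrix.transpose_one], by
    rw [← Matrix.transpose_mul, Units.inv_mul, Matrix.transpose_one]⟩
  have hcomm : A * t ∈ Subgroup.center (GLn n k) := by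
    rw [Subgroup.mem_center_iff]
    intro g
    have h1 : σ.aut (σ.aut g) = g := by
      have := congrArg (fun f : MulAut (GLn n k) => f g) σ.sq_eq_one
      simpa using this
    have h2 : g.val = A.val * ((A⁻¹).valᵀ * g.val * A.valᵀ) * (A⁻¹).val := by
      conv_lhs => rw [← h1, hA, ← map_inv, hA]
      simp [Matrix.transpose_mul, mul_assoc]
    have h3 : g = A * t * g * (A * t)⁻¹ := by
      apply Units.ext
      rw [mul_inv_rev]
      simp only [Units.val_mul, mul_assoc] at h2 ⊢
      exact h2
    calc g * (A * t) = A * t * g * (A * t)⁻¹ * (A * t) := by rw [← h3]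
      _ = A * t * g := by group
  obtain ⟨c, hc⟩ := Matrix.GeneralLinearGroup.mem_center_iff_val_mem_range_scalar.1 hcomm
  refine ⟨c, ?_⟩
  have : t.val = (A⁻¹).val * (A * t).val := by rw [← Units.val_mul, inv_mul_cancel_left]
  change t.val = _
  rw [this, ← hc]
  ext i j
  simp [mul_comm]

/-- The matrix identity behind it is `(x₀A)⁻¹ g' = ᵗg⁻¹ (x₀A)⁻¹`, which is `g' = x₀ σ(g) x₀⁻¹`
rewritten. -/
theorem form_conj {A : GLn n k}
    (hA : ∀ g : GLn n k, (σ.aut g : Matrix (Fin n) (Fin n) k) = A.val * (g⁻¹).valᵀ * (A⁻¹).val)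
    {x : σ.Ext} {g g' : GLn n k} (hx : x.right ≠ 1)
    (h : x * SemidirectProduct.inl g * x⁻¹ = SemidirectProduct.inl g') (v w : Fin n → k) :
    (g.val *ᵥ v) ⬝ᵥ (((x.left * A)⁻¹).val *ᵥ (g'.val *ᵥ w)) =
      v ⬝ᵥ (((x.left * A)⁻¹).val *ᵥ w) := by
  rw [conj_inl_of_right_ne_one hx] at h
  have h' : g' = x.left * σ.aut g * x.left⁻¹ := (SemidirectProduct.inl_injective h).symm
  have h1 : ((x.left * A)⁻¹).val * g'.val = (g⁻¹).valᵀ * ((x.left * A)⁻¹).val := by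
    rw [h', Units.val_mul, Units.val_mul, hA, mul_inv_rev]
    simp [mul_assoc]
  rw [Matrix.mulVec_mulVec, h1, ← Matrix.mulVec_mulVec, Matrix.dotProduct_mulVec,
    Matrix.vecMul_transpose, inv_mulVec_mulVec]

/-- Transposing the matrix of the form gives `ᵗ(x₀A)⁻¹ = c (x₀A)⁻¹ s`, because `s = x₀ σ(x₀) = x₀ A
ᵗx₀⁻¹ A⁻¹`. -/
theorem form_flip {A : GLn n k}
    (hA : ∀ g : GLn n k, (σ.aut g : Matrix (Fin n) (Fin n) k) = A.val * (g⁻¹).valᵀ * (A⁻¹).val)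
    {c : k} (hc : (A⁻¹).valᵀ = c • (A⁻¹).val) {x : σ.Ext} {s : GLn n k} (hx : x.right ≠ 1) (h : x * x = SemidirectProduct.inl s)
    (v w : Fin n → k) :
    w ⬝ᵥ (((x.left * A)⁻¹).val *ᵥ v) = c * (v ⬝ᵥ (((x.left * A)⁻¹).val *ᵥ (s.val *ᵥ w))) := by
  rw [mul_mul_of_right_ne_one hx] at h
  have h' : s = x.left * σ.aut x.left := (SemidirectProduct.inl_injective h).symm
  have h1 : ((x.left * A)⁻¹).valᵀ = c • (((x.left * A)⁻¹).val * s.val) := by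
    rw [h', Units.val_mul, hA, mul_inv_rev, Units.val_mul, Matrix.transpose_mul, hc]
    simp [mul_assoc]
  rw [Matrix.dotProduct_mulVec, ← Matrix.mulVec_transpose, h1, dotProduct_comm,
    Matrix.smul_mulVec, dotProduct_smul, smul_eq_mul, Matrix.mulVec_mulVec]

section TwistedForm

variable {G : Type*} [Group G] {A : GLn n k}
  (hA : ∀ g : GLn n k, (σ.aut g : Matrix (Fin n) (Fin n) k) = A.val * (g⁻¹).valᵀ * (A⁻¹).val)
  {c : k} (hc : (A⁻¹).valᵀ = c • (A⁻¹).val) {x : σ.Ext} (hx : x.right ≠ 1)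

/-- The form attached to an element of the non-identity component. -/
def extForm (φ : G →* GLn n k) (β : G → G)
    (hβ : ∀ g, x * SemidirectProduct.inl (φ (β g)) * x⁻¹ = SemidirectProduct.inl (φ g))
    (s : G) (hs : x * x = SemidirectProduct.inl (φ s)) :
    TwistedForm ((naturalRep n k).comp φ) where
  form := Matrix.toLinearMap₂' k ((x.left * A)⁻¹).val
  twist := β
  invariant g v w := by
    rw [Matrix.toLinearMap₂'_apply', Matrix.toLinearMap₂'_apply']
    exact form_conj hA hx (hβ g) v w
  element := s
  scalar := c
  flip v w := by
    rw [Matrix.toLinearMap₂'_apply', Matrix.toLinearMap₂'_apply']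
    exact form_flip hA hc hx hs v w
  nondegenerate v h := by
    have : ((x.left * A)⁻¹).val *ᵥ v = 0 := by
      apply dotProduct_eq_zero
      intro w
      have := h w
      rw [Matrix.toLinearMap₂'_apply'] at this
      rwa [dotProduct_comm]
    rw [← mulVec_inv_mulVec (x.left * A) v, this, Matrix.mulVec_zero]

theorem extForm_apply (φ : G →* GLn n k) (β : G → G)
    (hβ : ∀ g, x * SemidirectProduct.inl (φ (β g)) * x⁻¹ = SemidirectProduct.inl (φ g))
    (s : G) (hs : x * x = SemidirectProduct.inl (φ s)) (v w : Fin n → k) :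
    (extForm hA hc hx φ β hβ s hs).form v w = v ⬝ᵥ (((x.left * A)⁻¹).val *ᵥ w) :=
  Matrix.toLinearMap₂'_apply' _ _ _

/-- This is where irreducibility enters. A nonzero totally isotropic `U` is a proper subspace by
nondegeneracy and gives the flag `U ≤ U^⊥`. The group elements `φ g` lie in its stabiliser, and `x`
normalises that stabiliser. -/
theorem extForm_isAnisotropic (φ : G →* GLn n k) (β : G → G)
    (hβ : ∀ g, x * SemidirectProduct.inl (φ (β g)) * x⁻¹ = SemidirectProduct.inl (φ g))
    (s : G) (hs : x * x = SemidirectProduct.inl (φ s)) {H : Subgroup σ.Ext}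
    (hH : σ.IsIrreducible H)
    (hle : H ≤ σ.zariskiClosure (Subgroup.closure
      (Set.range (fun g => (SemidirectProduct.inl (φ g) : σ.Ext)) ∪ {x}))) :
    (extForm hA hc hx φ β hβ s hs).IsAnisotropic := by
  set B := extForm hA hc hx φ β hβ s hs with hB
  intro U hU
  by_contra hU0
  have hUle : U ≤ B.orthogonal U := fun w hw u hu => hU u hu w hw
  let F : Set (Submodule k (Fin n → k)) := {U.toSubmodule, (B.orthogonal U).toSubmodule}
  have hchain : IsChain (· ≤ ·) F := IsChain.pair hUle
  have hUbot : U.toSubmodule ≠ ⊥ := fun h => hU0 (Subrepresentation.toSubmodule_injective h)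
  have hUtop : U.toSubmodule ≠ ⊤ := by
    intro h
    obtain ⟨v, hv, hv0⟩ := (Submodule.ne_bot_iff _).1 hUbot
    refine hv0 (B.nondegenerate v fun w => hU w ?_ v hv)
    change w ∈ U.toSubmodule
    rw [h]
    trivial
  refine hH _ ⟨F, hchain, rfl⟩ (flagStabilizer_ne_top (Or.inl rfl) hUbot hUtop) (hle.trans ?_)
  apply zariskiClosure_le_normalizer
  rw [Subgroup.closure_le]
  have hφ : ∀ g, φ g ∈ flagStabilizer F := by
    intro g
    rw [mem_flagStabilizer]
    rintro W (rfl | rfl) v hv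
    · exact U.apply_mem_toSubmodule g hv
    · exact (B.orthogonal U).apply_mem_toSubmodule g hv
  -- The conjugate `g'` is the inverse adjoint of `g`, so `g'` preserves `U^⊥` because `g` preserves
  -- `U`, and preserves `U = U^⊥⊥` because `g` preserves `U^⊥`.
  have hconj : ∀ g ∈ flagStabilizer F, ∀ g',
      x * SemidirectProduct.inl g * x⁻¹ = SemidirectProduct.inl g' → g' ∈ flagStabilizer F := by
    intro g hg g' hgg'
    have hinv : ∀ v w, B.form v (g'.val *ᵥ w) = B.form ((g⁻¹).val *ᵥ v) w := by
      intro v w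
      rw [hB, extForm_apply, extForm_apply, ← form_conj hA hx hgg' ((g⁻¹).val *ᵥ v) w,
        mulVec_inv_mulVec]
    have hg' := mem_flagStabilizer.1 (inv_mem hg)
    rw [mem_flagStabilizer]
    rintro W (rfl | rfl) v hv
    · apply B.mem_of_form_orthogonal_eq_zero
      intro w hw
      rw [hinv]
      exact B.form_eq_zero_of_mem_orthogonal (hg' _ (Or.inr rfl) w hw) hv
    · intro u hu
      rw [hinv]
      exact hv _ (hg' _ (Or.inl rfl) u hu)
  rintro y (⟨g, rfl⟩ | rfl)
  · apply Subgroup.le_normalizer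
    exact ⟨_, hφ g, rfl⟩
  · rw [SetLike.mem_coe, mem_normalizer_map_inl]
    refine ⟨fun g hg => hconj g hg _ (conj_inl _ _), fun g hg => ?_⟩
    -- Since `y² = φ s` stabilises the flag, conjugation by `y⁻¹` reduces to conjugation by `y`
    -- followed by an inner one.
    have h1 : y⁻¹ = SemidirectProduct.inl (φ s)⁻¹ * y := by
      rw [map_inv, ← hs]
      group
    obtain ⟨g', hg'⟩ : ∃ g', y * SemidirectProduct.inl g * y⁻¹ = SemidirectProduct.inl g' :=
      ⟨_, conj_inl _ _⟩
    have h1' : y = y⁻¹ * SemidirectProduct.inl (φ s) := by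
      rw [← hs]
      group
    have h2 : y⁻¹ * SemidirectProduct.inl g * y =
        SemidirectProduct.inl ((φ s)⁻¹ * g' * φ s) := by
      calc y⁻¹ * SemidirectProduct.inl g * y
          = SemidirectProduct.inl (φ s)⁻¹ * y * SemidirectProduct.inl g *
            (y⁻¹ * SemidirectProduct.inl (φ s)) := by rw [← h1, ← h1']
        _ = SemidirectProduct.inl (φ s)⁻¹ * (y * SemidirectProduct.inl g * y⁻¹) *
            SemidirectProduct.inl (φ s) := by group
        _ = _ := by rw [hg', ← map_mul, ← map_mul]
    rw [inv_conj_inl] at h2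
    rw [SemidirectProduct.inl_injective h2]
    exact mul_mem (mul_mem (inv_mem (hφ s)) (hconj g hg g' hg')) (hφ s)

end TwistedForm

end Ext

/-! ### Maps and forms on an internal direct sum -/

section Internal

variable {k V : Type*} [Field k] [AddCommGroup V] [Module k V] {m : ℕ}
  {W : Fin m → Submodule k V}

theorem linearMap_ext_of_isInternal {V' : Type*} [AddCommGroup V'] [Module k V']
    (hW : DirectSum.IsInternal W) {f g : V →ₗ[k] V'}
    (h : ∀ j, ∀ v ∈ W j, f v = g v) : f = g := by
  ext v
  have hv : v ∈ ⨆ j, W j := hW.submodule_iSup_eq_top ▸ Submodule.mem_top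
  refine Submodule.iSup_induction W (motive := fun v => f v = g v) hv h ?_ ?_
  · rw [map_zero, map_zero]
  · intro x y hx hy
    rw [map_add, map_add, hx, hy]

theorem bilinear_ext_of_isInternal {V' : Type*} [AddCommGroup V'] [Module k V']
    (hW : DirectSum.IsInternal W) {f g : V →ₗ[k] V →ₗ[k] V'}
    (h : ∀ i j, ∀ v ∈ W i, ∀ w ∈ W j, f v w = g v w) : f = g :=
  linearMap_ext_of_isInternal hW fun i v hv => linearMap_ext_of_isInternal hW fun j w hw =>
    h i j v hv w hw

theorem exists_linearMap_eq_smul (hW : DirectSum.IsInternal W) (c : Fin m → k) :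
    ∃ f : V →ₗ[k] V, ∀ j, ∀ v ∈ W j, f v = c j • v := by
  classical
  refine ⟨DirectSum.toModule k (Fin m) V (fun j => c j • (W j).subtype) ∘ₗ
    (LinearEquiv.ofBijective (DirectSum.coeLinearMap W) hW).symm.toLinearMap, fun j v hv => ?_⟩
  have : (LinearEquiv.ofBijective (DirectSum.coeLinearMap W) hW).symm v =
      DirectSum.lof k (Fin m) (fun j => W j) j ⟨v, hv⟩ := by
    rw [LinearEquiv.symm_apply_eq]
    exact (DirectSum.coeLinearMap_lof W j ⟨v, hv⟩).symm
  rw [LinearMap.comp_apply, LinearEquiv.coe_coe, this, DirectSum.toModule_lof]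
  rfl

end Internal

/-! ### Schur's lemma for multiplicity-free decompositions -/

section Decomposition

variable {k G V : Type*} [Field k] [Group G] [AddCommGroup V] [Module k V]
  {r : Representation k G V} {B : TwistedForm r} {m : ℕ} {W : Fin m → Subrepresentation r}

theorem IsMultiplicityFreeDecomposition.eq_zero (hW : IsMultiplicityFreeDecomposition W) {w : V}
    (h : ∀ i, ∀ v ∈ W i, B.form v w = 0) : w = 0 := by
  apply B.nondegenerate
  have : B.form.flip w = 0 := linearMap_ext_of_isInternal hW.1 h
  exact fun v => LinearMap.congr_fun this v

theorem IsMultiplicityFreeDecomposition.form_eq_zero [FiniteDimensional k V]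
    (hW : IsMultiplicityFreeDecomposition W) (hB : B.IsAnisotropic)
    (C : V →ₗ[k] V →ₗ[k] k) (hC : ∀ g v w, C (r (B.twist g) v) (r g w) = C v w)
    {i j : Fin m} (hij : i ≠ j) {v w : V} (hv : v ∈ W i) (hw : w ∈ W j) : C v w = 0 :=
  hB.form_eq_zero (hW.2.1 i) (hW.2.1 j) (hW.2.2 i j hij) C hC hv hw

/-- The decomposition need not have been built from `B`: non-isomorphism alone forces orthogonality.
A decomposition obtained from one form thus serves for all the others. -/
theorem IsMultiplicityFreeDecomposition.orthogonal [FiniteDimensional k V]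
    (hW : IsMultiplicityFreeDecomposition W) (hB : B.IsAnisotropic)
    {i j : Fin m} (hij : i ≠ j) {v w : V} (hv : v ∈ W i) (hw : w ∈ W j) : B.form v w = 0 :=
  hW.form_eq_zero hB B.form B.invariant hij hv hw

theorem IsMultiplicityFreeDecomposition.mem_of_orthogonal [FiniteDimensional k V]
    (hW : IsMultiplicityFreeDecomposition W) (hB : B.IsAnisotropic) {j : Fin m} {w : V}
    (h : ∀ i, i ≠ j → ∀ v ∈ W i, B.form v w = 0) : w ∈ W j := by
  obtain ⟨u, hu, hwu⟩ := hB.exists_sub_mem_orthogonal (W j) w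
  have : w - u = 0 := by
    refine hW.eq_zero (B := B) fun i v hv => ?_
    by_cases hij : i = j
    · subst hij
      exact hwu v hv
    · rw [map_sub, h i hij v hv, hW.orthogonal hB hij hv hu, sub_zero]
  rwa [sub_eq_zero.1 this]

/-- The form `(v, w) ↦ B(v, f w)` has the same twisted invariance as `B`, so it vanishes between
distinct summands and is a multiple of `B` on each; nondegeneracy then determines `f`. -/
theorem IsMultiplicityFreeDecomposition.exists_scalar [FiniteDimensional k V] [IsAlgClosed k]
    (hW : IsMultiplicityFreeDecomposition W) (hB : B.IsAnisotropic) {f : V →ₗ[k] V}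
    (hf : ∀ g v, f (r g v) = r g (f v)) (j : Fin m) : ∃ c : k, ∀ w ∈ W j, f w = c • w := by
  have hC : ∀ g v w, B.form.compl₁₂ LinearMap.id f (r (B.twist g) v) (r g w) =
      B.form.compl₁₂ LinearMap.id f v w := by
    intro g v w
    simp only [LinearMap.compl₁₂_apply, LinearMap.id_apply, hf]
    exact B.invariant _ _ _
  obtain ⟨c, hc⟩ := hB.exists_scalar (hW.2.1 j)
    ((B.form.compl₁₂ LinearMap.id f).domRestrict₁₂ (W j).toSubmodule (W j).toSubmodule)
    fun g v w => hC g v w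
  refine ⟨c, fun w hw => ?_⟩
  rw [← sub_eq_zero]
  refine hW.eq_zero (B := B) fun i v hv => ?_
  rw [map_sub, map_smul, smul_eq_mul, sub_eq_zero]
  by_cases hij : i = j
  · subst hij
    exact hc ⟨v, hv⟩ ⟨w, hw⟩
  · rw [hW.orthogonal hB hij hv hw, mul_zero]
    exact hW.form_eq_zero hB _ hC hij hv hw

end Decomposition

/-! ### The centraliser of an irreducible subgroup -/

section Subgroups

variable {n : ℕ} {k : Type*} [Field k]

theorem exists_decomposition_and_centralizer [IsAlgClosed k] (σ : OuterInvolution n k)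
    (H₀ : Subgroup (GLn n k)) (x : σ.Ext) (H : Subgroup σ.Ext) (hx : x.right ≠ 1)
    (hnorm : x ∈ Subgroup.normalizer
      ((H₀.map SemidirectProduct.inl : Subgroup σ.Ext) : Set σ.Ext))
    (hsq : x ^ 2 ∈ (H₀.map SemidirectProduct.inl : Subgroup σ.Ext))
    (hH : H = Subgroup.closure (((H₀.map SemidirectProduct.inl : Subgroup σ.Ext) : Set σ.Ext) ∪ {x}))
    (hirr : σ.IsIrreducible H) :
    ∃ (m : ℕ) (W : Fin m → Subrepresentation ((naturalRep n k).comp H₀.subtype)),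
      IsMultiplicityFreeDecomposition W ∧
      ∃ e : (Fin m → rootsOfUnity 2 k) ≃*
          ((Subgroup.centralizer (H : Set σ.Ext)).comap
            (SemidirectProduct.inl : GLn n k →* σ.Ext)),
        ∀ (ε : Fin m → rootsOfUnity 2 k) (j : Fin m), ∀ v ∈ (W j).toSubmodule,
          ((e ε : GLn n k).val).mulVec v = ((ε j : kˣ) : k) • v := by
  obtain ⟨A, hA, c, hc⟩ := σ.exists_transpose_eq
  have hβ : ∀ g : H₀, ∃ g' : H₀, x * SemidirectProduct.inl (H₀.subtype g') * x⁻¹ =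
      SemidirectProduct.inl (H₀.subtype g) := by
    intro g
    obtain ⟨g', hg', hgg'⟩ := (Subgroup.mem_normalizer_iff''.1 hnorm
      (SemidirectProduct.inl g.1)).1 ⟨g, g.2, rfl⟩
    refine ⟨⟨g', hg'⟩, ?_⟩
    change x * SemidirectProduct.inl g' * x⁻¹ = _
    rw [hgg']
    simp [mul_assoc]
  choose β hβ using hβ
  obtain ⟨s, hs, hsx⟩ := hsq
  have hs' : x * x = SemidirectProduct.inl (H₀.subtype ⟨s, hs⟩) := by
    rw [← sq]
    exact hsx.symm
  have hB := extForm_isAnisotropic hA hc hx H₀.subtype β hβ ⟨s, hs⟩ hs' hirr (by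
    rw [hH]
    refine le_trans (Subgroup.closure_mono ?_) (le_zariskiClosure _)
    refine Set.union_subset_union_left _ ?_
    rintro _ ⟨g, hg, rfl⟩
    exact ⟨⟨g, hg⟩, rfl⟩)
  set B := extForm hA hc hx H₀.subtype β hβ ⟨s, hs⟩ hs' with hBdef
  obtain ⟨m, W, hW, horth⟩ := hB.exists_decomposition
  refine ⟨m, W, hW, ?_⟩
  have hext : ∀ g g' : GLn n k, (∀ j, ∀ v ∈ W j, g.val *ᵥ v = g'.val *ᵥ v) → g = g' := by
    intro g g' h
    have : Matrix.mulVecLin g.val = Matrix.mulVecLin g'.val := linearMap_ext_of_isInternal hW.1 h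
    exact Units.ext (Matrix.toLin'.injective this)
  -- Commuting with `x` means that `g` equals its own conjugate, the inverse adjoint of `g`; that
  -- is, `g` is an isometry of `B`.
  have hmem : ∀ g : GLn n k,
      g ∈ (Subgroup.centralizer (H : Set σ.Ext)).comap SemidirectProduct.inl ↔
        (∀ h ∈ H₀, h * g = g * h) ∧
          ∀ v w, B.form (g.val *ᵥ v) (g.val *ᵥ w) = B.form v w := by
    intro g
    have h1 : g ∈ (Subgroup.centralizer (H : Set σ.Ext)).comap SemidirectProduct.inl ↔
        (∀ h ∈ H₀, h * g = g * h) ∧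
          x * SemidirectProduct.inl g = SemidirectProduct.inl g * x := by
      rw [Subgroup.mem_comap, hH, Subgroup.centralizer_closure, Subgroup.mem_centralizer_iff]
      constructor
      · refine fun h => ⟨fun a ha => ?_, h x (Or.inr rfl)⟩
        have := h (SemidirectProduct.inl a) (Or.inl ⟨a, ha, rfl⟩)
        rw [← map_mul, ← map_mul] at this
        exact SemidirectProduct.inl_injective this
      · rintro ⟨h, h'⟩ _ (⟨a, ha, rfl⟩ | rfl)
        · rw [← map_mul, ← map_mul, h a ha]
        · exact h'
    rw [h1]
    refine and_congr_right fun _ => ⟨fun h v w => ?_, fun h => ?_⟩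
    · rw [hBdef, extForm_apply, extForm_apply]
      exact form_conj hA hx (by rw [h, mul_inv_cancel_right]) v w
    · obtain ⟨g', hg'⟩ : ∃ g', x * SemidirectProduct.inl g * x⁻¹ = SemidirectProduct.inl g' :=
        ⟨_, conj_inl _ _⟩
      have hgg' : g' = g := by
        refine hext _ _ fun j w _ => ?_
        rw [← sub_eq_zero]
        apply B.nondegenerate
        intro v
        rw [← mulVec_inv_mulVec g v, map_sub, h, sub_eq_zero, hBdef, extForm_apply, extForm_apply]
        exact form_conj hA hx hg' _ w
      rw [hgg'] at hg'
      exact mul_inv_eq_iff_eq_mul.1 hg'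
  -- The operator acting by signs on the summands is its own inverse, hence lies in `GL_n`.
  have hD : ∀ ε : Fin m → rootsOfUnity 2 k, ∃ g : GLn n k,
      ∀ j, ∀ v ∈ W j, g.val *ᵥ v = ((ε j : kˣ) : k) • v := by
    intro ε
    obtain ⟨f, hf⟩ := exists_linearMap_eq_smul hW.1 fun j => ((ε j : kˣ) : k)
    have hff : Function.LeftInverse f f := by
      have : f ∘ₗ f = LinearMap.id := by
        refine linearMap_ext_of_isInternal hW.1 fun j v hv => ?_
        have h2 : ((ε j : kˣ) : k) * ((ε j : kˣ) : k) = 1 := by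
          have := (mem_rootsOfUnity' 2 _).1 (ε j).2
          rwa [sq] at this
        rw [LinearMap.comp_apply, hf j v hv, map_smul, hf j v hv, smul_smul, h2, one_smul]
        rfl
      exact fun v => LinearMap.congr_fun this v
    obtain ⟨g, hg⟩ := exists_mulVec_eq (LinearEquiv.ofInvolutive f hff)
    exact ⟨g, fun j v hv => (hg v).trans (hf j v hv)⟩
  choose D hD using hD
  have hDmem : ∀ ε, D ε ∈ (Subgroup.centralizer (H : Set σ.Ext)).comap SemidirectProduct.inl := by
    intro ε
    rw [hmem]
    constructor
    · intro h hh
      refine hext _ _ fun j v hv => ?_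
      have hv' : h.val *ᵥ v ∈ W j := (W j).apply_mem_toSubmodule ⟨h, hh⟩ hv
      rw [Units.val_mul, Units.val_mul, ← Matrix.mulVec_mulVec, ← Matrix.mulVec_mulVec,
        hD ε j v hv, hD ε j _ hv', Matrix.mulVec_smul]
    · have : B.form.compl₁₂ (Matrix.mulVecLin (D ε).val) (Matrix.mulVecLin (D ε).val) = B.form := by
        refine bilinear_ext_of_isInternal hW.1 fun i j v hv w hw => ?_
        rw [LinearMap.compl₁₂_apply, Matrix.mulVecLin_apply, Matrix.mulVecLin_apply, hD ε i v hv,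
          hD ε j w hw, map_smul, map_smul, LinearMap.smul_apply]
        by_cases hij : i = j
        · subst hij
          have h2 : ((ε i : kˣ) : k) * ((ε i : kˣ) : k) = 1 := by
            have := (mem_rootsOfUnity' 2 _).1 (ε i).2
            rwa [sq] at this
          rw [smul_smul, h2, one_smul]
        · rw [horth i j hij v hv w hw, smul_zero, smul_zero]
      exact fun v w => LinearMap.congr_fun (LinearMap.congr_fun this v) w
  have hne : ∀ j, ∃ v ∈ W j, v ≠ 0 := fun j =>
    (Submodule.ne_bot_iff _).1 fun h => ne_bot_of_isIrreducible (hW.2.1 j)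
      (Subrepresentation.toSubmodule_injective h)
  let e₀ : (Fin m → rootsOfUnity 2 k) →*
      ((Subgroup.centralizer (H : Set σ.Ext)).comap (SemidirectProduct.inl : GLn n k →* σ.Ext)) :=
    MonoidHom.mk' (fun ε => ⟨D ε, hDmem ε⟩) (by
      intro ε ε'
      apply Subtype.ext
      refine hext _ _ fun j v hv => ?_
      change (D (ε * ε')).val *ᵥ v = (D ε * D ε').val *ᵥ v
      rw [Units.val_mul, ← Matrix.mulVec_mulVec, hD ε' j v hv, Matrix.mulVec_smul, hD ε j v hv,
        hD _ j v hv, smul_smul, mul_comm]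
      rfl)
  have hbij : Function.Bijective e₀ := by
    constructor
    · intro ε ε' h
      funext j
      obtain ⟨v, hv, hv0⟩ := hne j
      have h1 : D ε = D ε' := congrArg Subtype.val h
      have h2 := hD ε j v hv
      rw [h1, hD ε' j v hv] at h2
      exact Subtype.ext (Units.ext (smul_left_injective k hv0 h2.symm))
    · rintro ⟨g, hg⟩
      obtain ⟨hg1, hg2⟩ := (hmem g).1 hg
      have hcomm : ∀ (h : H₀) v, Matrix.mulVecLin g.val (((naturalRep n k).comp H₀.subtype) h v) =
          ((naturalRep n k).comp H₀.subtype) h (Matrix.mulVecLin g.val v) := by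
        intro h v
        change g.val *ᵥ (h.1.val *ᵥ v) = h.1.val *ᵥ (g.val *ᵥ v)
        rw [Matrix.mulVec_mulVec, Matrix.mulVec_mulVec, ← Units.val_mul, ← Units.val_mul,
          hg1 h h.2]
      choose l hl using hW.exists_scalar hB hcomm
      -- The form is not zero on `W j`, and an isometry acting there as `l j` multiplies it by `(l
      -- j)²`.
      have hl2 : ∀ j, l j ^ 2 = 1 := by
        intro j
        obtain ⟨w, hw, hw0⟩ := hne j
        have : ∃ v ∈ W j, B.form v w ≠ 0 := by
          by_contra! h
          exact hw0 (hB.eq_zero hw h)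
        obtain ⟨v, hv, hvw⟩ := this
        have h1 := hg2 v w
        have hv' : g.val *ᵥ v = l j • v := hl j v hv
        have hw' : g.val *ᵥ w = l j • w := hl j w hw
        rw [hv', hw', map_smul, map_smul, LinearMap.smul_apply, smul_smul, smul_eq_mul] at h1
        rw [sq]
        exact mul_right_cancel₀ hvw (h1.trans (one_mul _).symm)
      refine ⟨fun j => rootsOfUnity.mkOfPowEq (l j) (hl2 j), ?_⟩
      apply Subtype.ext
      refine hext _ _ fun j v hv => ?_
      exact (hD _ j v hv).trans (hl j v hv).symm
  exact ⟨MulEquiv.ofBijective e₀ hbij, fun ε j v hv => hD ε j v hv⟩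

end Subgroups

/-! ### The underlying representation of an irreducible representation -/

section Representations

variable {n : ℕ} {k : Type*} [Field k]

theorem OuterInvolution.IsExtRep.eq_inl {σ : OuterInvolution n k} {D : Type*} [Group D]
    {N : Subgroup D} {ρ : D →* σ.Ext} (hρ : σ.IsExtRep N ρ) (a : N) :
    ρ a = SemidirectProduct.inl (hρ.underlying a) := by
  apply SemidirectProduct.ext
  · rfl
  · exact (hρ a).2 a.2

theorem range_le_closure {σ : OuterInvolution n k} {D : Type*} [Group D]
    {N : Subgroup D} {ρ : D →* σ.Ext} (hρ : σ.IsExtRep N ρ) {γ : D} (hγ : γ ∉ N) :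
    ρ.range ≤ Subgroup.closure
      (Set.range (fun g => (SemidirectProduct.inl (hρ.underlying g) : σ.Ext)) ∪ {ρ γ}) := by
  have h : ∀ a b : Multiplicative (ZMod 2), a ≠ 1 → b ≠ 1 → a⁻¹ * b = 1 := by decide
  have hN : ∀ a ∈ N, ρ a ∈ Subgroup.closure
      (Set.range (fun g => (SemidirectProduct.inl (hρ.underlying g) : σ.Ext)) ∪ {ρ γ}) :=
    fun a ha => Subgroup.subset_closure (Or.inl ⟨⟨a, ha⟩, (hρ.eq_inl ⟨a, ha⟩).symm⟩)
  rintro _ ⟨a, rfl⟩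
  by_cases ha : a ∈ N
  · exact hN a ha
  · have h1 : γ⁻¹ * a ∈ N := by
      rw [← hρ, map_mul, map_inv, SemidirectProduct.mul_right, SemidirectProduct.inv_right]
      exact h _ _ (fun h => hγ ((hρ _).1 h)) fun h => ha ((hρ _).1 h)
    have h2 : ρ a = ρ γ * ρ (γ⁻¹ * a) := by rw [← map_mul, mul_inv_cancel_left]
    rw [h2]
    exact mul_mem (Subgroup.subset_closure (Or.inr rfl)) (hN _ h1)

theorem zariskiClosure_mono {σ : OuterInvolution n k} {H H' : Subgroup σ.Ext} (h : H ≤ H') :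
    σ.zariskiClosure H ≤ σ.zariskiClosure H' :=
  sInf_le_sInf fun _ hK => ⟨h.trans hK.1, hK.2⟩

theorem OuterInvolution.IsExtRep.mul_self_mem {σ : OuterInvolution n k} {D : Type*} [Group D]
    {N : Subgroup D} {ρ : D →* σ.Ext} (hρ : σ.IsExtRep N ρ) (γ : D) : γ * γ ∈ N := by
  have h : ∀ a : Multiplicative (ZMod 2), a * a = 1 := by decide
  rw [← hρ, map_mul, SemidirectProduct.mul_right]
  exact h _

theorem exists_decomposition_underlyingRep [IsAlgClosed k] (σ : OuterInvolution n k)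
    {D : Type*} [Group D] (N : Subgroup D) [N.Normal] (hN : N.index = 2)
    (ρ : D →* σ.Ext) (hρ : σ.IsExtRep N ρ) (hirr : σ.IsIrreducibleRep ρ) :
    ∃ (m : ℕ) (W : Fin m → Subrepresentation hρ.underlyingRep),
      IsMultiplicityFreeDecomposition W ∧
      (∀ j, IsGammaInvariant N (W j).toRepresentation) ∧
      (∀ γ : D, γ ∉ N → ∀ j, ∀ g ∈ blockFactor (fun i => (W i).toSubmodule) j,
        ∃ g' ∈ blockFactor (fun i => (W i).toSubmodule) j,
          ρ γ * SemidirectProduct.inl g * (ρ γ)⁻¹ = SemidirectProduct.inl g') := by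
  obtain ⟨A, hA, c, hc⟩ := σ.exists_transpose_eq
  have hright : ∀ γ, γ ∉ N → (ρ γ).right ≠ 1 := fun γ hγ h => hγ ((hρ γ).1 h)
  -- The twist is conjugation by `γ⁻¹`, since `form_conj` pairs an element in the first argument
  -- with its conjugate by `ρ γ` in the second.
  let β : D → N → N := fun γ => MulAut.conjNormal (H := N) γ⁻¹
  have hβ : ∀ γ (g : N), ρ γ * SemidirectProduct.inl (hρ.underlying (β γ g)) * (ρ γ)⁻¹ =
      SemidirectProduct.inl (hρ.underlying g) := by
    intro γ g
    rw [← hρ.eq_inl, ← hρ.eq_inl, ← map_inv, ← map_mul, ← map_mul, MulAut.conjNormal_apply]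
    congr 1
    group
  have hs : ∀ γ, ρ γ * ρ γ =
      SemidirectProduct.inl (hρ.underlying ⟨γ * γ, hρ.mul_self_mem γ⟩) := by
    intro γ
    rw [← hρ.eq_inl, ← map_mul]
  let B : ∀ γ, γ ∉ N → TwistedForm hρ.underlyingRep := fun γ hγ =>
    extForm hA hc (hright γ hγ) hρ.underlying (β γ) (hβ γ) _ (hs γ)
  have hB : ∀ γ hγ, (B γ hγ).IsAnisotropic := fun γ hγ =>
    extForm_isAnisotropic hA hc (hright γ hγ) hρ.underlying (β γ) (hβ γ) _ (hs γ) hirr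
      (zariskiClosure_mono (range_le_closure hρ hγ))
  have hBapply : ∀ γ hγ v w, (B γ hγ).form v w = v ⬝ᵥ ((((ρ γ).left * A)⁻¹).val *ᵥ w) :=
    fun γ hγ => extForm_apply hA hc (hright γ hγ) hρ.underlying (β γ) (hβ γ) _ (hs γ)
  obtain ⟨γ₀, hγ₀⟩ : ∃ γ, γ ∉ N := by
    by_contra! h
    have : N = ⊤ := (Subgroup.eq_top_iff' N).2 h
    rw [this, Subgroup.index_top] at hN
    norm_num at hN
  -- The decomposition comes from a single `γ₀`; it is nevertheless orthogonal for the form of every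
  -- `γ` outside `N`.
  obtain ⟨m, W, hW, -⟩ := (hB γ₀ hγ₀).exists_decomposition
  refine ⟨m, W, hW, ?_, ?_⟩
  · intro j γ hγ
    -- The form of `γ`, read as a map from the first argument, intertwines the twisted
    -- representation with the dual; it is inverted below.
    let f : (W j).toSubmodule →ₗ[k] Module.Dual k (W j).toSubmodule :=
      (B γ hγ).form.domRestrict₁₂ (W j).toSubmodule (W j).toSubmodule
    have hf : ∀ u v, f u v = (B γ hγ).form u v := fun u v => rfl
    have hinj : Function.Injective f := by
      rw [← LinearMap.ker_eq_bot, LinearMap.ker_eq_bot']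
      intro u hu
      apply Subtype.ext
      refine (hB γ hγ).eq_zero u.2 fun v hv => ?_
      rw [(B γ hγ).flip]
      have := LinearMap.congr_fun hu ((W j).toRepresentation (B γ hγ).element ⟨v, hv⟩)
      rw [hf] at this
      exact (congrArg _ this).trans (mul_zero _)
    refine ⟨Representation.Equiv.symm (Representation.Equiv.mk
      (LinearMap.linearEquivOfInjective f hinj Subspace.dual_finrank_eq.symm) ?_)⟩
    intro g
    ext u v
    change (B γ hγ).form (hρ.underlyingRep (β γ g) u) v = (B γ hγ).form u (hρ.underlyingRep g⁻¹ v)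
    rw [← (B γ hγ).invariant g u, Representation.self_inv_apply]
    rfl
  · intro γ hγ j g hg
    obtain ⟨g', hg'⟩ : ∃ g', ρ γ * SemidirectProduct.inl g * (ρ γ)⁻¹ = SemidirectProduct.inl g' :=
      ⟨_, conj_inl _ _⟩
    have hform : ∀ v w, (B γ hγ).form (g.val *ᵥ v) (g'.val *ᵥ w) = (B γ hγ).form v w := by
      intro v w
      rw [hBapply γ hγ, hBapply γ hγ]
      exact form_conj hA (hright γ hγ) hg' v w
    refine ⟨g', ⟨mulVec_mem_iff g' fun w hw => ?_, fun i hij w hw => ?_⟩, hg'⟩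
    · refine hW.mem_of_orthogonal (hB γ hγ) fun i hij v hv => ?_
      rw [← hg.2 i hij v hv, hform]
      exact hW.orthogonal (hB γ hγ) hij hv hw
    · rw [← sub_eq_zero]
      apply (B γ hγ).nondegenerate
      -- For `w` in `W i` with `i ≠ j`, replacing `v` by `g v` does not change `B(v, w)`: on `W j`
      -- both values vanish, and elsewhere `g` is the identity. Hence the inverse adjoint fixes `w`.
      have : ((B γ hγ).form.compl₁₂ (Matrix.mulVecLin g.val) LinearMap.id).flip w =
          (B γ hγ).form.flip w := by
        refine linearMap_ext_of_isInternal hW.1 fun l v hv => ?_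
        change (B γ hγ).form (g.val *ᵥ v) w = (B γ hγ).form v w
        by_cases hlj : l = j
        · subst hlj
          rw [hW.orthogonal (hB γ hγ) hij.symm ((hg.1 v).2 hv) hw,
            hW.orthogonal (hB γ hγ) hij.symm hv hw]
        · rw [hg.2 l hlj v hv]
      intro v
      have h1 := LinearMap.congr_fun this ((g⁻¹).val *ᵥ v)
      change (B γ hγ).form (g.val *ᵥ ((g⁻¹).val *ᵥ v)) w = (B γ hγ).form ((g⁻¹).val *ᵥ v) w at h1
      have h2 := hform ((g⁻¹).val *ᵥ v) w
      rw [mulVec_inv_mulVec] at h1 h2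
      rw [map_sub, h2, h1, sub_self]

end Representations

/-! ### Functions with vanishing differential -/

section Scalar

variable {E : Type*} [NormedAddCommGroup E] [NormedSpace ℂ E]
  {Y : Type*} [TopologicalSpace Y] [ChartedSpace E Y] [IsManifold 𝓘(ℂ, E) 1 Y]

/-- A function whose differential vanishes near a point is constant near this point. -/
theorem eventually_eq_of_mfderiv_eq_zero {f : Y → ℂ} {y : Y}
    (hf : ∀ᶠ z in 𝓝 y, MDifferentiableAt 𝓘(ℂ, E) 𝓘(ℂ, ℂ) f z ∧
      mfderiv 𝓘(ℂ, E) 𝓘(ℂ, ℂ) f z = 0) :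
    ∀ᶠ z in 𝓝 y, f z = f y := by
  let c := chartAt E y
  have hy : y ∈ c.source := mem_chart_source E y
  have hcy : c y ∈ c.target := c.map_source hy
  have hpull : ∀ᶠ x in 𝓝 (c y), x ∈ c.target ∧
      MDifferentiableAt 𝓘(ℂ, E) 𝓘(ℂ, ℂ) f (c.symm x) ∧
        mfderiv 𝓘(ℂ, E) 𝓘(ℂ, ℂ) f (c.symm x) = 0 := by
    refine Filter.Eventually.and (c.open_target.mem_nhds hcy) ?_
    have hc : Filter.Tendsto c.symm (𝓝 (c y)) (𝓝 y) := by
      have := (c.continuousAt_symm hcy).tendsto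
      rwa [c.left_inv hy] at this
    exact hc.eventually hf
  obtain ⟨δ, hδ, hball⟩ := Metric.eventually_nhds_iff_ball.1 hpull
  have hder : ∀ x ∈ Metric.ball (c y) δ, HasFDerivAt (f ∘ c.symm) (0 : E →L[ℂ] ℂ) x := by
    intro x hx
    obtain ⟨hxt, hfd, hf0⟩ := hball x hx
    have hs : MDifferentiableAt 𝓘(ℂ, E) 𝓘(ℂ, E) c.symm x :=
      mdifferentiableAt_atlas_symm (chart_mem_atlas E y) hxt
    have h1 : HasMFDerivAt 𝓘(ℂ, E) 𝓘(ℂ, ℂ) (f ∘ c.symm) x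
        ((mfderiv 𝓘(ℂ, E) 𝓘(ℂ, ℂ) f (c.symm x)).comp (mfderiv 𝓘(ℂ, E) 𝓘(ℂ, E) c.symm x)) :=
      hfd.hasMFDerivAt.comp x hs.hasMFDerivAt
    rw [hf0] at h1
    have h2 := hasMFDerivAt_iff_hasFDerivAt.1 h1
    convert! h2 using 1
  have hconst : ∀ x ∈ Metric.ball (c y) δ, (f ∘ c.symm) x = (f ∘ c.symm) (c y) := by
    intro x hx
    refine (Metric.isOpen_ball).is_const_of_fderiv_eq_zero (𝕜 := ℂ)
      (convex_ball (c y) δ).isPreconnected ?_ ?_ hx (Metric.mem_ball_self hδ)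
    · exact fun z hz => (hder z hz).differentiableAt.differentiableWithinAt
    · exact fun z hz => (hder z hz).fderiv
  have hcont : ∀ᶠ z in 𝓝 y, c z ∈ Metric.ball (c y) δ :=
    (c.continuousAt hy).eventually (Metric.ball_mem_nhds _ hδ)
  filter_upwards [hcont, c.open_source.mem_nhds hy] with z hz hzs
  have := hconst _ hz
  simpa only [Function.comp_apply, c.left_inv hzs, c.left_inv hy] using this

end Scalar

/-! ### Linear combinations of horizontal sections -/

section Horizontal

variable {E : Type*} [NormedAddCommGroup E] [NormedSpace ℂ E]
  {Y : Type*} [TopologicalSpace Y] [ChartedSpace E Y]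
  {F : Type*} [NormedAddCommGroup F] [NormedSpace ℂ F]
  {V : Y → Type*} [TopologicalSpace (TotalSpace F V)]
  [∀ y, AddCommGroup (V y)] [∀ y, Module ℂ (V y)] [∀ y, TopologicalSpace (V y)]
  [∀ y, IsTopologicalAddGroup (V y)] [∀ y, ContinuousSMul ℂ (V y)]
  [FiberBundle F V] {cov : CovariantDerivative 𝓘(ℂ, E) F V} {s t : ∀ y, V y} {U U' : Set Y} {y : Y}

theorem IsHorizontalOn.mono (h : IsHorizontalOn cov s U) (hU : U' ⊆ U) :
    IsHorizontalOn cov s U' :=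
  ⟨h.1.mono hU, fun y hy => h.2 y (hU hy)⟩

theorem IsHorizontalOn.mdifferentiableAt (h : IsHorizontalOn cov s U) (hU : IsOpen U)
    (hy : y ∈ U) : MDifferentiableAt 𝓘(ℂ, E) (𝓘(ℂ, E).prod 𝓘(ℂ, F))
      (fun y => TotalSpace.mk' F y (s y)) y :=
  (h.1.contMDiffAt (hU.mem_nhds hy)).mdifferentiableAt (by simp)

variable [VectorBundle ℂ F V]

theorem IsHorizontalOn.zero : IsHorizontalOn cov (0 : ∀ y, V y) U := by
  refine ⟨?_, fun y _ => cov.isCovariantDerivativeOnUniv.zero⟩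
  exact (contMDiff_zeroSection ℂ V).contMDiffOn

theorem IsHorizontalOn.add (hs : IsHorizontalOn cov s U) (ht : IsHorizontalOn cov t U)
    (hU : IsOpen U) : IsHorizontalOn cov (s + t) U := by
  refine ⟨ContMDiffOn.add_section hs.1 ht.1, fun y hy => ?_⟩
  rw [cov.isCovariantDerivativeOnUniv.add (hs.mdifferentiableAt hU hy)
    (ht.mdifferentiableAt hU hy), hs.2 y hy, ht.2 y hy, add_zero]

theorem IsHorizontalOn.smul (hs : IsHorizontalOn cov s U) (hU : IsOpen U) (c : ℂ) :
    IsHorizontalOn cov (c • s) U := by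
  refine ⟨ContMDiffOn.const_smul_section hs.1, fun y hy => ?_⟩
  rw [cov.isCovariantDerivativeOnUniv.smul_const c (hs.mdifferentiableAt hU hy), hs.2 y hy,
    smul_zero]

theorem IsHorizontalOn.sum {ι : Type*} {e : ι → ∀ y, V y} (he : ∀ i, IsHorizontalOn cov (e i) U)
    (hU : IsOpen U) (c : ι → ℂ) (S : Finset ι) :
    IsHorizontalOn cov (∑ i ∈ S, c i • e i) U := by
  classical
  induction S using Finset.induction_on with
  | empty => exact IsHorizontalOn.zero
  | insert i S hi ih =>
    rw [Finset.sum_insert hi]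
    exact ((he i).smul hU (c i)).add ih hU

end Horizontal

/-! ### Horizontal frames and constancy of coefficients -/

section Frame

variable {E : Type*} [NormedAddCommGroup E] [NormedSpace ℂ E]
  {Y : Type*} [TopologicalSpace Y] [ChartedSpace E Y]
  {F : Type*} [NormedAddCommGroup F] [NormedSpace ℂ F]
  {V : Y → Type*} [TopologicalSpace (TotalSpace F V)]
  [∀ y, AddCommGroup (V y)] [∀ y, Module ℂ (V y)] [∀ y, TopologicalSpace (V y)]
  [∀ y, IsTopologicalAddGroup (V y)] [∀ y, ContinuousSMul ℂ (V y)]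
  [FiberBundle F V]

/-- A frame of holomorphic horizontal sections over the open set `U`. -/
structure IsHorizontalFrame (cov : CovariantDerivative 𝓘(ℂ, E) F V) {d : ℕ}
    (e : Fin d → ∀ z, V z) (U : Set Y) : Prop where
  isOpen : IsOpen U
  horizontal : ∀ i, IsHorizontalOn cov (e i) U
  linearIndependent : ∀ z ∈ U, LinearIndependent ℂ (fun i => e i z)
  span : ∀ z ∈ U, Submodule.span ℂ (Set.range fun i => e i z) = ⊤

variable {cov : CovariantDerivative 𝓘(ℂ, E) F V} {s t : ∀ y, V y} {U U' : Set Y} {y z : Y}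
  {d : ℕ} {e : Fin d → ∀ z, V z}

theorem IsFlat.exists_frame (h : IsFlat cov) (y : Y) :
    ∃ (U : Set Y) (d : ℕ) (e : Fin d → ∀ z, V z), y ∈ U ∧ IsHorizontalFrame cov e U := by
  obtain ⟨U, hU, hy, d, e, he, hs⟩ := h y
  exact ⟨U, d, e, hy, hU, he, fun z hz => (hs z hz).1, fun z hz => (hs z hz).2⟩

/-- The basis of a fibre given by a horizontal frame. -/
noncomputable def IsHorizontalFrame.basis (h : IsHorizontalFrame cov e U) (hz : z ∈ U) :
    Module.Basis (Fin d) ℂ (V z) :=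
  Module.Basis.mk (h.linearIndependent z hz) (h.span z hz).ge

@[simp]
theorem IsHorizontalFrame.basis_apply (h : IsHorizontalFrame cov e U) (hz : z ∈ U) (i : Fin d) :
    h.basis hz i = e i z := by
  simp [IsHorizontalFrame.basis]

theorem IsHorizontalFrame.equivFun_symm_apply (h : IsHorizontalFrame cov e U) (hz : z ∈ U)
    (c : Fin d → ℂ) : (h.basis hz).equivFun.symm c = ∑ i, c i • e i z := by
  simp [Module.Basis.equivFun_symm_apply]

theorem IsHorizontalFrame.mono (h : IsHorizontalFrame cov e U) (hU : U' ⊆ U) (hU' : IsOpen U') :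
    IsHorizontalFrame cov e U' :=
  ⟨hU', fun i => (h.horizontal i).mono hU, fun z hz => h.linearIndependent z (hU hz),
    fun z hz => h.span z (hU hz)⟩

open Classical in
/-- The coefficients of a section with respect to a horizontal frame. -/
noncomputable def IsHorizontalFrame.coeff (h : IsHorizontalFrame cov e U) (s : ∀ z, V z) (z : Y) :
    Fin d → ℂ :=
  if hz : z ∈ U then (h.basis hz).equivFun (s z) else 0

theorem IsHorizontalFrame.sum_coeff (h : IsHorizontalFrame cov e U) (s : ∀ z, V z) (hz : z ∈ U) :
    ∑ i, h.coeff s z i • e i z = s z := by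
  rw [← h.equivFun_symm_apply hz, coeff, dif_pos hz, LinearEquiv.symm_apply_apply]

variable [VectorBundle ℂ F V]

theorem IsHorizontalFrame.sum (h : IsHorizontalFrame cov e U) (c : Fin d → ℂ) :
    IsHorizontalOn cov (∑ i, c i • e i) U :=
  IsHorizontalOn.sum h.horizontal h.isOpen c _

theorem IsFlat.exists_horizontal (hcov : IsFlat cov) (y : Y) (v : V y) :
    ∃ (U : Set Y) (u : ∀ z, V z), IsOpen U ∧ y ∈ U ∧ IsHorizontalOn cov u U ∧ u y = v := by
  obtain ⟨U, d, e, hy, h⟩ := hcov.exists_frame y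
  refine ⟨U, _, h.isOpen, hy, h.sum ((h.basis hy).equivFun v), ?_⟩
  have hv := h.equivFun_symm_apply hy ((h.basis hy).equivFun v)
  rw [LinearEquiv.symm_apply_apply] at hv
  refine Eq.trans ?_ hv.symm
  rw [Finset.sum_apply]
  rfl

variable [FiniteDimensional ℂ F] [ContMDiffVectorBundle 1 F V 𝓘(ℂ, E)]

theorem IsHorizontalFrame.mdifferentiableAt_coeff (h : IsHorizontalFrame cov e U)
    (hs : IsHorizontalOn cov s U) (hy : y ∈ U) :
    MDifferentiableAt 𝓘(ℂ, E) 𝓘(ℂ, Fin d → ℂ) (h.coeff s) y := by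
  have : CompleteSpace F := FiniteDimensional.complete ℂ F
  let t := trivializationAt F V y
  have hyt : y ∈ t.baseSet := FiberBundle.mem_baseSet_trivializationAt' y
  -- The frame read in a local trivialisation: `L z` is invertible and depends differentiably on
  -- `z`, and the coefficients of `s` are `(L z)⁻¹` applied to the trivialised section.
  let L : Y → (Fin d → ℂ) →L[ℂ] F := fun z => ∑ i,
    ContinuousLinearMap.smulRightL ℂ (Fin d → ℂ) F (ContinuousLinearMap.proj i)
      (t (TotalSpace.mk' F z (e i z))).2
  have hL : MDifferentiableAt 𝓘(ℂ, E) 𝓘(ℂ, (Fin d → ℂ) →L[ℂ] F) L y := by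
    have hsum : L = ∑ i, fun z => ContinuousLinearMap.smulRightL ℂ (Fin d → ℂ) F
        (ContinuousLinearMap.proj i) (t (TotalSpace.mk' F z (e i z))).2 := by
      ext z : 1
      rw [Finset.sum_apply]
    rw [hsum]
    refine MDifferentiableAt.sum fun i _ => ?_
    refine (ContinuousLinearMap.smulRightL ℂ (Fin d → ℂ) F
      (ContinuousLinearMap.proj i)).differentiableAt.comp_mdifferentiableAt ?_
    exact (t.mdifferentiableAt_section_iff _ (e i) hyt).1
      ((h.horizontal i).mdifferentiableAt h.isOpen hy)
  have hs' : MDifferentiableAt 𝓘(ℂ, E) 𝓘(ℂ, F) (fun z => (t (TotalSpace.mk' F z (s z))).2) y :=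
    (t.mdifferentiableAt_section_iff _ s hyt).1 (hs.mdifferentiableAt h.isOpen hy)
  have hinv : ∀ z, ∀ hz : z ∈ U, ∀ hzt : z ∈ t.baseSet,
      L z = (((h.basis hz).equivFun.symm ≪≫ₗ
        t.linearEquivAt ℂ z hzt).toContinuousLinearEquiv : (Fin d → ℂ) →L[ℂ] F) := by
    intro z hz hzt
    ext1 c
    simp only [L, _root_.sum_apply]
    change ∑ i, c i • t.linearEquivAt ℂ z hzt (e i z) =
      t.linearEquivAt ℂ z hzt ((h.basis hz).equivFun.symm c)
    rw [h.equivFun_symm_apply, map_sum]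
    simp
  have hLy : (L y).IsInvertible := ⟨_, (hinv y hy hyt).symm⟩
  have hLi : MDifferentiableAt 𝓘(ℂ, E) 𝓘(ℂ, F →L[ℂ] (Fin d → ℂ)) (fun z => (L z).inverse) y :=
    ((hLy.contDiffAt_map_inverse (n := 1)).differentiableAt one_ne_zero).comp_mdifferentiableAt hL
  refine (hLi.clm_apply hs').congr_of_eventuallyEq ?_
  filter_upwards [h.isOpen.mem_nhds hy, t.open_baseSet.mem_nhds hyt] with z hz hzt
  rw [hinv z hz hzt, ContinuousLinearMap.inverse_equiv, coeff, dif_pos hz]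
  change _ = (h.basis hz).equivFun ((t.linearEquivAt ℂ z hzt).symm (t.linearEquivAt ℂ z hzt (s z)))
  rw [LinearEquiv.symm_apply_apply]

/-- Write `s = ∑ cᵢ eᵢ`. The Leibniz rule gives `0 = ∇s = ∑ dcᵢ ⊗ eᵢ`, and the `eᵢ` are linearly
independent. -/
theorem IsHorizontalFrame.mfderiv_coeff (h : IsHorizontalFrame cov e U)
    (hs : IsHorizontalOn cov s U) (hy : y ∈ U) (i : Fin d) :
    MDifferentiableAt 𝓘(ℂ, E) 𝓘(ℂ, ℂ) (fun z => h.coeff s z i) y ∧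
      mfderiv 𝓘(ℂ, E) 𝓘(ℂ, ℂ) (fun z => h.coeff s z i) y = 0 := by
  have hd : ∀ i, MDifferentiableAt 𝓘(ℂ, E) 𝓘(ℂ, ℂ) (fun z => h.coeff s z i) y := fun i =>
    (ContinuousLinearMap.proj (R := ℂ) (φ := fun _ : Fin d => ℂ)
      i).differentiableAt.comp_mdifferentiableAt (h.mdifferentiableAt_coeff hs hy)
  refine ⟨hd i, ?_⟩
  have he : ∀ i, MDifferentiableAt 𝓘(ℂ, E) (𝓘(ℂ, E).prod 𝓘(ℂ, F))
      (fun z => TotalSpace.mk' F z (e i z)) y := fun i =>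
    (h.horizontal i).mdifferentiableAt h.isOpen hy
  have hsum : ∀ S : Finset (Fin d), MDifferentiableAt 𝓘(ℂ, E) (𝓘(ℂ, E).prod 𝓘(ℂ, F))
      (fun z => TotalSpace.mk' F z ((∑ i ∈ S, (fun z => h.coeff s z i) • e i) z)) y ∧
      cov (∑ i ∈ S, (fun z => h.coeff s z i) • e i) y =
        ∑ i ∈ S, (mvfderiv 𝓘(ℂ, E) (fun z => h.coeff s z i) y).smulRight (e i y) := by
    intro S
    classical
    induction S using Finset.induction_on with
    | empty =>
      refine ⟨((contMDiff_zeroSection ℂ V (n := 1)).mdifferentiable one_ne_zero) y, ?_⟩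
      simp
    | insert j S hj ih =>
      have hj' := (hd j).smul_section (he j)
      rw [Finset.sum_insert hj, Finset.sum_insert hj]
      refine ⟨mdifferentiableAt_add_section hj' ih.1, ?_⟩
      rw [cov.isCovariantDerivativeOnUniv.add hj' ih.1, ih.2,
        cov.isCovariantDerivativeOnUniv.leibniz (he j) (hd j), (h.horizontal j).2 y hy, smul_zero,
        zero_add]
  have heq : cov (∑ i, (fun z => h.coeff s z i) • e i) y = 0 := by
    rw [← hs.2 y hy]
    refine cov.isCovariantDerivativeOnUniv.congr_of_eventuallyEq (hsum _).1
      (hs.mdifferentiableAt h.isOpen hy) Filter.univ_mem ?_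
    filter_upwards [h.isOpen.mem_nhds hy] with z hz
    rw [← h.sum_coeff s hz, Finset.sum_apply]
    rfl
  rw [(hsum _).2] at heq
  ext1 v
  have h0 := congrArg (fun A : TangentSpace 𝓘(ℂ, E) y →L[ℂ] V y => A v) heq
  simp only [_root_.sum_apply, ContinuousLinearMap.smulRight_apply] at h0
  exact Fintype.linearIndependent_iff.1 (h.linearIndependent y hy) _ h0 i

variable [IsManifold 𝓘(ℂ, E) 1 Y]

/-- A horizontal section has locally constant coefficients in a horizontal frame. -/
theorem IsHorizontalFrame.eventually_coeff_eq (h : IsHorizontalFrame cov e U)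
    (hs : IsHorizontalOn cov s U) (hy : y ∈ U) : ∀ᶠ z in 𝓝 y, h.coeff s z = h.coeff s y := by
  simp only [funext_iff, Filter.eventually_all]
  intro i
  refine eventually_eq_of_mfderiv_eq_zero (E := E) ?_
  filter_upwards [h.isOpen.mem_nhds hy] with z hz
  exact h.mfderiv_coeff hs hz i

/-- Near a point, a horizontal section is a linear combination of the sections of a horizontal frame
with constant coefficients. -/
theorem IsHorizontalFrame.eventually_eq_sum (h : IsHorizontalFrame cov e U) (hyU : y ∈ U)
    (hs : IsHorizontalOn cov s U') (hU' : IsOpen U') (hy : y ∈ U') :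
    ∃ c : Fin d → ℂ, ∀ᶠ z in 𝓝 y, s z = ∑ i, c i • e i z := by
  have h' := h.mono Set.inter_subset_left (h.isOpen.inter hU')
  have hs' : IsHorizontalOn cov s (U ∩ U') := hs.mono Set.inter_subset_right
  refine ⟨h'.coeff s y, ?_⟩
  filter_upwards [h'.eventually_coeff_eq hs' ⟨hyU, hy⟩, h'.isOpen.mem_nhds ⟨hyU, hy⟩] with z hz hzU
  rw [← hz, h'.sum_coeff s hzU]

/-- Two horizontal sections which agree at a point agree near this point, and conversely. -/
theorem IsFlat.eventually_eq_iff (hcov : IsFlat cov) (hs : IsHorizontalOn cov s U) (hU : IsOpen U)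
    (hyU : y ∈ U) (ht : IsHorizontalOn cov t U') (hU' : IsOpen U') (hyU' : y ∈ U') :
    ∀ᶠ z in 𝓝 y, s z = t z ↔ s y = t y := by
  obtain ⟨U₀, d, e, hy, h⟩ := hcov.exists_frame y
  obtain ⟨c, hc⟩ := h.eventually_eq_sum hy hs hU hyU
  obtain ⟨c', hc'⟩ := h.eventually_eq_sum hy ht hU' hyU'
  have key : ∀ z ∈ U₀, (∑ i, c i • e i z = ∑ i, c' i • e i z ↔ c = c') := by
    intro z hz
    rw [← h.equivFun_symm_apply hz, ← h.equivFun_symm_apply hz]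
    exact (h.basis hz).equivFun.symm.injective.eq_iff
  filter_upwards [hc, hc', h.isOpen.mem_nhds hy] with z hz hz' hzU
  rw [hz, hz', hc.self_of_nhds, hc'.self_of_nhds, key z hzU, key y hy]

end Frame

/-! ### The étalé space of horizontal sections as a covering space -/

section LeafSpace

variable {E : Type*} [NormedAddCommGroup E] [NormedSpace ℂ E]
  {Y : Type*} [TopologicalSpace Y] [ChartedSpace E Y]
  {F : Type*} [NormedAddCommGroup F] [NormedSpace ℂ F]
  {V : Y → Type*} [TopologicalSpace (TotalSpace F V)]
  [∀ y, AddCommGroup (V y)] [∀ y, Module ℂ (V y)] [∀ y, TopologicalSpace (V y)]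
  [∀ y, IsTopologicalAddGroup (V y)] [∀ y, ContinuousSMul ℂ (V y)]
  [FiberBundle F V]

/-- The total space of a bundle with connection, with the topology in which the horizontal sections
are open: the étalé space of the sheaf of horizontal sections if the connection is flat. -/
structure LeafSpace (cov : CovariantDerivative 𝓘(ℂ, E) F V) where
  /-- The base point. -/
  base : Y
  /-- The vector in the fibre over the base point. -/
  vec : V base

variable {cov : CovariantDerivative 𝓘(ℂ, E) F V} {s u : ∀ y, V y} {U : Set Y} {x y : Y}

/-- The final topology for all local horizontal sections; flatness is what later makes their images
open. -/
instance : TopologicalSpace (LeafSpace cov) where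
  IsOpen O := ∀ (U : Set Y) (s : ∀ y, V y), IsOpen U → IsHorizontalOn cov s U → ∀ y ∈ U,
    (⟨y, s y⟩ : LeafSpace cov) ∈ O → ∀ᶠ z in 𝓝 y, (⟨z, s z⟩ : LeafSpace cov) ∈ O
  isOpen_univ _ _ _ _ _ _ _ := Filter.Eventually.of_forall fun _ => Set.mem_univ _
  isOpen_inter O O' h h' U s hU hs y hy hm :=
    (h U s hU hs y hy hm.1).and (h' U s hU hs y hy hm.2)
  isOpen_sUnion 𝒪 h U s hU hs y hy := by
    rintro ⟨O, hO, hm⟩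
    exact (h O hO U s hU hs y hy hm).mono fun z hz => ⟨O, hO, hz⟩

theorem IsHorizontalOn.continuousAt (hs : IsHorizontalOn cov s U) (hU : IsOpen U) (hy : y ∈ U) :
    ContinuousAt (fun z => (⟨z, s z⟩ : LeafSpace cov)) y := by
  intro N hN
  obtain ⟨O, hON, hO, hyO⟩ := mem_nhds_iff.1 hN
  exact (hO U s hU hs y hy hyO).mono fun z hz => hON hz

theorem LeafSpace.continuous_base : Continuous (LeafSpace.base : LeafSpace cov → Y) :=
  ⟨fun _ hO _ _ _ _ _ _ hm => hO.mem_nhds hm⟩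

/-- Equality of points of the leaf space replaces casts between fibres over points that are only
propositionally equal, such as `γ 0` and `x`. -/
theorem LeafSpace.cast_add {a b : Y} {p p' : V a} {q q' : V b}
    (h : (⟨a, p⟩ : LeafSpace cov) = ⟨b, q⟩) (h' : (⟨a, p'⟩ : LeafSpace cov) = ⟨b, q'⟩) :
    (⟨a, p + p'⟩ : LeafSpace cov) = ⟨b, q + q'⟩ := by
  cases h
  cases h'
  rfl

theorem LeafSpace.cast_smul {a b : Y} {p : V a} {q : V b} (c : ℂ)
    (h : (⟨a, p⟩ : LeafSpace cov) = ⟨b, q⟩) :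
    (⟨a, c • p⟩ : LeafSpace cov) = ⟨b, c • q⟩ := by
  cases h
  rfl

theorem LeafSpace.mk_injective {a : Y} {p q : V a} (h : (⟨a, p⟩ : LeafSpace cov) = ⟨a, q⟩) :
    p = q := by
  cases h
  rfl

variable [VectorBundle ℂ F V] [FiniteDimensional ℂ F] [ContMDiffVectorBundle 1 F V 𝓘(ℂ, E)]
  [IsManifold 𝓘(ℂ, E) 1 Y]

/-- Two horizontal sections that agree at a point agree nearby, so the image of one is open along
every other. -/
theorem IsHorizontalOn.isOpen_range (hcov : IsFlat cov) (hs : IsHorizontalOn cov s U)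
    (hU : IsOpen U) :
    IsOpen {a : LeafSpace cov | a.base ∈ U ∧ a.vec = s a.base} := by
  intro U' t hU' ht y hy hm
  filter_upwards [hcov.eventually_eq_iff ht hU' hy hs hU hm.1, hU.mem_nhds hm.1] with z hz hzU
  exact ⟨hzU, hz.2 hm.2⟩

theorem IsHorizontalFrame.isEvenlyCovered {d : ℕ} {e : Fin d → ∀ z, V z}
    (h : IsHorizontalFrame cov e U) (hcov : IsFlat cov) (hy : y ∈ U) :
    @IsEvenlyCovered _ _ _ _ (LeafSpace.base : LeafSpace cov → Y) y (Fin d → ℂ) ⊥ := by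
  -- The sheets over `U` are the combinations of the frame with constant coefficients, so the
  -- coefficient space carries the discrete topology.
  let :  TopologicalSpace (Fin d → ℂ) := ⊥
  have : DiscreteTopology (Fin d → ℂ) := ⟨rfl⟩
  refine ⟨inferInstance, U, hy, h.isOpen, LeafSpace.continuous_base.isOpen_preimage _ h.isOpen,
    ⟨⟨fun a => (⟨a.1.base, a.2⟩, (h.basis a.2).equivFun a.1.vec),
      fun a => ⟨⟨a.1, (h.basis a.1.2).equivFun.symm a.2⟩, a.1.2⟩, ?_, ?_⟩, ?_, ?_⟩, fun a => rfl⟩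
  · intro a
    simp only [LinearEquiv.symm_apply_apply]
  · intro a
    simp only [LinearEquiv.apply_symm_apply]
  · refine Continuous.prodMk
      ((LeafSpace.continuous_base.comp continuous_subtype_val).subtype_mk _) ?_
    rw [continuous_discrete_rng]
    intro c
    have hO := (h.sum c).isOpen_range hcov h.isOpen
    convert! hO.preimage (continuous_subtype_val (p := fun a : LeafSpace cov => a.base ∈ U)) using 1
    ext a
    have ha : a.1.base ∈ U := a.2
    change (h.basis ha).equivFun a.1.vec = c ↔ (a.1.base ∈ U ∧ a.1.vec = _)
    rw [← LinearEquiv.eq_symm_apply, h.equivFun_symm_apply]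
    simp [ha]
  · rw [continuous_prod_of_discrete_right]
    intro c
    refine Continuous.subtype_mk ?_ _
    rw [continuous_iff_continuousAt]
    intro z
    have := ((h.sum c).continuousAt h.isOpen z.2).comp
      (continuous_subtype_val (p := fun z : Y => z ∈ U)).continuousAt
    convert! this using 1
    ext1 w
    simp [h.equivFun_symm_apply w.2]

theorem IsFlat.isCoveringMap (hcov : IsFlat cov) :
    IsCoveringMap (LeafSpace.base : LeafSpace cov → Y) := by
  intro y
  obtain ⟨U, d, e, hy, h⟩ := hcov.exists_frame y
  exact @IsEvenlyCovered.to_isEvenlyCovered_preimage _ _ _ _ _ _ ⊥ _ (h.isEvenlyCovered hcov hy)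

/-- A continuous map to the leaf space is locally a horizontal section. -/
theorem IsFlat.continuousAt_leaf_iff (hcov : IsFlat cov) {A : Type*} [TopologicalSpace A]
    {γ : A → Y} {a : A} (hγ : ContinuousAt γ a) (s : ∀ a, V (γ a)) :
    ContinuousAt (fun a => (⟨γ a, s a⟩ : LeafSpace cov)) a ↔
      ∃ (U : Set Y) (u : ∀ z, V z), IsOpen U ∧ γ a ∈ U ∧ IsHorizontalOn cov u U ∧
        ∀ᶠ b in 𝓝 a, s b = u (γ b) := by
  constructor
  · intro h
    obtain ⟨U, u, hU, hy, hu, hs⟩ := hcov.exists_horizontal (γ a) (s a)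
    refine ⟨U, u, hU, hy, hu, ?_⟩
    exact (h.eventually ((hu.isOpen_range hcov hU).mem_nhds ⟨hy, hs.symm⟩)).mono fun b hb => hb.2
  · rintro ⟨U, u, hU, hy, hu, hs⟩
    refine ContinuousAt.congr ((hu.continuousAt hU hy).comp hγ) ?_
    filter_upwards [hs] with b hb
    simp [hb]

end LeafSpace

/-! ### Parallel transport along homotopy classes of paths -/

section Transport

variable {E : Type*} [NormedAddCommGroup E] [NormedSpace ℂ E]
  {Y : Type*} [TopologicalSpace Y] [ChartedSpace E Y]
  {F : Type*} [NormedAddCommGroup F] [NormedSpace ℂ F]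
  {V : Y → Type*} [TopologicalSpace (TotalSpace F V)]
  [∀ y, AddCommGroup (V y)] [∀ y, Module ℂ (V y)] [∀ y, TopologicalSpace (V y)]
  [∀ y, IsTopologicalAddGroup (V y)] [∀ y, ContinuousSMul ℂ (V y)]
  [FiberBundle F V] [VectorBundle ℂ F V] [FiniteDimensional ℂ F]
  [ContMDiffVectorBundle 1 F V 𝓘(ℂ, E)] [IsManifold 𝓘(ℂ, E) 1 Y]
  {cov : CovariantDerivative 𝓘(ℂ, E) F V} {s u : ∀ y, V y} {U : Set Y} {x y z : Y}

/-- A parallel family of vectors along a path. -/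
def IsParallelAlong (cov : CovariantDerivative 𝓘(ℂ, E) F V) (γ : Path x y)
    (s : ∀ t, V (γ t)) : Prop :=
  Continuous fun t => (⟨γ t, s t⟩ : LeafSpace cov)

theorem IsFlat.isParallelAlong_iff (hcov : IsFlat cov) {γ : Path x y} {s : ∀ t, V (γ t)} :
    IsParallelAlong cov γ s ↔ ∀ t, ∃ (U : Set Y) (u : ∀ z, V z), IsOpen U ∧ γ t ∈ U ∧
      IsHorizontalOn cov u U ∧ ∀ᶠ t' in 𝓝 t, s t' = u (γ t') := by
  rw [IsParallelAlong, continuous_iff_continuousAt]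
  exact forall_congr' fun t => hcov.continuousAt_leaf_iff γ.continuous.continuousAt s

theorem IsParallelAlong.add (hcov : IsFlat cov) {γ : Path x y} {s s' : ∀ t, V (γ t)}
    (h : IsParallelAlong cov γ s) (h' : IsParallelAlong cov γ s') :
    IsParallelAlong cov γ (fun t => s t + s' t) := by
  rw [hcov.isParallelAlong_iff] at *
  intro t
  obtain ⟨U, u, hU, ht, hu, hs⟩ := h t
  obtain ⟨U', u', hU', ht', hu', hs'⟩ := h' t
  refine ⟨U ∩ U', u + u', hU.inter hU', ⟨ht, ht'⟩, (hu.mono Set.inter_subset_left).add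
    (hu'.mono Set.inter_subset_right) (hU.inter hU'), ?_⟩
  filter_upwards [hs, hs'] with a ha ha'
  rw [ha, ha']
  rfl

theorem IsParallelAlong.smul (hcov : IsFlat cov) {γ : Path x y} {s : ∀ t, V (γ t)}
    (h : IsParallelAlong cov γ s) (c : ℂ) : IsParallelAlong cov γ (fun t => c • s t) := by
  rw [hcov.isParallelAlong_iff] at *
  intro t
  obtain ⟨U, u, hU, ht, hu, hs⟩ := h t
  refine ⟨U, c • u, hU, ht, hu.smul hU c, ?_⟩
  filter_upwards [hs] with a ha
  rw [ha]
  rfl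

/-- Parallel transport along a homotopy class of paths, as a map. -/
noncomputable def IsFlat.transportFun (hcov : IsFlat cov) (q : Path.Homotopic.Quotient x y)
    (v : V x) : V y :=
  (hcov.isCoveringMap.monodromy q ⟨⟨x, v⟩, rfl⟩).2 ▸
    (hcov.isCoveringMap.monodromy q ⟨⟨x, v⟩, rfl⟩).1.vec

theorem IsFlat.mk_transportFun (hcov : IsFlat cov) (q : Path.Homotopic.Quotient x y) (v : V x) :
    (⟨⟨y, hcov.transportFun q v⟩, rfl⟩ : (LeafSpace.base : LeafSpace cov → Y) ⁻¹' {y}) =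
      hcov.isCoveringMap.monodromy q ⟨⟨x, v⟩, rfl⟩ := by
  have key : ∀ a : (LeafSpace.base : LeafSpace cov → Y) ⁻¹' {y},
      (⟨⟨y, (show a.1.base = y from a.2) ▸ a.1.vec⟩, rfl⟩ :
        (LeafSpace.base : LeafSpace cov → Y) ⁻¹' {y}) = a := by
    rintro ⟨⟨b, v⟩, h⟩
    obtain rfl : b = y := h
    rfl
  exact key _

theorem IsFlat.exists_parallel (hcov : IsFlat cov) (γ : Path x y) (v : V x) :
    ∃ s : ∀ t, V (γ t), IsParallelAlong cov γ s ∧ (⟨γ 0, s 0⟩ : LeafSpace cov) = ⟨x, v⟩ ∧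
      (⟨γ 1, s 1⟩ : LeafSpace cov) = ⟨y, hcov.transportFun (.mk γ) v⟩ := by
  have h0 : γ 0 = LeafSpace.base (⟨x, v⟩ : LeafSpace cov) := γ.source
  let Γ := hcov.isCoveringMap.liftPath γ ⟨x, v⟩ h0
  have hΓ : ∀ t, (Γ t).base = γ t := fun t =>
    congrFun (hcov.isCoveringMap.liftPath_lifts γ ⟨x, v⟩ h0) t
  have key : ∀ t, ∃ w : V (γ t), (⟨γ t, w⟩ : LeafSpace cov) = Γ t := by
    intro t
    have := hΓ t
    generalize Γ t = a at this
    generalize γ t = b at this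
    subst this
    exact ⟨a.vec, rfl⟩
  choose s hs using key
  refine ⟨s, ?_, ?_, ?_⟩
  · rw [IsParallelAlong]
    simp only [hs]
    exact Γ.continuous
  · rw [hs]
    exact hcov.isCoveringMap.liftPath_zero γ ⟨x, v⟩ h0
  · rw [hs]
    exact (congrArg Subtype.val (hcov.mk_transportFun (.mk γ) v)).symm

/-- Uniqueness of path lifting: any parallel family computes the monodromy of the covering,
whichever way it was constructed. -/
theorem IsParallelAlong.transportFun_eq (hcov : IsFlat cov) {γ : Path x y} {s : ∀ t, V (γ t)}
    (h : IsParallelAlong cov γ s) {v : V x} {w : V y}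
    (h0 : (⟨γ 0, s 0⟩ : LeafSpace cov) = ⟨x, v⟩) (h1 : (⟨γ 1, s 1⟩ : LeafSpace cov) = ⟨y, w⟩) :
    hcov.transportFun (.mk γ) v = w := by
  apply LeafSpace.mk_injective (cov := cov)
  refine (congrArg Subtype.val (hcov.mk_transportFun (.mk γ) v)).trans ?_
  rw [← h1]
  have := (hcov.isCoveringMap.eq_liftPath_iff (γ := γ.toContinuousMap) (e := ⟨x, v⟩)
    (γ_0 := γ.source) (Γ := fun t => (⟨γ t, s t⟩ : LeafSpace cov))).2 ⟨h, rfl, h0⟩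
  exact (congrFun this 1).symm

theorem IsFlat.transportFun_trans (hcov : IsFlat cov) (q : Path.Homotopic.Quotient x y)
    (q' : Path.Homotopic.Quotient y z) (v : V x) :
    hcov.transportFun (q.trans q') v = hcov.transportFun q' (hcov.transportFun q v) := by
  apply LeafSpace.mk_injective (cov := cov)
  have h1 := hcov.mk_transportFun (q.trans q') v
  have h2 := hcov.mk_transportFun q' (hcov.transportFun q v)
  rw [hcov.isCoveringMap.monodromy_trans_apply, ← hcov.mk_transportFun, ← h2] at h1
  exact congrArg Subtype.val h1

theorem IsFlat.transportFun_refl (hcov : IsFlat cov) (v : V x) :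
    hcov.transportFun (.refl x) v = v := by
  apply LeafSpace.mk_injective (cov := cov)
  have h1 := hcov.mk_transportFun (.refl x) v
  rw [hcov.isCoveringMap.monodromy_refl] at h1
  exact congrArg Subtype.val h1

theorem quotient_trans_symm (q : Path.Homotopic.Quotient x y) : q.trans q.symm = .refl x := by
  induction q using Path.Homotopic.Quotient.ind with
  | mk γ =>
    rw [← Path.Homotopic.Quotient.mk_symm, ← Path.Homotopic.Quotient.mk_trans]
    exact (Path.Homotopic.Quotient.eq.2 ⟨Path.Homotopy.reflTransSymm γ⟩).symm

theorem quotient_symm_trans (q : Path.Homotopic.Quotient x y) : q.symm.trans q = .refl y := by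
  induction q using Path.Homotopic.Quotient.ind with
  | mk γ =>
    rw [← Path.Homotopic.Quotient.mk_symm, ← Path.Homotopic.Quotient.mk_trans]
    exact (Path.Homotopic.Quotient.eq.2 ⟨Path.Homotopy.reflSymmTrans γ⟩).symm

/-- Parallel transport along a homotopy class of paths. -/
noncomputable def IsFlat.transport (hcov : IsFlat cov) (q : Path.Homotopic.Quotient x y) :
    V x ≃ₗ[ℂ] V y where
  toFun := hcov.transportFun q
  -- The sum of two parallel families is parallel, so it computes the transport of the sum.
  map_add' v w := by
    induction q using Path.Homotopic.Quotient.ind with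
    | mk γ =>
      obtain ⟨s, hs, h0, h1⟩ := hcov.exists_parallel γ v
      obtain ⟨s', hs', h0', h1'⟩ := hcov.exists_parallel γ w
      exact (hs.add hcov hs').transportFun_eq hcov (LeafSpace.cast_add h0 h0')
        (LeafSpace.cast_add h1 h1')
  map_smul' c v := by
    induction q using Path.Homotopic.Quotient.ind with
    | mk γ =>
      obtain ⟨s, hs, h0, h1⟩ := hcov.exists_parallel γ v
      exact (hs.smul hcov c).transportFun_eq hcov (LeafSpace.cast_smul c h0)
        (LeafSpace.cast_smul c h1)
  invFun := hcov.transportFun q.symm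
  left_inv v := by
    rw [← hcov.transportFun_trans, quotient_trans_symm, hcov.transportFun_refl]
  right_inv v := by
    rw [← hcov.transportFun_trans, quotient_symm_trans, hcov.transportFun_refl]

theorem IsFlat.transport_trans (hcov : IsFlat cov) (q : Path.Homotopic.Quotient x y)
    (q' : Path.Homotopic.Quotient y z) (v : V x) :
    hcov.transport (q.trans q') v = hcov.transport q' (hcov.transport q v) :=
  hcov.transportFun_trans q q' v

theorem IsFlat.transport_symm (hcov : IsFlat cov) (q : Path.Homotopic.Quotient x y) :
    hcov.transport q.symm = (hcov.transport q).symm :=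
  LinearEquiv.ext fun _ => rfl

theorem IsParallelAlong.transport_eq (hcov : IsFlat cov) {γ : Path x y} {s : ∀ t, V (γ t)}
    (h : IsParallelAlong cov γ s) {v : V x} {w : V y}
    (h0 : (⟨γ 0, s 0⟩ : LeafSpace cov) = ⟨x, v⟩) (h1 : (⟨γ 1, s 1⟩ : LeafSpace cov) = ⟨y, w⟩) :
    hcov.transport (.mk γ) v = w :=
  h.transportFun_eq hcov h0 h1

/-- A horizontal section over `U` is preserved by parallel transport along paths in `U`. -/
theorem IsHorizontalOn.transport_eq (hcov : IsFlat cov) (hu : IsHorizontalOn cov u U)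
    (hU : IsOpen U) (γ : Path x y) (hγ : ∀ t, γ t ∈ U) :
    hcov.transport (.mk γ) (u x) = u y := by
  have hpar : IsParallelAlong cov γ (fun t => u (γ t)) :=
    hcov.isParallelAlong_iff.2 fun t => ⟨U, u, hU, hγ t, hu, Filter.Eventually.of_forall fun _ => rfl⟩
  refine hpar.transport_eq hcov ?_ ?_
  · rw [γ.source]
  · rw [γ.target]

theorem IsHorizontalLift.transport_eq (hcov : IsFlat cov) {γ : Path x y}
    {s : unitInterval → TotalSpace F V} (hs : IsHorizontalLift cov γ s) {v : V x} {w : V y}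
    (h0 : s 0 = TotalSpace.mk' F x v) (h1 : s 1 = TotalSpace.mk' F y w) :
    hcov.transport (.mk γ) v = w := by
  have key : ∀ t, ∃ w : V (γ t), s t = TotalSpace.mk' F (γ t) w := by
    intro t
    obtain ⟨U, u, -, -, -, h⟩ := hs t
    exact ⟨_, h.self_of_nhds⟩
  choose s' hs' using key
  have hpar : IsParallelAlong cov γ s' := by
    refine hcov.isParallelAlong_iff.2 fun t => ?_
    obtain ⟨U, u, hU, ht, hu, h⟩ := hs t
    refine ⟨U, u, hU, ht, hu, h.mono fun t' ht' => ?_⟩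
    rw [hs'] at ht'
    exact eq_of_heq (TotalSpace.mk.inj ht').2
  have conv : ∀ {a b : Y} {p : V a} {q : V b}, TotalSpace.mk' F a p = TotalSpace.mk' F b q →
      (⟨a, p⟩ : LeafSpace cov) = ⟨b, q⟩ := by
    intro a b p q h
    cases h
    rfl
  refine hpar.transport_eq hcov (conv ?_) (conv ?_)
  · rw [← hs', h0]
  · rw [← hs', h1]

theorem HasMonodromy.transport_eq (hcov : IsFlat cov) {n : ℕ} {b : Module.Basis (Fin n) ℂ (V x)}
    {r : FundamentalGroup Y x → GLn n ℂ} (h : HasMonodromy cov b r) (a : FundamentalGroup Y x)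
    (c : Fin n → ℂ) :
    hcov.transport a (b.equivFun.symm c) = b.equivFun.symm ((r a).val *ᵥ c) := by
  obtain ⟨γ, rfl⟩ := Path.Homotopic.Quotient.mk_surjective a
  obtain ⟨s, hs, h0, h1⟩ := h γ c
  exact hs.transport_eq hcov h0 h1

/-- A locally constant function on the leaf space is invariant under parallel transport. -/
theorem IsFlat.eq_of_isLocallyConstant (hcov : IsFlat cov) {α : Type*} {f : LeafSpace cov → α}
    (hf : IsLocallyConstant f) (q : Path.Homotopic.Quotient x y) (v : V x) :
    f ⟨y, hcov.transport q v⟩ = f ⟨x, v⟩ := by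
  obtain ⟨γ, rfl⟩ := Path.Homotopic.Quotient.mk_surjective q
  obtain ⟨s, hs, h0, h1⟩ := hcov.exists_parallel γ v
  have := (hf.comp_continuous hs).apply_eq_of_preconnectedSpace 1 0
  simp only [Function.comp_apply, h0, h1] at this
  exact this

/-- Every point of the leaf space has a neighbourhood that is the image of a horizontal section, so
local constancy can be tested on sections. -/
theorem IsFlat.isLocallyConstant_of_eventually {α : Type*} {f : LeafSpace cov → α}
    (hcov : IsFlat cov)
    (h : ∀ (U : Set Y) (u : ∀ y, V y), IsOpen U → IsHorizontalOn cov u U → ∀ y ∈ U,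
      ∀ᶠ z in 𝓝 y, f ⟨z, u z⟩ = f ⟨y, u y⟩) : IsLocallyConstant f := by
  rw [IsLocallyConstant.iff_eventually_eq]
  rintro ⟨y, v⟩
  obtain ⟨U, u, hU, hy, hu, rfl⟩ := hcov.exists_horizontal y v
  filter_upwards [(hu.isOpen_range hcov hU).mem_nhds ⟨hy, rfl⟩,
    LeafSpace.continuous_base.continuousAt.eventually (h U u hU hu y hy)] with a ha ha'
  rw [← ha']
  obtain ⟨z, w⟩ := a
  rw [show w = u z from ha.2]

end Transport

theorem isInternal_map {ι k V V' : Type*} [DecidableEq ι] [Field k] [AddCommGroup V]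
    [AddCommGroup V'] [Module k V] [Module k V'] {W : ι → Submodule k V}
    (hW : DirectSum.IsInternal W) (f : V ≃ₗ[k] V') :
    DirectSum.IsInternal (fun j => (W j).map (f : V →ₗ[k] V')) := by
  rw [DirectSum.isInternal_submodule_iff_iSupIndep_and_iSup_eq_top] at hW ⊢
  refine ⟨(iSupIndep_map_orderIso_iff (Submodule.orderIsoMapComap f)).2 hW.1, ?_⟩
  rw [← Submodule.map_iSup, hW.2, Submodule.map_top, LinearEquiv.range]

/-! ### Flat subbundles and subrepresentations of the monodromy -/

section Subbundle

variable {E : Type*} [NormedAddCommGroup E] [NormedSpace ℂ E]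
  {Y : Type*} [TopologicalSpace Y] [ChartedSpace E Y]
  {F : Type*} [NormedAddCommGroup F] [NormedSpace ℂ F]
  {V : Y → Type*} [TopologicalSpace (TotalSpace F V)]
  [∀ y, AddCommGroup (V y)] [∀ y, Module ℂ (V y)] [∀ y, TopologicalSpace (V y)]
  [∀ y, IsTopologicalAddGroup (V y)] [∀ y, ContinuousSMul ℂ (V y)]
  [FiberBundle F V] [VectorBundle ℂ F V] [FiniteDimensional ℂ F]
  [ContMDiffVectorBundle 1 F V 𝓘(ℂ, E)] [IsManifold 𝓘(ℂ, E) 1 Y]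
  {cov : CovariantDerivative 𝓘(ℂ, E) F V} {s u : ∀ y, V y} {U : Set Y} {x y z : Y}
  {W W' : ∀ y, Submodule ℂ (V y)}

/-- A family of subspaces of the fibres is parallel if it is preserved by parallel transport. -/
def IsFlat.IsParallel (hcov : IsFlat cov) (W : ∀ y, Submodule ℂ (V y)) : Prop :=
  ∀ ⦃x y : Y⦄ (q : Path.Homotopic.Quotient x y), ∀ v ∈ W x, hcov.transport q v ∈ W y

/-- Whether a horizontal section lies in a flat subbundle is locally constant. -/
theorem IsFlatSubbundle.eventually_mem_iff (hcov : IsFlat cov) (hW : IsFlatSubbundle cov W)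
    (hu : IsHorizontalOn cov u U) (hU : IsOpen U) (hy : y ∈ U) :
    ∀ᶠ z in 𝓝 y, (u z ∈ W z ↔ u y ∈ W y) := by
  obtain ⟨U₀, d, e, hy₀, h⟩ := hcov.exists_frame y
  obtain ⟨U₁, hU₁, hy₁, d₁, e₁, he₁, hspan⟩ := hW y
  obtain ⟨c, hc⟩ := h.eventually_eq_sum hy₀ hu hU hy
  choose C hC using fun j => h.eventually_eq_sum hy₀ (he₁ j) hU₁ hy₁
  -- In the coordinates of the frame, `W` is near `y` the fixed subspace spanned by the `C j`, and
  -- `u` is the fixed vector `c`.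
  have key : ∀ᶠ z in 𝓝 y, (u z ∈ W z ↔ c ∈ Submodule.span ℂ (Set.range C)) := by
    filter_upwards [hc, Filter.eventually_all.2 hC, h.isOpen.mem_nhds hy₀, hU₁.mem_nhds hy₁]
      with z hz hzC hz₀ hz₁
    have hz' : u z = (h.basis hz₀).equivFun.symm.toLinearMap c :=
      hz.trans (h.equivFun_symm_apply hz₀ c).symm
    have hr : (Set.range fun j => e₁ j z) =
        (h.basis hz₀).equivFun.symm.toLinearMap '' Set.range C := by
      rw [← Set.range_comp]
      congr 1
      funext j
      exact (hzC j).trans (h.equivFun_symm_apply hz₀ (C j)).symm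
    rw [← (hspan z hz₁).2, hr, ← Submodule.map_span, hz']
    refine Iff.trans (Submodule.mem_map_equiv _) ?_
    rw [LinearEquiv.coe_coe, LinearEquiv.symm_apply_apply]
  filter_upwards [key] with z hz
  rw [hz, key.self_of_nhds]

/-- Membership in `W` is a locally constant proposition-valued function on the leaf space, hence
constant along parallel families. -/
theorem IsFlatSubbundle.isParallel (hcov : IsFlat cov) (hW : IsFlatSubbundle cov W) :
    hcov.IsParallel W := by
  intro x y q v hv
  have hf : IsLocallyConstant fun a : LeafSpace cov => a.vec ∈ W a.base :=
    hcov.isLocallyConstant_of_eventually fun U u hU hu y hy =>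
      (hW.eventually_mem_iff hcov hu hU hy).mono fun z hz => propext hz
  exact (hcov.eq_of_isLocallyConstant hf q v).mpr hv

theorem IsFlat.IsParallel.transport_mem_iff {hcov : IsFlat cov} (hW : hcov.IsParallel W)
    (q : Path.Homotopic.Quotient x y) {v : V x} : hcov.transport q v ∈ W y ↔ v ∈ W x := by
  refine ⟨fun h => ?_, hW q v⟩
  have := hW q.symm _ h
  rwa [hcov.transport_symm, LinearEquiv.symm_apply_apply] at this

theorem IsFlat.IsParallel.map_eq {hcov : IsFlat cov} (hW : hcov.IsParallel W)
    (q : Path.Homotopic.Quotient x y) :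
    (W x).map (hcov.transport q : V x →ₗ[ℂ] V y) = W y := by
  ext v
  rw [Submodule.mem_map_equiv, ← hW.transport_mem_iff q, LinearEquiv.apply_symm_apply]

theorem exists_isPathConnected_subset [LocallyPathConnectedSpace Y] (hU : IsOpen U) (hy : y ∈ U) :
    ∃ B ⊆ U, IsOpen B ∧ y ∈ B ∧ ∀ z ∈ B, ∃ γ : Path y z, ∀ t, γ t ∈ B := by
  obtain ⟨B, ⟨hB, hyB, hpath⟩, hBU⟩ :=
    (isOpen_isPathConnected_basis y).mem_iff.1 (hU.mem_nhds hy)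
  refine ⟨B, hBU, hB, hyB, fun z hz => ?_⟩
  have := hpath.joinedIn y hyB z hz
  exact ⟨this.somePath, this.somePath_mem⟩

/-- Extend a basis of `W y` to horizontal sections over a neighbourhood whose points are joined to
`y` within it. There these sections agree with transport from `y`, which carries `W y` onto `W z`.
-/
theorem IsFlat.IsParallel.isFlatSubbundle [LocallyPathConnectedSpace Y] {hcov : IsFlat cov}
    (hW : hcov.IsParallel W) : IsFlatSubbundle cov W := by
  intro y
  obtain ⟨U, d, e, hy, h⟩ := hcov.exists_frame y
  obtain ⟨B, hBU, hB, hyB, hpath⟩ := exists_isPathConnected_subset h.isOpen hy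
  have : Module.Finite ℂ (V y) := Module.Finite.of_basis (h.basis hy)
  let b := Module.finBasis ℂ (W y)
  let c : Fin (Module.finrank ℂ (W y)) → ∀ z, V z := fun j =>
    ∑ i, (h.basis hy).equivFun (b j) i • e i
  have hc : ∀ j, IsHorizontalOn cov (c j) B := fun j => (h.sum _).mono hBU
  have hcy : ∀ j, c j y = b j := by
    intro j
    have hv := h.equivFun_symm_apply hy ((h.basis hy).equivFun (b j))
    rw [LinearEquiv.symm_apply_apply] at hv
    rw [hv]
    simp only [c]
    rw [Finset.sum_apply]
    rfl
  refine ⟨B, hB, hyB, _, c, hc, fun z hz => ?_⟩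
  obtain ⟨γ, hγ⟩ := hpath z hz
  have hcz : (fun j => c j z) = hcov.transport (.mk γ) ∘ (W y).subtype ∘ b := by
    funext j
    rw [← (hc j).transport_eq hcov hB γ hγ, hcy]
    rfl
  rw [hcz]
  constructor
  · exact (b.linearIndependent.map' (W y).subtype (Submodule.ker_subtype _)).map'
      (hcov.transport (.mk γ)).toLinearMap (LinearEquiv.ker _)
  · rw [Set.range_comp, Set.range_comp, ← hW.map_eq (.mk γ)]
    have h1 : Submodule.span ℂ ((W y).subtype '' Set.range b) = W y := by
      rw [← Submodule.map_span, b.span_eq, Submodule.map_subtype_top]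
    conv_rhs => rw [← h1]
    rw [Submodule.map_span]
    rfl

theorem IsFlat.isParallel_bot (hcov : IsFlat cov) : hcov.IsParallel (fun _ => ⊥) := by
  intro x y q v hv
  rw [Submodule.mem_bot] at hv ⊢
  rw [hv, map_zero]

theorem IsFlat.transport_mem_map {M : Type*} [AddCommGroup M] [Module ℂ M]
    {r : Representation ℂ (FundamentalGroup Y x) M} {b : M ≃ₗ[ℂ] V x} (hcov : IsFlat cov)
    (hb : ∀ a c, hcov.transport a (b c) = b (r a c)) (X : Subrepresentation r)
    (a : Path.Homotopic.Quotient x x) :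
    ∀ v ∈ X.toSubmodule.map (b : M →ₗ[ℂ] V x),
      hcov.transport a v ∈ X.toSubmodule.map (b : M →ₗ[ℂ] V x) := by
  rintro _ ⟨c, hc, rfl⟩
  exact ⟨r a c, X.apply_mem_toSubmodule a hc, (hb a c).symm⟩

variable [PathConnectedSpace Y]

theorem IsFlat.IsParallel.le_of_le {hcov : IsFlat cov} (hW : hcov.IsParallel W)
    (hW' : hcov.IsParallel W') (h : W x ≤ W' x) (y : Y) : W y ≤ W' y := by
  obtain ⟨γ⟩ := PathConnectedSpace.joined x y
  rw [← hW.map_eq (.mk γ), ← hW'.map_eq (.mk γ)]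
  exact Submodule.map_mono h

theorem IsFlat.IsParallel.eq_of_eq {hcov : IsFlat cov} (hW : hcov.IsParallel W)
    (hW' : hcov.IsParallel W') (h : W x = W' x) : W = W' :=
  funext fun y => le_antisymm (hW.le_of_le hW' h.le y) (hW'.le_of_le hW h.ge y)

theorem IsFlat.isInternal_of_isParallel (hcov : IsFlat cov) {m : ℕ}
    {W : Fin m → ∀ y, Submodule ℂ (V y)} (hW : ∀ j, hcov.IsParallel (W j))
    (h : DirectSum.IsInternal (fun j => W j x)) (y : Y) :
    DirectSum.IsInternal (fun j => W j y) := by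
  obtain ⟨γ⟩ := PathConnectedSpace.joined x y
  have := isInternal_map h (hcov.transport (.mk γ))
  simpa only [(hW _).map_eq] using this

/-- The extension of a subspace of a fibre by parallel transport along chosen paths. -/
noncomputable def IsFlat.extend (hcov : IsFlat cov) (x : Y) (M : Submodule ℂ (V x)) (y : Y) :
    Submodule ℂ (V y) :=
  M.map (hcov.transport (.mk (PathConnectedSpace.somePath x y)) : V x →ₗ[ℂ] V y)

variable {M : Submodule ℂ (V x)}

theorem IsFlat.isParallel_extend (hcov : IsFlat cov)
    (hM : ∀ a : Path.Homotopic.Quotient x x, ∀ v ∈ M, hcov.transport a v ∈ M) :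
    hcov.IsParallel (hcov.extend x M) := by
  rintro y z q _ ⟨v, hv, rfl⟩
  rw [extend, Submodule.mem_map_equiv, ← hcov.transport_symm]
  -- The path `q`, closed up by the two chosen paths, is a loop at `x`, and loops preserve `M`.
  have := hM ((Path.Homotopic.Quotient.mk (PathConnectedSpace.somePath x y)).trans
    (q.trans (Path.Homotopic.Quotient.mk (PathConnectedSpace.somePath x z)).symm)) v hv
  rwa [hcov.transport_trans, hcov.transport_trans] at this

theorem IsFlat.extend_self (hcov : IsFlat cov)
    (hM : ∀ a : Path.Homotopic.Quotient x x, ∀ v ∈ M, hcov.transport a v ∈ M) :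
    hcov.extend x M x = M := by
  apply le_antisymm
  · rintro _ ⟨v, hv, rfl⟩
    exact hM _ v hv
  · intro v hv
    rw [extend, Submodule.mem_map_equiv, ← hcov.transport_symm]
    exact hM _ v hv

variable {M : Type*} [AddCommGroup M] [Module ℂ M]
  {r : Representation ℂ (FundamentalGroup Y x) M} {b : M ≃ₗ[ℂ] V x}

/-- The flat subbundle attached to a subrepresentation of the monodromy representation. -/
noncomputable def IsFlat.subbundle (hcov : IsFlat cov) (b : M ≃ₗ[ℂ] V x) (X : Subrepresentation r) :
    ∀ y, Submodule ℂ (V y) :=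
  hcov.extend x (X.toSubmodule.map (b : M →ₗ[ℂ] V x))

theorem IsFlat.isParallel_subbundle (hcov : IsFlat cov)
    (hb : ∀ a c, hcov.transport a (b c) = b (r a c)) (X : Subrepresentation r) :
    hcov.IsParallel (hcov.subbundle b X) :=
  hcov.isParallel_extend (hcov.transport_mem_map hb X)

theorem IsFlat.subbundle_self (hcov : IsFlat cov)
    (hb : ∀ a c, hcov.transport a (b c) = b (r a c)) (X : Subrepresentation r) :
    hcov.subbundle b X x = X.toSubmodule.map (b : M →ₗ[ℂ] V x) :=
  hcov.extend_self (hcov.transport_mem_map hb X)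

theorem IsFlat.mem_subbundle_self (hcov : IsFlat cov)
    (hb : ∀ a c, hcov.transport a (b c) = b (r a c)) (X : Subrepresentation r) {c : M} :
    b c ∈ hcov.subbundle b X x ↔ c ∈ X := by
  rw [hcov.subbundle_self hb, Submodule.mem_map_equiv, LinearEquiv.symm_apply_apply]
  rfl

/-- A flat subbundle is determined by its fibre at `x`, which is a subrepresentation of the
monodromy. -/
theorem IsFlat.isIrreducibleFlat_subbundle (hcov : IsFlat cov)
    (hb : ∀ a c, hcov.transport a (b c) = b (r a c)) {X : Subrepresentation r}
    (hX : X.toRepresentation.IsIrreducible) :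
    IsIrreducibleFlat cov (hcov.subbundle b X) := by
  have hpar := hcov.isParallel_subbundle hb X
  refine ⟨fun h => ne_bot_of_isIrreducible hX ?_, fun W' hW' hle => ?_⟩
  · rw [eq_bot_iff]
    intro c hc
    rw [← hcov.mem_subbundle_self hb, h, Submodule.mem_bot, LinearEquiv.map_eq_zero_iff] at hc
    rw [hc]
    exact Submodule.zero_mem _
  · have hpar' := hW'.isParallel hcov
    let X' : Subrepresentation r := ⟨(W' x).comap (b : M →ₗ[ℂ] V x), fun a c hc => by
      rw [Submodule.mem_comap, LinearEquiv.coe_coe] at hc ⊢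
      rw [← hb]
      exact hpar' _ _ hc⟩
    have hX'mem : ∀ c, c ∈ X' ↔ b c ∈ W' x := fun c => Iff.rfl
    have hX' : X' ≤ X := fun c hc => by
      rw [← hcov.mem_subbundle_self hb]
      exact hle x hc
    rcases eq_bot_or_eq_of_le hX hX' with h | h
    · left
      refine hpar'.eq_of_eq hcov.isParallel_bot (x := x) ?_
      rw [eq_bot_iff]
      intro v hv
      obtain ⟨c, rfl⟩ := b.surjective v
      rw [← hX'mem, h] at hv
      rw [Submodule.mem_bot, LinearEquiv.map_eq_zero_iff]
      exact hv
    · right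
      refine hpar'.eq_of_eq hpar (x := x) ?_
      ext v
      obtain ⟨c, rfl⟩ := b.surjective v
      rw [← hX'mem, h, hcov.mem_subbundle_self hb]

/-- An isomorphism of flat subbundles carries parallel families in the first to parallel families in
the second, so on the fibre at `x` it commutes with the monodromy. -/
theorem IsFlat.nonempty_equiv_of_flatIsomorphic (hcov : IsFlat cov)
    (hb : ∀ a c, hcov.transport a (b c) = b (r a c)) {X X' : Subrepresentation r}
    (hW : IsFlatSubbundle cov (hcov.subbundle b X))
    (h : FlatIsomorphic cov (hcov.subbundle b X) (hcov.subbundle b X')) :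
    Nonempty (X.toRepresentation.Equiv X'.toRepresentation) := by
  obtain ⟨φ, hφ, hhor⟩ := h
  have hcomm : ∀ (a : Path.Homotopic.Quotient x x), ∀ v ∈ hcov.subbundle b X x,
      φ x (hcov.transport a v) = hcov.transport a (φ x v) := by
    intro a v hv
    obtain ⟨γ, rfl⟩ := Path.Homotopic.Quotient.mk_surjective a
    obtain ⟨s, hs, h0, h1⟩ := hcov.exists_parallel γ v
    have hmem : ∀ t, s t ∈ hcov.subbundle b X (γ t) := by
      let f : LeafSpace cov → Prop := fun a => a.vec ∈ hcov.subbundle b X a.base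
      have hf : IsLocallyConstant f :=
        hcov.isLocallyConstant_of_eventually fun U u hU hu y hy =>
          (hW.eventually_mem_iff hcov hu hU hy).mono fun z hz => propext hz
      intro t
      have ht := (hf.comp_continuous hs).apply_eq_of_preconnectedSpace t 0
      exact (ht.trans (congrArg f h0)).mpr hv
    have hφs : IsParallelAlong cov γ (fun t => φ (γ t) (s t)) := by
      refine hcov.isParallelAlong_iff.2 fun t => ?_
      obtain ⟨U, u, hU, ht, hu, hsu⟩ := hcov.isParallelAlong_iff.1 hs t
      -- The map `φ` is only known to respect horizontal sections lying in the subbundle; on `O` the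
      -- section `u` stays there.
      obtain ⟨O, hO, hO', htO⟩ := eventually_nhds_iff.1 (hW.eventually_mem_iff hcov hu hU ht)
      have hut : u (γ t) ∈ hcov.subbundle b X (γ t) := by
        rw [← hsu.self_of_nhds]
        exact hmem t
      refine ⟨U ∩ O, fun y => φ y (u y), hU.inter hO', ⟨ht, htO⟩,
        hhor _ u (hU.inter hO') (fun y hy => (hO y hy.2).2 hut) (hu.mono Set.inter_subset_left), ?_⟩
      exact hsu.mono fun t' ht' => by rw [ht']
    have conv : ∀ {y z : Y} {v : V y} {w : V z}, (⟨y, v⟩ : LeafSpace cov) = ⟨z, w⟩ →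
        (⟨y, φ y v⟩ : LeafSpace cov) = ⟨z, φ z w⟩ := by
      intro y z v w h
      cases h
      rfl
    exact (hφs.transport_eq hcov (conv h0) (conv h1)).symm
  let ψ : M →ₗ[ℂ] M := (b.symm : V x →ₗ[ℂ] M) ∘ₗ φ x ∘ₗ (b : M →ₗ[ℂ] V x)
  have hψ : ∀ c, b (ψ c) = φ x (b c) := fun c => b.apply_symm_apply _
  have hmaps : ∀ c ∈ X.toSubmodule, ψ c ∈ X'.toSubmodule := by
    intro c hc
    apply (hcov.mem_subbundle_self hb X').1
    rw [hψ]
    exact (hφ x).mapsTo ((hcov.mem_subbundle_self hb X).2 hc)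
  let Ψ : X.toSubmodule →ₗ[ℂ] X'.toSubmodule := ψ.restrict hmaps
  have hbij : Function.Bijective Ψ := by
    constructor
    · rintro ⟨c, hc⟩ ⟨c', hc'⟩ h
      have h' : ψ c = ψ c' := congrArg Subtype.val h
      apply Subtype.ext
      apply b.injective
      refine (hφ x).injOn ((hcov.mem_subbundle_self hb X).2 hc)
        ((hcov.mem_subbundle_self hb X).2 hc') ?_
      rw [← hψ, ← hψ, h']
    · rintro ⟨c, hc⟩
      obtain ⟨v, hv, hvc⟩ := (hφ x).surjOn ((hcov.mem_subbundle_self hb X').2 hc)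
      obtain ⟨c', rfl⟩ := b.surjective v
      refine ⟨⟨c', (hcov.mem_subbundle_self hb X).1 hv⟩, ?_⟩
      apply Subtype.ext
      apply b.injective
      exact (hψ c').trans hvc
  refine ⟨Representation.Equiv.mk (LinearEquiv.ofBijective Ψ hbij) fun a => ?_⟩
  ext c
  apply b.injective
  change b (ψ (r a c)) = b (r a (ψ c))
  rw [hψ, ← hb, ← hb, hψ]
  exact hcomm a _ ((hcov.mem_subbundle_self hb X).2 c.2)

end Subbundle

/-! ### Functoriality of homotopy classes of paths -/

section Quotient

variable {X Y : Type*} [TopologicalSpace X] [TopologicalSpace Y]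

theorem quotient_assoc {a b c d : X} (p : Path.Homotopic.Quotient a b)
    (q : Path.Homotopic.Quotient b c) (r : Path.Homotopic.Quotient c d) :
    (p.trans q).trans r = p.trans (q.trans r) := by
  obtain ⟨p, rfl⟩ := Path.Homotopic.Quotient.mk_surjective p
  obtain ⟨q, rfl⟩ := Path.Homotopic.Quotient.mk_surjective q
  obtain ⟨r, rfl⟩ := Path.Homotopic.Quotient.mk_surjective r
  simp only [← Path.Homotopic.Quotient.mk_trans]
  exact Path.Homotopic.Quotient.eq.2 ⟨Path.Homotopy.transAssoc p q r⟩

theorem quotient_map_trans {a b c : X} (p : Path.Homotopic.Quotient a b)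
    (q : Path.Homotopic.Quotient b c) (f : C(X, Y)) :
    (p.trans q).map f = (p.map f).trans (q.map f) := by
  obtain ⟨p, rfl⟩ := Path.Homotopic.Quotient.mk_surjective p
  obtain ⟨q, rfl⟩ := Path.Homotopic.Quotient.mk_surjective q
  simp only [← Path.Homotopic.Quotient.mk_trans, ← Path.Homotopic.Quotient.mk_map]
  rw [Path.map_trans]

theorem quotient_map_symm {a b : X} (p : Path.Homotopic.Quotient a b) (f : C(X, Y)) :
    p.symm.map f = (p.map f).symm := by
  obtain ⟨p, rfl⟩ := Path.Homotopic.Quotient.mk_surjective p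
  simp only [← Path.Homotopic.Quotient.mk_symm, ← Path.Homotopic.Quotient.mk_map]
  rw [Path.map_symm]

theorem quotient_cast_trans {a b c a' b' c' : X} (p : Path.Homotopic.Quotient a b)
    (q : Path.Homotopic.Quotient b c) (ha : a' = a) (hb : b' = b) (hc : c' = c) :
    (p.trans q).cast ha hc = (p.cast ha hb).trans (q.cast hb hc) := by
  subst ha hb hc
  simp only [Path.Homotopic.Quotient.cast_rfl_rfl]

/-- Maps which agree pointwise agree on homotopy classes of paths, up to a cast. -/
theorem quotient_map_eq_cast {a b : X} (p : Path.Homotopic.Quotient a b) {f g : C(X, Y)}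
    (h : ∀ t, f t = g t) : p.map f = (p.map g).cast (h a) (h b) := by
  obtain rfl : f = g := ContinuousMap.ext h
  rw [Path.Homotopic.Quotient.cast_rfl_rfl]

theorem quotient_map_comp {Z : Type*} [TopologicalSpace Z] {a b : X}
    (p : Path.Homotopic.Quotient a b) (f : C(X, Y)) (g : C(Y, Z)) :
    (p.map f).map g = p.map (g.comp f) := by
  obtain ⟨p, rfl⟩ := Path.Homotopic.Quotient.mk_surjective p
  rfl

theorem quotient_map_map {a b : X} (p : Path.Homotopic.Quotient a b) {f : C(X, X)}
    (h : ∀ t, f (f t) = t) : (p.map f).map f = p.cast (h a) (h b) := by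
  rw [quotient_map_comp, quotient_map_eq_cast (g := ContinuousMap.id X) p h]
  obtain ⟨p, rfl⟩ := Path.Homotopic.Quotient.mk_surjective p
  rfl

end Quotient

/-! ### Loops in the base of a double covering -/

section DoubleCover

variable {X Y : Type*} [TopologicalSpace X] [TopologicalSpace Y] {p : C(Y, X)} {τ : C(Y, Y)}

theorem IsDoubleCover.apply_eq (h : IsDoubleCover p τ) (y : Y) : p (τ y) = p y :=
  ((h.fibre y (τ y)).2 (Or.inr rfl)).symm

theorem IsDoubleCover.involutive (h : IsDoubleCover p τ) (y : Y) : τ (τ y) = y := by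
  rcases (h.fibre (τ y) y).1 (h.apply_eq y) with h' | h'
  · exact absurd h'.symm (h.free y)
  · exact h'.symm

variable {y₀ : Y}

/-- The loop in the base of a double covering which is the image of a path from a point to its image
under the covering transformation. -/
def IsDoubleCover.loop (h : IsDoubleCover p τ) (δ : Path.Homotopic.Quotient y₀ (τ y₀)) :
    FundamentalGroup X (p y₀) :=
  (δ.map p).cast rfl (h.apply_eq y₀).symm

/-- The lift of this loop from `y₀` ends at `τ y₀ ≠ y₀`, whereas the image of a loop lifts to a
loop. -/
theorem IsDoubleCover.loop_notMem_range (h : IsDoubleCover p τ)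
    (δ : Path.Homotopic.Quotient y₀ (τ y₀)) :
    h.loop δ ∉ (FundamentalGroup.map p y₀).range := by
  rintro ⟨a, ha⟩
  have h1 := h.covering.monodromy_eq_of_map_eq (γ := h.loop δ) (ex := ⟨y₀, rfl⟩)
    (ey := ⟨τ y₀, h.apply_eq y₀⟩) δ (by
      refine Eq.trans ?_ (Path.Homotopic.Quotient.cast_cast (δ.map p) _ _ _ _).symm
      rw [Path.Homotopic.Quotient.cast_rfl_rfl]
      rfl)
  have h2 := h.covering.monodromy_eq_of_map_eq (γ := h.loop δ) (ex := ⟨y₀, rfl⟩)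
    (ey := ⟨y₀, rfl⟩) a (by
      rw [Path.Homotopic.Quotient.cast_rfl_rfl]
      exact ha)
  exact h.free y₀ (congrArg Subtype.val (h1.symm.trans h2))

/-- The action of the loop attached to `δ` on the fundamental group of the double covering. -/
noncomputable def twistLoop (δ : Path.Homotopic.Quotient y₀ (τ y₀)) (a : FundamentalGroup Y y₀) :
    FundamentalGroup Y y₀ :=
  (δ.trans (Path.Homotopic.Quotient.map a τ)).trans δ.symm

/-- The square of the loop attached to `δ`. -/
noncomputable def IsDoubleCover.squareLoop (h : IsDoubleCover p τ) (δ : Path.Homotopic.Quotient y₀ (τ y₀)) :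
    Path.Homotopic.Quotient y₀ y₀ :=
  (δ.trans (δ.map τ)).cast rfl (h.involutive y₀).symm

theorem IsDoubleCover.map_twistLoop (h : IsDoubleCover p τ)
    (δ : Path.Homotopic.Quotient y₀ (τ y₀)) (a : FundamentalGroup Y y₀) :
    FundamentalGroup.map p y₀ (twistLoop δ a) =
      (h.loop δ)⁻¹ * (FundamentalGroup.map p y₀ a * h.loop δ) := by
  -- The product in the fundamental group is concatenation in the opposite order.
  change Path.Homotopic.Quotient.map ((δ.trans (Path.Homotopic.Quotient.map a τ)).trans δ.symm) p =
    ((h.loop δ).trans (Path.Homotopic.Quotient.map a p)).trans (h.loop δ).symm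
  rw [quotient_map_trans, quotient_map_trans, quotient_map_symm, quotient_map_comp,
    quotient_map_eq_cast (f := p.comp τ) (g := p) a h.apply_eq, loop]
  have key : ∀ {c d e : X} (q : Path.Homotopic.Quotient c d) (s : Path.Homotopic.Quotient e e)
      (h : d = e), (q.trans (s.cast h h)).trans q.symm =
        ((q.cast rfl h.symm).trans s).trans (q.cast rfl h.symm).symm := by
    intro c d e q s h
    subst h
    simp only [Path.Homotopic.Quotient.cast_rfl_rfl]
  exact key _ _ _

theorem IsDoubleCover.map_squareLoop (h : IsDoubleCover p τ)
    (δ : Path.Homotopic.Quotient y₀ (τ y₀)) :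
    FundamentalGroup.map p y₀ (h.squareLoop δ) = h.loop δ * h.loop δ := by
  change Path.Homotopic.Quotient.map ((δ.trans (δ.map τ)).cast rfl (h.involutive y₀).symm) p =
    (h.loop δ).trans (h.loop δ)
  rw [Path.Homotopic.Quotient.map_cast, quotient_map_trans, quotient_map_comp,
    quotient_map_eq_cast (f := p.comp τ) (g := p) δ h.apply_eq, loop]
  have key : ∀ {c d e : X} (q : Path.Homotopic.Quotient c d) (h : d = c) (h' : e = d)
      (h'' : c = e), (q.trans (q.cast h h')).cast rfl h'' =
        (q.cast rfl h.symm).trans (q.cast rfl h.symm) := by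
    intro c d e q h h' h''
    subst h h'
    simp only [Path.Homotopic.Quotient.cast_rfl_rfl]
  exact key _ _ _ _

end DoubleCover

/-! ### Invariant pairings and twisted forms on a fibre -/

section Pairing

variable {E : Type*} [NormedAddCommGroup E] [NormedSpace ℂ E]
  {Y : Type*} [TopologicalSpace Y] [ChartedSpace E Y]
  {F : Type*} [NormedAddCommGroup F] [NormedSpace ℂ F]
  {V : Y → Type*} [TopologicalSpace (TotalSpace F V)]
  [∀ y, AddCommGroup (V y)] [∀ y, Module ℂ (V y)] [∀ y, TopologicalSpace (V y)]
  [∀ y, IsTopologicalAddGroup (V y)] [∀ y, ContinuousSMul ℂ (V y)]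
  [FiberBundle F V]
  {cov : CovariantDerivative 𝓘(ℂ, E) F V} {y₀ y z : Y} {τ : C(Y, Y)} {ε : ℂ}

/-- If an invariant pairing is orthogonal for a direct sum decomposition into parallel subbundles, it
restricts to invariant pairings on the summands. -/
theorem IsInvariantPairing.of_isInternal {Φ : ∀ y z, V y →ₗ[ℂ] V z →ₗ[ℂ] ℂ}
    (hΦ : IsInvariantPairing cov τ ε (fun _ => ⊤) Φ) {m : ℕ} {W : Fin m → ∀ y, Submodule ℂ (V y)}
    (hW : ∀ y, DirectSum.IsInternal (fun j => W j y))
    (hort : ∀ i j, i ≠ j → ∀ y, ∀ v ∈ W i y, ∀ w ∈ W j (τ y), Φ y (τ y) v w = 0) (j : Fin m) :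
    IsInvariantPairing cov τ ε (W j) Φ where
  horizontal U U' s t hU hU' hUU' hs ht _ _ :=
    hΦ.horizontal U U' s t hU hU' hUU' hs ht (fun _ _ => Submodule.mem_top)
      fun _ _ => Submodule.mem_top
  left_nondegenerate y v hv h := by
    apply hΦ.left_nondegenerate y v Submodule.mem_top
    have : Φ y (τ y) v = 0 := linearMap_ext_of_isInternal (hW (τ y)) fun i w hw => by
      rcases eq_or_ne i j with rfl | hij
      · exact h w hw
      · exact hort j i hij.symm y v hv w hw
    intro w _
    rw [this, LinearMap.zero_apply]
  right_nondegenerate y w hw h := by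
    apply hΦ.right_nondegenerate y w Submodule.mem_top
    have : (Φ y (τ y)).flip w = 0 := linearMap_ext_of_isInternal (hW y) fun i v hv => by
      rcases eq_or_ne i j with rfl | hij
      · exact h v hv
      · exact hort i j hij y v hv w hw
    intro v _
    exact LinearMap.congr_fun this v
  cocycle y z hz v _ w _ := hΦ.cocycle y z hz v Submodule.mem_top w Submodule.mem_top

variable [VectorBundle ℂ F V] [FiniteDimensional ℂ F]
  [ContMDiffVectorBundle 1 F V 𝓘(ℂ, E)] [IsManifold 𝓘(ℂ, E) 1 Y]

/-- An invariant pairing is preserved by parallel transport along a path and its image under the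
involution. -/
theorem IsInvariantPairing.transport_eq (hcov : IsFlat cov)
    {Φ : ∀ y z, V y →ₗ[ℂ] V z →ₗ[ℂ] ℂ} (hΦ : IsInvariantPairing cov τ ε (fun _ => ⊤) Φ)
    (q : Path.Homotopic.Quotient y z) (v : V y) (w : V (τ y)) :
    Φ z (τ z) (hcov.transport q v) (hcov.transport (q.map τ) w) = Φ y (τ y) v w := by
  obtain ⟨γ, rfl⟩ := Path.Homotopic.Quotient.mk_surjective q
  rw [← Path.Homotopic.Quotient.mk_map]
  obtain ⟨s, hs, hs0, hs1⟩ := hcov.exists_parallel γ v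
  obtain ⟨t, ht, ht0, ht1⟩ := hcov.exists_parallel (γ.map τ.continuous) w
  let f : unitInterval → ℂ := fun a => Φ (γ a) (τ (γ a)) (s a) (t a)
  have hf : IsLocallyConstant f := by
    rw [IsLocallyConstant.iff_eventually_eq]
    intro a
    obtain ⟨U, u, hU, haU, hu, hsu⟩ := hcov.isParallelAlong_iff.1 hs a
    obtain ⟨U', u', hU', haU', hu', htu⟩ := hcov.isParallelAlong_iff.1 ht a
    have hO := hU.inter (hU'.preimage τ.continuous)
    have := hΦ.horizontal (U ∩ τ ⁻¹' U') U' u u' hO hU' (fun y hy => hy.2)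
      (hu.mono Set.inter_subset_left) hu' (fun _ _ => Submodule.mem_top)
      (fun _ _ => Submodule.mem_top) (γ a) ⟨haU, haU'⟩
    filter_upwards [hsu, htu, γ.continuous.continuousAt.eventually this] with c hc hc' h
    have hfc : f c = Φ (γ c) (τ (γ c)) (u (γ c)) (u' (τ (γ c))) := by
      simp only [f, hc, hc']
      rfl
    have hfa : f a = Φ (γ a) (τ (γ a)) (u (γ a)) (u' (τ (γ a))) := by
      simp only [f, hsu.self_of_nhds, htu.self_of_nhds]
      rfl
    rw [hfc, hfa, h]
  have conv : ∀ {a b : Y} {v : V a} {w : V (τ a)} {v' : V b} {w' : V (τ b)},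
      (⟨a, v⟩ : LeafSpace cov) = ⟨b, v'⟩ → (⟨τ a, w⟩ : LeafSpace cov) = ⟨τ b, w'⟩ →
        Φ a (τ a) v w = Φ b (τ b) v' w' := by
    intro a b v w v' w' h h'
    cases h
    rw [LeafSpace.mk_injective h']
  exact (conv hs1 ht1).symm.trans ((hf.apply_eq_of_preconnectedSpace 1 0).trans (conv hs0 ht0))

variable [PathConnectedSpace Y]

open Classical in
/-- The pairing obtained from a bilinear form on a fibre by parallel transport. -/
noncomputable def IsFlat.pairing (hcov : IsFlat cov) (δ : Path.Homotopic.Quotient y₀ (τ y₀))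
    (K : V y₀ →ₗ[ℂ] V y₀ →ₗ[ℂ] ℂ) (y z : Y) : V y →ₗ[ℂ] V z →ₗ[ℂ] ℂ :=
  K.compl₁₂
    ((hcov.transport (.mk (PathConnectedSpace.somePath y₀ y))).symm : V y →ₗ[ℂ] V y₀)
    ((hcov.transport (if h : z = τ y then
      (δ.trans ((Path.Homotopic.Quotient.mk (PathConnectedSpace.somePath y₀ y)).map τ)).cast rfl h
      else .mk (PathConnectedSpace.somePath y₀ z))).symm : V z →ₗ[ℂ] V y₀)

variable {δ : Path.Homotopic.Quotient y₀ (τ y₀)} {K : V y₀ →ₗ[ℂ] V y₀ →ₗ[ℂ] ℂ}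

/-- Independence of the chosen path: replacing it by `q` inserts a loop `a` in the first argument
and the twisted loop in the second, and `K` is invariant under that. -/
theorem IsFlat.pairing_transport (hcov : IsFlat cov)
    (hK : ∀ (a : Path.Homotopic.Quotient y₀ y₀) v w,
      K (hcov.transport a v) (hcov.transport ((δ.trans (a.map τ)).trans δ.symm) w) = K v w)
    (q : Path.Homotopic.Quotient y₀ y) (h : z = τ y) (v w : V y₀) :
    hcov.pairing δ K y z (hcov.transport q v)
      (hcov.transport ((δ.trans (q.map τ)).cast rfl h) w) = K v w := by
  subst h
  rw [pairing, dif_pos rfl, LinearMap.compl₁₂_apply, LinearEquiv.coe_coe, LinearEquiv.coe_coe]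
  set g : Path.Homotopic.Quotient y₀ y := .mk (PathConnectedSpace.somePath y₀ y)
  simp only [Path.Homotopic.Quotient.cast_rfl_rfl]
  have h1 : (hcov.transport g).symm (hcov.transport q v) = hcov.transport (q.trans g.symm) v := by
    rw [hcov.transport_trans, hcov.transport_symm]
  have h2 : (hcov.transport (δ.trans (g.map τ))).symm (hcov.transport (δ.trans (q.map τ)) w) =
      hcov.transport ((δ.trans ((q.trans g.symm).map τ)).trans δ.symm) w := by
    rw [LinearEquiv.symm_apply_eq, quotient_map_trans, quotient_map_symm]
    simp only [hcov.transport_trans, hcov.transport_symm, LinearEquiv.apply_symm_apply]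
  rw [h1, h2, hK]

theorem IsFlat.pairing_transport_apply (hcov : IsFlat cov)
    (hK : ∀ (a : Path.Homotopic.Quotient y₀ y₀) v w,
      K (hcov.transport a v) (hcov.transport ((δ.trans (a.map τ)).trans δ.symm) w) = K v w)
    (q : Path.Homotopic.Quotient y₀ y) (v w : V y₀) :
    hcov.pairing δ K y (τ y) (hcov.transport q v) (hcov.transport (δ.trans (q.map τ)) w) =
      K v w := by
  have := hcov.pairing_transport hK q rfl v w
  rwa [Path.Homotopic.Quotient.cast_rfl_rfl] at this

theorem IsFlat.pairing_transport_map (hcov : IsFlat cov)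
    (hK : ∀ (a : Path.Homotopic.Quotient y₀ y₀) v w,
      K (hcov.transport a v) (hcov.transport ((δ.trans (a.map τ)).trans δ.symm) w) = K v w)
    (q : Path.Homotopic.Quotient y z) (v : V y) (w : V (τ y)) :
    hcov.pairing δ K z (τ z) (hcov.transport q v) (hcov.transport (q.map τ) w) =
      hcov.pairing δ K y (τ y) v w := by
  obtain ⟨γ⟩ := PathConnectedSpace.joined y₀ y
  obtain ⟨v, rfl⟩ := (hcov.transport (.mk γ)).surjective v
  obtain ⟨w, rfl⟩ :=
    (hcov.transport (δ.trans ((Path.Homotopic.Quotient.mk γ).map τ))).surjective w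
  rw [hcov.pairing_transport_apply hK, ← hcov.transport_trans, ← hcov.transport_trans,
    quotient_assoc, ← quotient_map_trans, hcov.pairing_transport_apply hK]

theorem IsFlat.isInvariantPairing_pairing [LocallyPathConnectedSpace Y] {X : Type*}
    [TopologicalSpace X] {p : C(Y, X)} (hcov : IsFlat cov) (hτ : IsDoubleCover p τ)
    (hK : ∀ (a : Path.Homotopic.Quotient y₀ y₀) v w,
      K (hcov.transport a v) (hcov.transport ((δ.trans (a.map τ)).trans δ.symm) w) = K v w)
    (hflip : ∀ v w, K (hcov.transport (hτ.squareLoop δ) w) v = ε * K v w)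
    (hleft : ∀ v, (∀ w, K v w = 0) → v = 0) (hright : ∀ w, (∀ v, K v w = 0) → w = 0) :
    IsInvariantPairing cov τ ε (fun _ => ⊤) (hcov.pairing δ K) where
  horizontal U U' s t hU hU' hUU' hs ht _ _ y hy := by
    obtain ⟨B, hBU, hB, hyB, hpath⟩ := exists_isPathConnected_subset hU hy
    filter_upwards [hB.mem_nhds hyB] with z hz
    obtain ⟨γ, hγ⟩ := hpath z hz
    rw [← hs.transport_eq hcov hU γ fun a => hBU (hγ a),
      ← ht.transport_eq hcov hU' (γ.map τ.continuous) fun a => hUU' _ (hBU (hγ a)),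
      Path.Homotopic.Quotient.mk_map, hcov.pairing_transport_map hK]
  left_nondegenerate y v _ h := by
    obtain ⟨γ⟩ := PathConnectedSpace.joined y₀ y
    obtain ⟨v, rfl⟩ := (hcov.transport (.mk γ)).surjective v
    rw [hleft v, map_zero]
    intro w
    rw [← hcov.pairing_transport_apply hK (.mk γ)]
    exact h _ Submodule.mem_top
  right_nondegenerate y w _ h := by
    obtain ⟨γ⟩ := PathConnectedSpace.joined y₀ y
    obtain ⟨w, rfl⟩ :=
      (hcov.transport (δ.trans ((Path.Homotopic.Quotient.mk γ).map τ))).surjective w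
    rw [hright w, map_zero]
    intro v
    rw [← hcov.pairing_transport_apply hK (.mk γ)]
    exact h _ Submodule.mem_top
  cocycle y z hz v _ w _ := by
    subst hz
    obtain ⟨γ⟩ := PathConnectedSpace.joined y₀ y
    let q : Path.Homotopic.Quotient y₀ y := .mk γ
    obtain ⟨v, rfl⟩ := (hcov.transport q).surjective v
    obtain ⟨w, rfl⟩ := (hcov.transport (δ.trans (q.map τ))).surjective w
    obtain ⟨v, rfl⟩ := (hcov.transport (hτ.squareLoop δ)).surjective v
    -- If `τ y` is reached along `δ · τq`, the companion path to `τ(τ y) = y` is `δ · τδ · q`, the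
    -- square loop followed by `q`. So exchanging the arguments of the pairing amounts to the flip
    -- rule for `K`.
    have hq : (δ.trans ((δ.trans (q.map τ)).map τ)).cast rfl (hτ.involutive y).symm =
        Path.Homotopic.Quotient.trans (hτ.squareLoop δ) q := by
      rw [quotient_map_trans, ← quotient_assoc,
        quotient_cast_trans _ _ rfl (hτ.involutive y₀).symm (hτ.involutive y).symm,
        quotient_map_map q hτ.involutive, Path.Homotopic.Quotient.cast_cast,
        Path.Homotopic.Quotient.cast_rfl_rfl]
      rfl
    have h := hcov.pairing_transport hK (δ.trans (q.map τ)) (hτ.involutive y).symm w v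
    rw [hq, hcov.transport_trans (hτ.squareLoop δ)] at h
    rw [hcov.pairing_transport_apply hK, h, hflip]

end Pairing

/-! ### Decomposition of the flat bundle and of its `Γ`-structures -/

section FlatDecomposition

variable {E : Type*} [NormedAddCommGroup E] [NormedSpace ℂ E]
  {Y : Type*} [TopologicalSpace Y] [ChartedSpace E Y]
  {X : Type*} [TopologicalSpace X]
  {F : Type*} [NormedAddCommGroup F] [NormedSpace ℂ F]
  {V : Y → Type*} [TopologicalSpace (TotalSpace F V)]
  [∀ y, AddCommGroup (V y)] [∀ y, Module ℂ (V y)] [∀ y, TopologicalSpace (V y)]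
  [∀ y, IsTopologicalAddGroup (V y)] [∀ y, ContinuousSMul ℂ (V y)]
  [FiberBundle F V] [VectorBundle ℂ F V] [FiniteDimensional ℂ F]
  [ContMDiffVectorBundle 1 F V 𝓘(ℂ, E)] [IsManifold 𝓘(ℂ, E) 1 Y]
  [PathConnectedSpace Y] [LocallyPathConnectedSpace Y]
  {p : C(Y, X)} {τ : C(Y, Y)} {cov : CovariantDerivative 𝓘(ℂ, E) F V} {y₀ : Y}

/-- The form `B` yields one `Γ`-structure by parallel transport. Conversely, any `Γ`-structure
restricts over the base point to a form with the same twisted invariance, which vanishes between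
non-isomorphic summands; parallel transport spreads this orthogonality to every fibre. -/
theorem TwistedForm.exists_flat_decomposition {M : Type*} [AddCommGroup M] [Module ℂ M]
    [FiniteDimensional ℂ M] {r : Representation ℂ (FundamentalGroup Y y₀) M} {B : TwistedForm r}
    (hB : B.IsAnisotropic) (hτ : IsDoubleCover p τ) (hcov : IsFlat cov)
    (δ : Path.Homotopic.Quotient y₀ (τ y₀)) (htwist : B.twist = twistLoop δ)
    (helement : B.element = hτ.squareLoop δ) (hscalar : B.scalar * B.scalar = 1)
    (f : M ≃ₗ[ℂ] V y₀)
    (hf : ∀ (a : Path.Homotopic.Quotient y₀ y₀) c, hcov.transport a (f c) = f (r a c)) :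
    ∃ (m : ℕ) (W : Fin m → ∀ y, Submodule ℂ (V y)),
      (∀ j, IsFlatSubbundle cov (W j)) ∧
      (∀ y, DirectSum.IsInternal (fun j => W j y)) ∧
      (∀ j, IsIrreducibleFlat cov (W j)) ∧
      (∀ i j, i ≠ j → ¬ FlatIsomorphic cov (W i) (W j)) ∧
      (∃ Φ, IsInvariantPairing cov τ B.scalar (fun _ => ⊤) Φ) ∧
      (∀ Φ, IsInvariantPairing cov τ B.scalar (fun _ => ⊤) Φ →
        (∀ i j, i ≠ j → ∀ y, ∀ v ∈ W i y, ∀ w ∈ W j (τ y), Φ y (τ y) v w = 0) ∧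
        ∀ j, IsInvariantPairing cov τ B.scalar (W j) Φ) := by
  obtain ⟨m, W, hW, -⟩ := hB.exists_decomposition
  have hpar : ∀ j, hcov.IsParallel (hcov.subbundle f (W j)) := fun j =>
    hcov.isParallel_subbundle hf (W j)
  have hflat : ∀ j, IsFlatSubbundle cov (hcov.subbundle f (W j)) := fun j =>
    (hpar j).isFlatSubbundle
  have hint : ∀ y, DirectSum.IsInternal (fun j => hcov.subbundle f (W j) y) := by
    refine hcov.isInternal_of_isParallel hpar (x := y₀) ?_
    simp only [hcov.subbundle_self hf]
    exact isInternal_map hW.1 f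
  refine ⟨m, fun j => hcov.subbundle f (W j), hflat, hint,
    fun j => hcov.isIrreducibleFlat_subbundle hf (hW.2.1 j), fun i j hij h => ?_, ?_, ?_⟩
  · have := hW.2.2 i j hij
    exact this.false (hcov.nonempty_equiv_of_flatIsomorphic hf (hflat i) h).some
  · have hfs : ∀ (a : Path.Homotopic.Quotient y₀ y₀) v,
        f.symm (hcov.transport a v) = r a (f.symm v) := by
      intro a v
      rw [LinearEquiv.symm_apply_eq, ← hf, LinearEquiv.apply_symm_apply]
    -- The arguments are exchanged because the twist acts on the first argument of `B`, whereas `τ`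
    -- is applied to the path of the second argument of the pairing.
    let K : V y₀ →ₗ[ℂ] V y₀ →ₗ[ℂ] ℂ :=
      B.form.flip.compl₁₂ (f.symm : V y₀ →ₗ[ℂ] _) (f.symm : V y₀ →ₗ[ℂ] _)
    have hKB : ∀ v w, K v w = B.form (f.symm w) (f.symm v) := fun v w => rfl
    refine ⟨hcov.pairing δ K, hcov.isInvariantPairing_pairing hτ ?_ ?_ ?_ ?_⟩
    · intro a v w
      rw [hKB, hKB, hfs, hfs, ← B.invariant a (f.symm w), htwist]
      rfl
    · intro v w
      rw [hKB, hKB, hfs, B.flip (f.symm v) (f.symm w), ← mul_assoc, hscalar, one_mul, helement]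
    · intro v h
      rw [← LinearEquiv.map_eq_zero_iff f.symm]
      refine B.nondegenerate _ fun w => ?_
      have := h (f w)
      rwa [hKB, LinearEquiv.symm_apply_apply] at this
    · intro w h
      rw [← LinearEquiv.map_eq_zero_iff f.symm]
      refine B.nondegenerate _ fun v => ?_
      have := h (f (r B.element v))
      rw [hKB, LinearEquiv.symm_apply_apply] at this
      rw [B.flip, this, mul_zero]
  · intro Φ hΦ
    have hort : ∀ i j, i ≠ j → ∀ y, ∀ v ∈ hcov.subbundle f (W i) y,
        ∀ w ∈ hcov.subbundle f (W j) (τ y), Φ y (τ y) v w = 0 := by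
      intro i j hij y v hv w hw
      -- The value of `Φ` at the base point, with its second argument brought to `y₀` along `δ` and
      -- the two arguments exchanged, so that its invariance is that of `B`.
      let C : M →ₗ[ℂ] M →ₗ[ℂ] ℂ :=
        ((Φ y₀ (τ y₀)).compl₁₂ (f : M →ₗ[ℂ] V y₀)
          ((f.trans (hcov.transport δ) : M ≃ₗ[ℂ] V (τ y₀)) :
            M →ₗ[ℂ] V (τ y₀))).flip
      have hC : ∀ c d, C c d = Φ y₀ (τ y₀) (f d) (hcov.transport δ (f c)) := fun c d => rfl
      have hCinv : ∀ a c d, C (r (B.twist a) c)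
          (r a d) = C c d := by
        intro a c d
        refine Eq.trans ?_ (hΦ.transport_eq hcov a (f d) (hcov.transport δ (f c)))
        rw [hC, htwist, ← hf a d, ← hf (twistLoop δ a) c, twistLoop]
        congr 1
        simp only [hcov.transport_trans, hcov.transport_symm, LinearEquiv.apply_symm_apply]
      obtain ⟨γ⟩ := PathConnectedSpace.joined y₀ y
      let q : Path.Homotopic.Quotient y₀ y := .mk γ
      obtain ⟨v, rfl⟩ := (hcov.transport q).surjective v
      obtain ⟨w, rfl⟩ := (hcov.transport (q.map τ)).surjective w
      rw [(hpar i).transport_mem_iff] at hv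
      rw [(hpar j).transport_mem_iff] at hw
      rw [hΦ.transport_eq hcov]
      obtain ⟨w, rfl⟩ := (hcov.transport δ).surjective w
      rw [(hpar j).transport_mem_iff] at hw
      obtain ⟨c, rfl⟩ := f.surjective v
      obtain ⟨d, rfl⟩ := f.surjective w
      rw [hcov.mem_subbundle_self hf] at hv hw
      exact hW.form_eq_zero hB C hCinv hij.symm hw hv
    exact ⟨hort, hΦ.of_isInternal hint hort⟩

/-- The form is that of `x = ρ(loop δ)`, which lies off `GL_n` because the loop does not lift to a
loop. Its twist and its square are computed by `twistLoop` and `squareLoop`. -/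
theorem exists_flat_decomposition {n : ℕ} (σ : OuterInvolution n ℂ) {ε : ℂ} (hε : σ.HasSign ε)
    (b : Module.Basis (Fin n) ℂ (V y₀)) (ρ : FundamentalGroup X (p y₀) →* σ.Ext)
    (hτ : IsDoubleCover p τ) (hcov : IsFlat cov)
    (hρ : σ.IsExtRep (FundamentalGroup.map p y₀).range ρ) (hirr : σ.IsIrreducibleRep ρ)
    (hmon : HasMonodromy cov b (fun a => (ρ (FundamentalGroup.map p y₀ a)).left)) :
    ∃ (m : ℕ) (W : Fin m → ∀ y, Submodule ℂ (V y)),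
      (∀ j, IsFlatSubbundle cov (W j)) ∧
      (∀ y, DirectSum.IsInternal (fun j => W j y)) ∧
      (∀ j, IsIrreducibleFlat cov (W j)) ∧
      (∀ i j, i ≠ j → ¬ FlatIsomorphic cov (W i) (W j)) ∧
      (∃ Φ, IsInvariantPairing cov τ ε (fun _ => ⊤) Φ) ∧
      (∀ Φ, IsInvariantPairing cov τ ε (fun _ => ⊤) Φ →
        (∀ i j, i ≠ j → ∀ y, ∀ v ∈ W i y, ∀ w ∈ W j (τ y), Φ y (τ y) v w = 0) ∧
        ∀ j, IsInvariantPairing cov τ ε (W j) Φ) := by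
  obtain ⟨hε1, A, hA, hAε⟩ := hε
  have hεε : ε * ε = 1 := by
    rcases hε1 with rfl | rfl <;> norm_num
  -- Inverting `ᵗA = ε A` and using `ε² = 1` identifies the scalar of the flip rule with the sign of
  -- `σ`.
  have hc : (A⁻¹).valᵀ = ε • (A⁻¹).val := by
    have h1 : A.valᵀ * (A⁻¹).valᵀ = 1 := by
      rw [← Matrix.transpose_mul, ← Units.val_mul, inv_mul_cancel, Units.val_one,
        Matrix.transpose_one]
    have h2 : (A⁻¹).val * A.val = 1 := by
      rw [← Units.val_mul, inv_mul_cancel, Units.val_one]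
    rw [hAε, Matrix.smul_mul] at h1
    have h3 := congrArg (fun M => ε • ((A⁻¹).val * M)) h1
    simpa only [Matrix.mul_smul, ← Matrix.mul_assoc, h2, Matrix.one_mul, smul_smul, hεε, one_smul,
      Matrix.mul_one] using h3
  obtain ⟨γ₀⟩ := PathConnectedSpace.joined y₀ (τ y₀)
  let δ : Path.Homotopic.Quotient y₀ (τ y₀) := .mk γ₀
  have hδ : hτ.loop δ ∉ (FundamentalGroup.map p y₀).range := hτ.loop_notMem_range δ
  have hx : (ρ (hτ.loop δ)).right ≠ 1 := fun h => hδ ((hρ _).1 h)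
  let φ : FundamentalGroup Y y₀ →* GLn n ℂ :=
    hρ.underlying.comp (FundamentalGroup.map p y₀).rangeRestrict
  have hφ : ∀ a, SemidirectProduct.inl (φ a) = ρ (FundamentalGroup.map p y₀ a) := fun a =>
    (hρ.eq_inl ⟨_, a, rfl⟩).symm
  have hβ : ∀ a, ρ (hτ.loop δ) * SemidirectProduct.inl (φ (twistLoop δ a)) * (ρ (hτ.loop δ))⁻¹ =
      SemidirectProduct.inl (φ a) := by
    intro a
    rw [hφ, hφ, hτ.map_twistLoop, ← map_inv, ← map_mul, ← map_mul]
    congr 1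
    group
  have hs : ρ (hτ.loop δ) * ρ (hτ.loop δ) = SemidirectProduct.inl (φ (hτ.squareLoop δ)) := by
    rw [hφ, hτ.map_squareLoop, map_mul]
  let B := extForm hA hc hx φ (twistLoop δ) hβ (hτ.squareLoop δ) hs
  have hB : B.IsAnisotropic := by
    refine extForm_isAnisotropic hA hc hx φ (twistLoop δ) hβ (hτ.squareLoop δ) hs hirr
      (zariskiClosure_mono ((range_le_closure hρ hδ).trans (Subgroup.closure_mono ?_)))
    refine Set.union_subset_union_left _ ?_
    rintro _ ⟨⟨_, a, rfl⟩, rfl⟩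
    exact ⟨a, rfl⟩
  exact TwistedForm.exists_flat_decomposition hB hτ hcov δ rfl rfl hεε b.equivFun.symm fun a c =>
    hmon.transport_eq hcov a c

end FlatDecomposition

end TwistedGL

theorem mainTheorem5 :
    -- irreducible subgroups of `GL_n ⋊ ⟨σ⟩`
    (∀ (k : Type*) [Field k] [IsAlgClosed k], (2 : k) ≠ 0 →
      ∀ (n : ℕ) (σ : TwistedGL.OuterInvolution n k)
        (H₀ : Subgroup (TwistedGL.GLn n k)) (x : σ.Ext) (H : Subgroup σ.Ext),
        x.right ≠ 1 →
        σ.IsSemisimpleElement x →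
        x ∈ Subgroup.normalizer ((H₀.map SemidirectProduct.inl : Subgroup σ.Ext) : Set σ.Ext) →
        x ^ 2 ∈ (H₀.map SemidirectProduct.inl : Subgroup σ.Ext) →
        H = Subgroup.closure
          (((H₀.map SemidirectProduct.inl : Subgroup σ.Ext) : Set σ.Ext) ∪ {x}) →
        σ.IsIrreducible H →
        ∃ (m : ℕ)
          (W : Fin m → Subrepresentation ((TwistedGL.naturalRep n k).comp H₀.subtype)),
          TwistedGL.IsMultiplicityFreeDecomposition W ∧
          ∃ e : (Fin m → rootsOfUnity 2 k) ≃*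
              ((Subgroup.centralizer (H : Set σ.Ext)).comap
                (SemidirectProduct.inl : TwistedGL.GLn n k →* σ.Ext)),
            ∀ (ε : Fin m → rootsOfUnity 2 k) (j : Fin m), ∀ v ∈ (W j).toSubmodule,
              ((e ε : TwistedGL.GLn n k).val).mulVec v = ((ε j : kˣ) : k) • v) ∧
    -- the underlying representation of an irreducible `GL_n ⋊ ⟨σ⟩`-representation
    (∀ (k : Type*) [Field k] [IsAlgClosed k], (2 : k) ≠ 0 →
      ∀ (n : ℕ) (σ : TwistedGL.OuterInvolution n k)
        (D : Type*) [Group D] (N : Subgroup D) [N.Normal] (_hN : N.index = 2)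
        (ρ : D →* σ.Ext) (hρ : σ.IsExtRep N ρ),
        σ.IsIrreducibleRep ρ →
        ∃ (m : ℕ) (W : Fin m → Subrepresentation hρ.underlyingRep),
          TwistedGL.IsMultiplicityFreeDecomposition W ∧
          (∀ j, TwistedGL.IsGammaInvariant N (W j).toRepresentation) ∧
          (∀ γ : D, γ ∉ N → ∀ j, ∀ g ∈ TwistedGL.blockFactor (fun i => (W i).toSubmodule) j,
            ∃ g' ∈ TwistedGL.blockFactor (fun i => (W i).toSubmodule) j,
              ρ γ * SemidirectProduct.inl g * (ρ γ)⁻¹ = SemidirectProduct.inl g')) ∧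
    -- the underlying flat connection of an irreducible `GL_n ⋊ ⟨σ⟩`-representation
    (∀ (n : ℕ) (σ : TwistedGL.OuterInvolution n ℂ) (ε : ℂ), σ.HasSign ε →
      ∀ (E : Type*) [NormedAddCommGroup E] [NormedSpace ℂ E] [FiniteDimensional ℂ E]
        (Y : Type*) [TopologicalSpace Y] [T2Space Y] [ConnectedSpace Y] [ChartedSpace E Y]
        [IsManifold (modelWithCornersSelf ℂ E) ω Y]
        (X : Type*) [TopologicalSpace X] [T2Space X] (p : C(Y, X))
        (τ : Diffeomorph (modelWithCornersSelf ℂ E) (modelWithCornersSelf ℂ E) Y Y ω)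
        (F : Type*) [NormedAddCommGroup F] [NormedSpace ℂ F] [FiniteDimensional ℂ F]
        (V : Y → Type*) [TopologicalSpace (Bundle.TotalSpace F V)]
        [∀ y, AddCommGroup (V y)] [∀ y, Module ℂ (V y)] [∀ y, TopologicalSpace (V y)]
        [∀ y, IsTopologicalAddGroup (V y)] [∀ y, ContinuousSMul ℂ (V y)]
        [FiberBundle F V] [VectorBundle ℂ F V]
        [ContMDiffVectorBundle ω F V (modelWithCornersSelf ℂ E)]
        (cov : CovariantDerivative (modelWithCornersSelf ℂ E) F V)
        (y₀ : Y) (b : Module.Basis (Fin n) ℂ (V y₀))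
        (ρ : FundamentalGroup X (p y₀) →* σ.Ext),
        TwistedGL.IsDoubleCover p τ →
        TwistedGL.IsFlat cov →
        σ.IsExtRep (FundamentalGroup.map p y₀).range ρ →
        σ.IsIrreducibleRep ρ →
        TwistedGL.HasMonodromy cov b (fun a => (ρ (FundamentalGroup.map p y₀ a)).left) →
        ∃ (m : ℕ) (W : Fin m → ∀ y, Submodule ℂ (V y)),
          (∀ j, TwistedGL.IsFlatSubbundle cov (W j)) ∧
          (∀ y, DirectSum.IsInternal (fun j => W j y)) ∧
          (∀ j, TwistedGL.IsIrreducibleFlat cov (W j)) ∧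
          (∀ i j, i ≠ j → ¬ TwistedGL.FlatIsomorphic cov (W i) (W j)) ∧
          (∃ Φ, TwistedGL.IsInvariantPairing cov τ ε (fun _ => ⊤) Φ) ∧
          (∀ Φ, TwistedGL.IsInvariantPairing cov τ ε (fun _ => ⊤) Φ →
            (∀ i j, i ≠ j → ∀ y, ∀ v ∈ W i y, ∀ w ∈ W j (τ y), Φ y (τ y) v w = 0) ∧
            ∀ j, TwistedGL.IsInvariantPairing cov τ ε (W j) Φ)) := by
  refine ⟨fun k _ _ _ n σ H₀ x H hx _ hnorm hsq hH hirr =>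
      TwistedGL.exists_decomposition_and_centralizer σ H₀ x H hx hnorm hsq hH hirr,
    fun k _ _ _ n σ D _ N _ hN ρ hρ hirr =>
      TwistedGL.exists_decomposition_underlyingRep σ N hN ρ hρ hirr, ?_⟩
  intro n σ ε hε E _ _ _ Y _ _ _ _ _ X _ _ p τ F _ _ _ V _ _ _ _ _ _ _ _ _ cov y₀ b ρ hτ hcov hρ
    hirr hmon
  -- Local path connectedness of `Y` comes from its charts in a real normed space; with
  -- connectedness it gives path connectedness.
  let _ : NormedSpace ℝ E := NormedSpace.complexToReal
  have : LocallyPathConnectedSpace Y := ChartedSpace.locallyPathConnectedSpace E Y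
  have : PathConnectedSpace Y := pathConnectedSpace_iff_connectedSpace.2 inferInstance
  have : ContMDiffVectorBundle 1 F V (modelWithCornersSelf ℂ E) :=
    ContMDiffVectorBundle.of_le (n := ω) le_top
  have : IsManifold (modelWithCornersSelf ℂ E) 1 Y := IsManifold.of_le (n := ω) le_top
  exact TwistedGL.exists_flat_decomposition (τ := ⟨τ, τ.continuous⟩) σ hε b ρ hτ hcov hρ hirr hmon
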